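/- **Setting.** Let $\mathcal N\subseteq\mathbb Z^d$ (for instance $\mathcal N=\mathbb Z^d$ or $\mathbb N^d$), $\mathcal Z=\mathcal N\times\{\pm1\}$, and for $j=(a,\delta)\in\mathcal Z$ put $\overline j=(a,-\delta)$ and $|j|=|a|=\max(1,a_1^2+\dots+a_d^2)^{1/2}$. For $s\ge 0$ let $\ell^1_s$ be the space of $z\in\mathbb C^{\mathcal Z}$ with $\|z\|_{\ell^1_s}=\sum_{j}|j|^s|z_j|<\infty$; write $\xi_a=z_{(a,1)}$, $\eta_a=z_{(a,-1)}$, and $B^s_M=\{z:\|z\|_{\ell^1_s}\le M\}$. A Hamiltonian $H$ has the vector field $X_H$ given by $\dot\xi_a=-i\,\partial H/\partial\eta_a$, $\dot\eta_a=i\,\partial H/\partial\xi_a$, and $\Phi_H^t$ denotes the flow of $X_H$ in $\ell^1_s$. For $k\ge2$, $\mathcal P_k$ is the set of polynomial Hamiltonians $P(z)=\sum_{\ell=2}^k\sum_{j\in\mathcal Z^\ell}a_j z_{j_1}\cdots z_{j_\ell}$ with bounded coefficients, such that $a_j\ne0$ implies zero momentum $\delta_1a_1+\dots+\delta_\ell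 a_\ell=0$ (where $j_i=(a_i,\delta_i)$), and real: $a_{\overline j}=\overline{a_j}$. $\mathcal{SP}_k\subset\mathcal P_k$ consists of those $P$ for which $a_j\neq0$ implies that $j$ contains as many indices with $\delta_i=+1$ as with $\delta_i=-1$. Let $(\omega_a)_{a\in\mathcal N}$ be real frequencies that are bounded below. Let $\beta:\mathbb R\to\mathbb R$ be a filter function: $\beta(0)=0$, $\beta'(0)=1$, and $\beta$ is strictly increasing on $[0,\infty)$ (for instance $\beta(x)=x$, standard splitting, or $\beta(x)=2\arctan(x/2)$, midpoint splitting). For $y>0$ let $\beta^{-1}(y)=\sup\{x\ge0:\beta(x)<y\}\in(0,+\infty]$. For $c\in\mathbb R$ put $\alpha(x)=\beta(x)\mathbf 1_{x<c}(x)$ and $\lambda_a=\alpha(h\omega_a)$, and let $\Phi^1_{A_0}$ be the time-one flow of $A_0=\sum_a\lambda_a\xi_a\eta_a$, i.e. $\xi_a\mapsto e^{-i\lambda_a}\xi_a$, $\eta_a\mapsto e^{i\lambda_a}\eta_a$. **Theorem.** Let $r_0\ge3$ and $r\ge r_0$ be integers, $s\ge0$, $M>0$, and $P\in\mathcal P_{r_0}$.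 Assume that $$c<c_r:=\beta^{-1}\Big(\frac{2\pi}{r}\Big).$$ Then there are constants $h_0>0$ and $C_r$ such that for every $0<h\le h_0$ there is a real polynomial Hamiltonian $H_h\in\mathcal P_r$ such that for all $z\in B^s_M$ the flows $\Phi_P^h(\Phi^1_{A_0}(z))$ and $\Phi^h_{H_h}(z)$ exist and $$\big\|\Phi_P^h\circ\Phi_{A_0}^1(z)-\Phi_{H_h}^h(z)\big\|_{\ell^1_s}\le C_r\,h^{N(r)},\qquad N(r)=\Big\lfloor\frac{r-2}{r_0-2}\Big\rfloor+1 .$$ If moreover $P\in\mathcal{SP}_{r_0}$ and $\omega_a\ge0$ for all $a\in\mathcal N$, the same conclusion holds under the weaker condition $c<\beta^{-1}(4\pi/r)$. -/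

import Mathlib

noncomputable section

namespace SplittingBEA

/-! ### Indices, phase space -/

/-- The index set `𝒵 = 𝒩 × {±1}`, where `𝒩` is a set of modes in `ℤ^d`
(for instance all of `ℤ^d`, or `ℕ^d`). For `z : Idx 𝒩 → ℂ`, `ξ_a = z (a, 1)` and
`η_a = z (a, -1)`. -/
abbrev Idx {d : ℕ} (𝒩 : Set (Fin d → ℤ)) : Type := 𝒩 × ℤˣ

variable {d : ℕ} {𝒩 : Set (Fin d → ℤ)}

/-- The conjugate index `(a, δ) ↦ (a, -δ)`. -/
def Idx.bar (j : Idx 𝒩) : Idx 𝒩 := (j.1, -j.2)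

/-- `|j| = |a| = max(1, a₁² + ⋯ + a_d²)^{1/2}` for `j = (a, δ)`. -/
def Idx.size (j : Idx 𝒩) : ℝ := Real.sqrt (max 1 (∑ i, ((j.1 : Fin d → ℤ) i : ℝ) ^ 2))

lemma Idx.size_pos (j : Idx 𝒩) : 0 < j.size :=
  Real.sqrt_pos.mpr (lt_of_lt_of_le one_pos (le_max_left _ _))

/-- The linear space of all `z ∈ ℂ^𝒵` with `∑_j |j|^s |z_j| < ∞`. -/
def ellOneSubmodule (𝒩 : Set (Fin d → ℤ)) (s : ℝ) : Submodule ℂ (Idx 𝒩 → ℂ) where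
  carrier := {z | Summable fun j => j.size ^ s * ‖z j‖}
  zero_mem' := by simp [summable_zero]
  add_mem' := by
    intro z y hz hy
    refine Summable.of_nonneg_of_le (fun j => ?_) (fun j => ?_) (Summable.add hz hy)
    · have := j.size_pos; positivity
    · have := j.size_pos
      rw [← mul_add]
      exact mul_le_mul_of_nonneg_left (norm_add_le _ _) (by positivity)
  smul_mem' := by
    intro c z hz
    refine (Summable.mul_left ‖c‖ hz).congr (fun j => ?_)
    simp only [Pi.smul_apply, norm_smul]
    ring

/-- The weighted space `ℓ¹_s(𝒵, ℂ)`. -/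
def EllOne (𝒩 : Set (Fin d → ℤ)) (s : ℝ) : Type := ellOneSubmodule 𝒩 s

namespace EllOne

variable {s : ℝ}

instance : AddCommGroup (EllOne 𝒩 s) := inferInstanceAs (AddCommGroup (ellOneSubmodule 𝒩 s))

instance : Module ℂ (EllOne 𝒩 s) := inferInstanceAs (Module ℂ (ellOneSubmodule 𝒩 s))

/-- The sequence `(z_j)_{j ∈ 𝒵}` underlying an element of `ℓ¹_s`. -/
def coord (z : EllOne 𝒩 s) : Idx 𝒩 → ℂ := z.1

lemma summable (z : EllOne 𝒩 s) : Summable fun j => j.size ^ s * ‖z.coord j‖ := z.2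

/-- The norm `‖z‖ = ∑_j |j|^s |z_j|` of `ℓ¹_s`. -/
instance : NormedAddCommGroup (EllOne 𝒩 s) :=
  AddGroupNorm.toNormedAddCommGroup
    { toFun := fun z => ∑' j, j.size ^ s * ‖z.coord j‖
      map_zero' := by
        have h : ∀ j, (0 : EllOne 𝒩 s).coord j = 0 := fun _ => rfl
        simp [h]
      add_le' := by
        intro z y
        rw [← Summable.tsum_add z.summable y.summable]
        refine Summable.tsum_le_tsum (fun j => ?_) (z + y).summable
          (z.summable.add y.summable)
        have := j.size_pos
        rw [← mul_add]
        exact mul_le_mul_of_nonneg_left (norm_add_le (z.coord j) (y.coord j)) (by positivity)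
      neg' := by
        intro z
        have h : ∀ j, (-z).coord j = -(z.coord j) := fun _ => rfl
        simp [h]
      eq_zero_of_map_eq_zero' := by
        intro z hz
        have hnn : ∀ j : Idx 𝒩, 0 ≤ j.size ^ s * ‖z.coord j‖ := fun j => by
          have := j.size_pos; positivity
        have h0 := (hasSum_zero_iff_of_nonneg hnn).mp (hz ▸ z.summable.hasSum)
        refine Subtype.ext (funext fun j => ?_)
        have hj := congrFun h0 j
        have hp : j.size ^ s ≠ 0 := (Real.rpow_pos_of_pos j.size_pos s).ne'
        exact norm_eq_zero.mp ((mul_eq_zero.mp hj).resolve_left hp) }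

lemma norm_def (z : EllOne 𝒩 s) : ‖z‖ = ∑' j, j.size ^ s * ‖z.coord j‖ := rfl

instance : NormedSpace ℂ (EllOne 𝒩 s) where
  norm_smul_le := by
    intro c z
    have h : ∀ j, (c • z).coord j = c * z.coord j := fun _ => rfl
    rw [norm_def, norm_def, ← tsum_mul_left]
    refine le_of_eq (tsum_congr fun j => ?_)
    rw [h, norm_mul]
    ring

end EllOne

/-! ### Hamiltonian vector fields and flows -/

/-- The complex partial derivative `∂H/∂z_j` at `z`. -/
def partialDeriv (H : (Idx 𝒩 → ℂ) → ℂ) (z : Idx 𝒩 → ℂ) (j : Idx 𝒩) : ℂ :=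
  deriv (fun w : ℂ => H (Function.update z j w)) (z j)

/-- The Hamiltonian vector field `X_H = J ∇H`: the `ξ_a`-component is `-i ∂H/∂η_a`
and the `η_a`-component is `i ∂H/∂ξ_a`. -/
def hamField (H : (Idx 𝒩 → ℂ) → ℂ) (z : Idx 𝒩 → ℂ) (j : Idx 𝒩) : ℂ :=
  -Complex.I * ((j.2 : ℤ) : ℂ) * partialDeriv H z j.bar

/-- `u` solves `u' = X_H(u)` in `ℓ¹_s` on `[0, T]`: at each time the vector `X_H(u(t))` lies in
`ℓ¹_s` and is the derivative of `u` there for the norm of `ℓ¹_s`. -/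
def IsTrajectory {s : ℝ} (H : (Idx 𝒩 → ℂ) → ℂ) (T : ℝ) (u : ℝ → EllOne 𝒩 s) : Prop :=
  ∀ t ∈ Set.Icc (0 : ℝ) T, ∃ v : EllOne 𝒩 s,
    (∀ j, v.coord j = hamField H (u t).coord j) ∧
      HasDerivWithinAt u v (Set.Icc 0 T) t

/-- `Φ_H^T(z) = w`. -/
def FlowsTo {s : ℝ} (H : (Idx 𝒩 → ℂ) → ℂ) (T : ℝ) (z w : EllOne 𝒩 s) : Prop :=
  ∃ u : ℝ → EllOne 𝒩 s, u 0 = z ∧ u T = w ∧ IsTrajectory H T u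

/-! ### Polynomial Hamiltonians -/

/-- The momentum `a₁ δ₁ + ⋯ + a_ℓ δ_ℓ` of a multi-index. -/
def momentum {l : ℕ} (j : Fin l → Idx 𝒩) : Fin d → ℤ :=
  ∑ i, ((j i).2 : ℤ) • ((j i).1 : Fin d → ℤ)

/-- The class `𝒫_k`: real polynomial Hamiltonians of degree at most `k`, with a zero of order at
least 2 at the origin, bounded coefficients, and monomials of zero momentum only. -/
structure PolyHam (𝒩 : Set (Fin d → ℤ)) (k : ℕ) where
  /-- the coefficient `a_j` of `z_{j₁} ⋯ z_{j_ℓ}` -/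
  coeff : (l : ℕ) → (Fin l → Idx 𝒩) → ℂ
  degree : ∀ l j, coeff l j ≠ 0 → 2 ≤ l ∧ l ≤ k
  zero_momentum : ∀ l j, coeff l j ≠ 0 → momentum j = 0
  real : ∀ l j, coeff l (fun i => (j i).bar) = (starRingEnd ℂ) (coeff l j)
  bounded : ∃ C : ℝ, ∀ l j, ‖coeff l j‖ ≤ C

/-- `P(z) = ∑_{ℓ=2}^k ∑_{j ∈ 𝒵^ℓ} a_j z_{j₁} ⋯ z_{j_ℓ}`; the inner series converges absolutely
for `z` in `ℓ¹_s`, `s ≥ 0`. -/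
def PolyHam.eval {k : ℕ} (P : PolyHam 𝒩 k) (z : Idx 𝒩 → ℂ) : ℂ :=
  ∑ l ∈ Finset.Icc 2 k, ∑' j : Fin l → Idx 𝒩, P.coeff l j * ∏ i, z (j i)

/-- The subclass `𝒮𝒫_k` of `𝒫_k`: each monomial contains as many `ξ`'s as `η`'s. -/
def PolyHam.IsSymmetric {k : ℕ} (P : PolyHam 𝒩 k) : Prop :=
  ∀ l j, P.coeff l j ≠ 0 →
    (Finset.univ.filter fun i => (j i).2 = 1).card =
      (Finset.univ.filter fun i => (j i).2 = -1).card

/-! ### Splitting schemes with a CFL condition -/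

/-- A filter function: `β(0) = 0`, `β(x) ≃ x` for small `x`, and `β` is strictly increasing on
`[0, ∞)`. The examples are `β(x) = x` and `β(x) = 2 arctan(x/2)`. -/
structure IsFilterFunction (β : ℝ → ℝ) : Prop where
  map_zero : β 0 = 0
  hasDerivAt_zero : HasDerivAt β 1 0
  strictMonoOn : StrictMonoOn β (Set.Ici 0)

/-- The number `β⁻¹(y)` for a filter function `β` and `y > 0`, equal to `+∞` if `β` stays
below `y`. -/
def filterInv (β : ℝ → ℝ) (y : ℝ) : EReal :=
  sSup ((fun x : ℝ => (x : EReal)) '' {x : ℝ | 0 ≤ x ∧ β x < y})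

open Classical in
/-- `α(x) = β(x) 1_{x < c}`. -/
def cflFilter (β : ℝ → ℝ) (c x : ℝ) : ℝ := if x < c then β x else 0

/-- The time-one flow of the Hamiltonian `∑_a λ_a ξ_a η_a`:
`ξ_a ↦ exp(-i λ_a) ξ_a`, `η_a ↦ exp(i λ_a) η_a`. -/
def phaseFlow {s : ℝ} (lam : 𝒩 → ℝ) (z : EllOne 𝒩 s) : EllOne 𝒩 s :=
  ⟨fun j => Complex.exp (((-((j.2 : ℤ) : ℝ) * lam j.1 : ℝ) : ℂ) * Complex.I) * z.coord j, by
    refine z.summable.congr (fun j => ?_)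
    rw [norm_mul, Complex.norm_exp_ofReal_mul_I, one_mul]⟩

/-- The linear part `Φ_{A₀}^1` of the scheme with time step `h`: `λ_a = α(h ω_a)`,
`α(x) = β(x) 1_{x < c}`. -/
def linearStep {s : ℝ} (ω : 𝒩 → ℝ) (β : ℝ → ℝ) (c h : ℝ) (z : EllOne 𝒩 s) : EllOne 𝒩 s :=
  phaseFlow (fun a => cflFilter β c (h * ω a)) z

end SplittingBEA

end

/-! ### Weighted sequence spaces, words, and the pairing of coefficients with words -/

noncomputable section

namespace SplittingBEA

open scoped ENNReal

variable {d : ℕ} {𝒩 : Set (Fin d → ℤ)} {s : ℝ}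

/-! The proof interpolates in two variables: the step size $t\in[0,h]$ and an artificial time
$x\in[0,1]$. One seeks $Z(t)=\sum_n t^{n+1}Z_n$ such that, if $u(t,x)$ is the flow at time $x$ of
$A_0+Z(t)$ started at $z$, then $u(t,1)=\Phi_P^t(\Phi_{A_0}^1(z))$. At $t=0$ this holds because
$Z(0)=0$, so it is enough that $\partial_t u(t,1)=X_P(u(t,1))$. Writing $\partial_t
u=X_{W(t,x)}(u)$, equality of the mixed derivatives becomes the zero-curvature equation $$\partial_x
W=\{A_0,W\}+\partial_t Z+\{Z,W\},\qquad W(t,0)=0,\quad W(t,1)=P.$$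

On a monomial $w$, the operator $\{A_0,\cdot\}$ is multiplication by $i\theta_w$ with
$\theta_w=\sum\delta_i\lambda_{a_i}$. With $W=\sum_n t^nW_n$, order $n$ in $t$ is therefore a scalar
linear equation in $x$ for each monomial, solved by Duhamel's formula (`hasDerivAt_genCoeff`). The
condition at $x=1$ determines $Z_n$ after division by $(n+1)\int_0^1e^{i(1-t)\theta}dt$, which is
$(n+1)(e^{i\theta}-1)/(i\theta)$ for $\theta\ne0$ (`genCoeff_one`). This divisor has a bounded
inverse on $|\theta|\le\kappa<2\pi$. The CFL condition provides such a $\kappa$ for all words of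
length at most $r$ (`exists_isNonresonant`); for words with as many $\xi$'s as $\eta$'s, a constant
may be subtracted from all $\lambda_a$ first, which gains a factor 2
(`exists_isNonresonant_of_symmetric`).

The degrees of $Z_n$ and $W_n$ are at most $(n+1)(r_0-2)+2$, so $N=\lfloor(r-2)/(r_0-2)\rfloor$
orders fit in degree $r$. Truncating there leaves a defect $O(h^N)$ in the zero-curvature equation
(`norm_defect_le`). A Gronwall argument in $x$ (`IsTameOn.interpolation`) carries the defect to
$t\mapsto u(t,1)$, and one in $t\in[0,h]$ (`norm_sub_le_of_defect`) gives the error $O(h^{N+1})$.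
The modified Hamiltonian is $H_h=h^{-1}(A_0+Z(h))$. All constants depend on the phases and on the
inverse divisors through norm bounds only (`exists_interp_bound`), hence are uniform in $h$.

The estimates rest on linearity in the coefficients: a polynomial is a bounded function on words,
and its vector field is `hamL F (tensors r z)`, bounded bilinear in the coefficients and the
weighted monomials of $z$. Zero momentum leaves at most two choices for the index of
differentiation, which bounds both vector fields (`norm_hamVec_le`) and brackets
(`norm_bracketFun_le`) with merely bounded coefficients. -/

lemma Idx.one_le_size (j : Idx 𝒩) : 1 ≤ j.size :=
  Real.one_le_sqrt.mpr (le_max_left _ _)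

lemma Idx.one_le_size_rpow [hs : Fact (0 ≤ s)] (j : Idx 𝒩) : 1 ≤ j.size ^ s :=
  Real.one_le_rpow j.one_le_size hs.out

lemma Idx.size_rpow_pos (j : Idx 𝒩) : 0 < j.size ^ s := Real.rpow_pos_of_pos j.size_pos s

@[simp] lemma Idx.size_bar (j : Idx 𝒩) : j.bar.size = j.size := rfl

@[simp] lemma Idx.bar_bar (j : Idx 𝒩) : j.bar.bar = j := by simp [Idx.bar]

@[simp] lemma Idx.bar_fst (j : Idx 𝒩) : j.bar.1 = j.1 := rfl

@[simp] lemma Idx.bar_snd (j : Idx 𝒩) : j.bar.2 = -j.2 := rfl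

/-- Conjugation of indices as an equivalence. -/
def barEquiv (𝒩 : Set (Fin d → ℤ)) : Idx 𝒩 ≃ Idx 𝒩 :=
  ⟨Idx.bar, Idx.bar, Idx.bar_bar, Idx.bar_bar⟩

namespace EllOne

@[simp] lemma coord_zero (j : Idx 𝒩) : (0 : EllOne 𝒩 s).coord j = 0 := rfl

@[simp] lemma coord_add (y z : EllOne 𝒩 s) (j : Idx 𝒩) :
    (y + z).coord j = y.coord j + z.coord j := rfl

@[simp] lemma coord_neg (z : EllOne 𝒩 s) (j : Idx 𝒩) : (-z).coord j = -z.coord j := rfl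

@[simp] lemma coord_sub (y z : EllOne 𝒩 s) (j : Idx 𝒩) :
    (y - z).coord j = y.coord j - z.coord j := by
  rw [sub_eq_add_neg, coord_add, coord_neg, sub_eq_add_neg]

@[simp] lemma coord_smul (c : ℂ) (z : EllOne 𝒩 s) (j : Idx 𝒩) :
    (c • z).coord j = c * z.coord j := rfl

lemma ext {y z : EllOne 𝒩 s} (h : ∀ j, y.coord j = z.coord j) : y = z :=
  Subtype.ext (funext h)

/-- The element of `ℓ¹_s` with given coordinates. -/
def mk (z : Idx 𝒩 → ℂ) (h : Summable fun j => j.size ^ s * ‖z j‖) : EllOne 𝒩 s := ⟨z, h⟩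

@[simp] lemma coord_mk (z : Idx 𝒩 → ℂ) (h : Summable fun j => j.size ^ s * ‖z j‖) (j : Idx 𝒩) :
    (mk z h).coord j = z j := rfl

lemma norm_coord_le [Fact (0 ≤ s)] (z : EllOne 𝒩 s) (j : Idx 𝒩) : ‖z.coord j‖ ≤ ‖z‖ := by
  rw [norm_def]
  refine le_trans ?_ (z.summable.le_tsum j fun i _ =>
    mul_nonneg (Idx.size_rpow_pos i).le (norm_nonneg _))
  exact le_mul_of_one_le_left (norm_nonneg _) j.one_le_size_rpow

/-- The coordinate functionals. -/
def coordL [Fact (0 ≤ s)] (j : Idx 𝒩) : EllOne 𝒩 s →L[ℂ] ℂ :=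
  LinearMap.mkContinuous
    { toFun := fun z => z.coord j
      map_add' := fun _ _ => rfl
      map_smul' := fun _ _ => rfl } 1 fun z => by
    rw [one_mul]; exact z.norm_coord_le j

@[simp] lemma coordL_apply [Fact (0 ≤ s)] (j : Idx 𝒩) (z : EllOne 𝒩 s) :
    coordL j z = z.coord j := rfl

lemma memLp_weighted (z : EllOne 𝒩 s) :
    Memℓp (fun j : Idx 𝒩 => ((j.size ^ s : ℝ) : ℂ) * z.coord j) 1 := by
  refine memℓp_gen ?_
  simp only [ENNReal.toReal_one, Real.rpow_one, norm_mul, Complex.norm_real, Real.norm_eq_abs,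
    abs_of_pos (Idx.size_rpow_pos _)]
  exact z.summable

/-- The isometry of `ℓ¹_s` with the unweighted space. -/
def weightedEquiv (𝒩 : Set (Fin d → ℤ)) (s : ℝ) :
    EllOne 𝒩 s ≃ᵢ lp (fun _ : Idx 𝒩 => ℂ) 1 where
  toFun z := ⟨fun j => ((j.size ^ s : ℝ) : ℂ) * z.coord j, z.memLp_weighted⟩
  invFun f := mk (fun j => ((j.size ^ s : ℝ) : ℂ)⁻¹ * f j) <| by
    refine (f.2.summable (by simp)).congr fun j => ?_
    have := Idx.size_rpow_pos (s := s) j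
    simp only [ENNReal.toReal_one, Real.rpow_one, norm_mul, norm_inv, Complex.norm_real,
      Real.norm_eq_abs, abs_of_pos this]
    field_simp
  left_inv z := ext fun j => by
    have : ((j.size ^ s : ℝ) : ℂ) ≠ 0 := by exact_mod_cast (Idx.size_rpow_pos (s := s) j).ne'
    change ((j.size ^ s : ℝ) : ℂ)⁻¹ * (((j.size ^ s : ℝ) : ℂ) * z.coord j) = _
    field_simp
  right_inv f := by
    refine lp.ext (funext fun j => ?_)
    have : ((j.size ^ s : ℝ) : ℂ) ≠ 0 := by exact_mod_cast (Idx.size_rpow_pos (s := s) j).ne'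
    change ((j.size ^ s : ℝ) : ℂ) * (((j.size ^ s : ℝ) : ℂ)⁻¹ * f j) = _
    field_simp
  isometry_toFun := by
    refine Isometry.of_dist_eq fun y z => ?_
    rw [dist_eq_norm, dist_eq_norm, norm_def, lp.norm_eq_tsum_rpow (by simp)]
    simp only [ENNReal.toReal_one, Real.rpow_one, div_one]
    refine tsum_congr fun j => ?_
    change ‖((j.size ^ s : ℝ) : ℂ) * y.coord j - ((j.size ^ s : ℝ) : ℂ) * z.coord j‖ = _
    rw [← mul_sub, norm_mul, Complex.norm_real, Real.norm_eq_abs,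
      abs_of_pos (Idx.size_rpow_pos _), coord_sub]

/-- Completeness is what Picard–Lindelöf needs in order to produce the flows. -/
instance : CompleteSpace (EllOne 𝒩 s) :=
  (weightedEquiv 𝒩 s).isometry.isUniformInducing.completeSpace_congr
    (weightedEquiv 𝒩 s).surjective |>.mpr inferInstance

open Classical in
/-- The basis vector `e_b` of `ℓ¹_s`. -/
def single (b : Idx 𝒩) : EllOne 𝒩 s :=
  mk (fun j => if j = b then 1 else 0) (summable_of_ne_finset_zero (s := {b}) fun j hj => by
    simp [Finset.notMem_singleton.mp hj])

lemma coord_single_same (b : Idx 𝒩) : (single b : EllOne 𝒩 s).coord b = 1 := if_pos rfl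

lemma coord_single_ne {b j : Idx 𝒩} (h : j ≠ b) : (single b : EllOne 𝒩 s).coord j = 0 := if_neg h

lemma norm_single (b : Idx 𝒩) : ‖(single b : EllOne 𝒩 s)‖ = b.size ^ s := by
  rw [norm_def, tsum_eq_single b fun j hj => by rw [coord_single_ne hj]; simp,
    coord_single_same]
  simp

/-- Diagonal operators with bounded entries. -/
def diag (μ : Idx 𝒩 → ℂ) (C : ℝ) (hμ : ∀ j, ‖μ j‖ ≤ C) : EllOne 𝒩 s →L[ℂ] EllOne 𝒩 s :=
  have key : ∀ (z : EllOne 𝒩 s) (j : Idx 𝒩),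
      j.size ^ s * ‖μ j * z.coord j‖ ≤ C * (j.size ^ s * ‖z.coord j‖) := fun z j => by
    rw [norm_mul, mul_left_comm]
    exact mul_le_mul_of_nonneg_right (hμ j) (mul_nonneg (Idx.size_rpow_pos j).le (norm_nonneg _))
  have sm : ∀ z : EllOne 𝒩 s, Summable fun j => j.size ^ s * ‖μ j * z.coord j‖ := fun z =>
    Summable.of_nonneg_of_le (fun j => mul_nonneg (Idx.size_rpow_pos j).le (norm_nonneg _))
      (key z) (z.summable.mul_left C)
  LinearMap.mkContinuous
    { toFun := fun z => mk (fun j => μ j * z.coord j) (sm z)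
      map_add' := fun y z => ext fun j => by simp [mul_add]
      map_smul' := fun c z => ext fun j => by simp [mul_left_comm] } C fun z => by
    rw [norm_def, norm_def, ← tsum_mul_left]
    exact (sm z).tsum_le_tsum (key z) (z.summable.mul_left C)

@[simp] lemma coord_diag (μ : Idx 𝒩 → ℂ) (C : ℝ) (hμ : ∀ j, ‖μ j‖ ≤ C) (z : EllOne 𝒩 s)
    (j : Idx 𝒩) : (diag μ C hμ z).coord j = μ j * z.coord j := rfl

lemma norm_diag_le (μ : Idx 𝒩 → ℂ) {C : ℝ} (hμ : ∀ j, ‖μ j‖ ≤ C) (hC : 0 ≤ C) :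
    ‖(diag μ C hμ : EllOne 𝒩 s →L[ℂ] EllOne 𝒩 s)‖ ≤ C :=
  ContinuousLinearMap.opNorm_le_bound _ hC fun z => by
    rw [norm_def, norm_def, ← tsum_mul_left]
    refine Summable.tsum_le_tsum (fun j => ?_) (diag μ C hμ z).summable (z.summable.mul_left C)
    rw [coord_diag, norm_mul, mul_left_comm]
    exact mul_le_mul_of_nonneg_right (hμ j) (mul_nonneg (Idx.size_rpow_pos j).le (norm_nonneg _))

lemma summable_norm_coord_mul [Fact (0 ≤ s)] (y : EllOne 𝒩 s) {k : Idx 𝒩 → ℂ} {C : ℝ}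
    (hk : ∀ c, ‖k c‖ ≤ C) : Summable fun c => ‖y.coord c * k c‖ := by
  refine Summable.of_nonneg_of_le (fun c => norm_nonneg _) (fun c => ?_) (y.summable.mul_left C)
  rw [norm_mul, mul_comm]
  exact mul_le_mul (hk c) (le_mul_of_one_le_left (norm_nonneg _) c.one_le_size_rpow)
    (norm_nonneg _) ((norm_nonneg _).trans (hk c))

lemma summable_coord_mul [Fact (0 ≤ s)] (y : EllOne 𝒩 s) {k : Idx 𝒩 → ℂ} {C : ℝ}
    (hk : ∀ c, ‖k c‖ ≤ C) : Summable fun c => y.coord c * k c :=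
  (y.summable_norm_coord_mul hk).of_norm

lemma norm_tsum_coord_mul_le [Fact (0 ≤ s)] (y : EllOne 𝒩 s) {k : Idx 𝒩 → ℂ} {C : ℝ}
    (hk : ∀ c, ‖k c‖ ≤ C) : ‖∑' c, y.coord c * k c‖ ≤ C * ‖y‖ := by
  refine tsum_of_norm_bounded (y.summable.hasSum.mul_left C) fun c => ?_
  rw [norm_mul, mul_comm]
  exact mul_le_mul (hk c) (le_mul_of_one_le_left (norm_nonneg _) c.one_le_size_rpow)
    (norm_nonneg _) ((norm_nonneg _).trans (hk c))

end EllOne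

/-! ### Words -/

/-- The weight `∏ |w_i|^s` of a word. -/
def wt (s : ℝ) (w : List (Idx 𝒩)) : ℝ := (w.map fun j => j.size ^ s).prod

@[simp] lemma wt_nil : wt s ([] : List (Idx 𝒩)) = 1 := rfl

@[simp] lemma wt_cons (c : Idx 𝒩) (w : List (Idx 𝒩)) : wt s (c :: w) = c.size ^ s * wt s w := by
  simp [wt]

lemma wt_pos (w : List (Idx 𝒩)) : 0 < wt s w := by
  induction w with
  | nil => simp
  | cons c w ih => rw [wt_cons]; exact mul_pos c.size_rpow_pos ih

lemma one_le_wt [Fact (0 ≤ s)] (w : List (Idx 𝒩)) : 1 ≤ wt s w := by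
  induction w with
  | nil => simp
  | cons c w ih => rw [wt_cons]; exact one_le_mul_of_one_le_of_one_le c.one_le_size_rpow ih

/-- `ℓ¹` over the words. -/
abbrev WordL1 (𝒩 : Set (Fin d → ℤ)) : Type := lp (fun _ : List (Idx 𝒩) => ℂ) 1

/-- Bounded coefficient families over the words, with the sup norm and the pointwise product. -/
abbrev Coeffs (𝒩 : Set (Fin d → ℤ)) : Type := lp (fun _ : List (Idx 𝒩) => ℂ) ⊤

lemma WordL1.summable (f : WordL1 𝒩) : Summable fun w => ‖f w‖ := by
  simpa using f.2.summable (by simp)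

lemma WordL1.norm_eq (f : WordL1 𝒩) : ‖f‖ = ∑' w, ‖f w‖ := by
  simp [lp.norm_eq_tsum_rpow (p := 1) (by simp) f]

lemma Coeffs.norm_apply_le (F : Coeffs 𝒩) (w : List (Idx 𝒩)) : ‖F w‖ ≤ ‖F‖ :=
  lp.norm_apply_le_norm (by simp) F w

/-- The injection `(c, w) ↦ c :: w`. -/
lemma cons_injective : Function.Injective fun p : Idx 𝒩 × List (Idx 𝒩) => p.1 :: p.2 := by
  rintro ⟨a, v⟩ ⟨b, w⟩ h
  simpa using h

/-- The coordinates of `y ⊗ f`, for the weighted coordinates of `y`. -/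
def consFun (y : EllOne 𝒩 s) (f : WordL1 𝒩) : List (Idx 𝒩) → ℂ
  | [] => 0
  | c :: w => ((c.size ^ s : ℝ) : ℂ) * y.coord c * f w

lemma summable_consFun (y : EllOne 𝒩 s) (f : WordL1 𝒩) :
    Summable (fun p : Idx 𝒩 × List (Idx 𝒩) => (p.1.size ^ s * ‖y.coord p.1‖) * ‖f p.2‖) :=
  y.summable.mul_of_nonneg f.summable
    (fun j => mul_nonneg j.size_rpow_pos.le (norm_nonneg _)) (fun _ => norm_nonneg _)

lemma norm_consFun_cons (y : EllOne 𝒩 s) (f : WordL1 𝒩) (c : Idx 𝒩) (w : List (Idx 𝒩)) :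
    ‖consFun y f (c :: w)‖ = (c.size ^ s * ‖y.coord c‖) * ‖f w‖ := by
  rw [consFun, norm_mul, norm_mul, Complex.norm_real, Real.norm_eq_abs,
    abs_of_pos c.size_rpow_pos]

lemma hasSum_norm_consFun (y : EllOne 𝒩 s) (f : WordL1 𝒩) :
    HasSum (fun w => ‖consFun y f w‖) (‖y‖ * ‖f‖) := by
  rw [← cons_injective.hasSum_iff]
  · rw [EllOne.norm_def, f.norm_eq, y.summable.tsum_mul_tsum f.summable (summable_consFun y f)]
    convert (summable_consFun y f).hasSum using 2 with p
    exact norm_consFun_cons y f p.1 p.2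
  · rintro (_ | ⟨c, w⟩) h
    · simp [consFun]
    · exact absurd ⟨(c, w), rfl⟩ h

/-- The tensor product `y ⊗ f`. -/
def consL (𝒩 : Set (Fin d → ℤ)) (s : ℝ) : EllOne 𝒩 s →L[ℂ] WordL1 𝒩 →L[ℂ] WordL1 𝒩 :=
  LinearMap.mkContinuous₂
    (LinearMap.mk₂ ℂ
      (fun (y : EllOne 𝒩 s) (f : WordL1 𝒩) =>
        (⟨consFun y f, memℓp_gen (by simpa using (hasSum_norm_consFun y f).summable)⟩ : WordL1 𝒩))
      (fun y z f => lp.ext (funext fun w => by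
        change consFun (y + z) f w = consFun y f w + consFun z f w
        rcases w with _ | ⟨c, w⟩
        · simp [consFun]
        · simp [consFun]; ring))
      (fun a y f => lp.ext (funext fun w => by
        change consFun (a • y) f w = a * consFun y f w
        rcases w with _ | ⟨c, w⟩
        · simp [consFun]
        · simp [consFun]; ring))
      (fun y f g => lp.ext (funext fun w => by
        change consFun y (f + g) w = consFun y f w + consFun y g w
        rcases w with _ | ⟨c, w⟩
        · simp [consFun]
        · simp [consFun]; ring))
      (fun a y f => lp.ext (funext fun w => by
        change consFun y (a • f) w = a * consFun y f w
        rcases w with _ | ⟨c, w⟩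
        · simp [consFun]
        · simp [consFun]; ring))) 1 (fun y f => by
      rw [one_mul, WordL1.norm_eq]
      exact (hasSum_norm_consFun y f).tsum_eq.le)

lemma consL_apply (y : EllOne 𝒩 s) (f : WordL1 𝒩) (w : List (Idx 𝒩)) :
    consL 𝒩 s y f w = consFun y f w := rfl

lemma norm_consL_le (y : EllOne 𝒩 s) (f : WordL1 𝒩) : ‖consL 𝒩 s y f‖ ≤ ‖y‖ * ‖f‖ := by
  rw [WordL1.norm_eq]
  exact (hasSum_norm_consFun y f).tsum_eq.le

/-! ### Pairing coefficients with words -/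

/-- `∑_w K(w) f(w) / ∏ |w_i|^s`. -/
def pair (s : ℝ) (K : List (Idx 𝒩) → ℂ) (f : WordL1 𝒩) : ℂ :=
  ∑' w, K w / (wt s w : ℂ) * f w

lemma norm_div_wt_le [Fact (0 ≤ s)] (a : ℂ) (w : List (Idx 𝒩)) : ‖a / (wt s w : ℂ)‖ ≤ ‖a‖ := by
  rw [norm_div, Complex.norm_real, Real.norm_eq_abs, abs_of_pos (wt_pos w)]
  exact div_le_self (norm_nonneg _) (one_le_wt w)

lemma summable_norm_pair [Fact (0 ≤ s)] {K : List (Idx 𝒩) → ℂ} {C : ℝ} (hK : ∀ w, ‖K w‖ ≤ C)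
    (f : WordL1 𝒩) : Summable fun w => ‖K w / (wt s w : ℂ) * f w‖ := by
  refine Summable.of_nonneg_of_le (fun w => norm_nonneg _) (fun w => ?_) (f.summable.mul_left C)
  rw [norm_mul]
  exact mul_le_mul_of_nonneg_right ((norm_div_wt_le _ w).trans (hK w)) (norm_nonneg _)

lemma summable_pair [Fact (0 ≤ s)] {K : List (Idx 𝒩) → ℂ} {C : ℝ} (hK : ∀ w, ‖K w‖ ≤ C)
    (f : WordL1 𝒩) : Summable fun w => K w / (wt s w : ℂ) * f w :=
  (summable_norm_pair hK f).of_norm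

lemma norm_pair_le [Fact (0 ≤ s)] {K : List (Idx 𝒩) → ℂ} {C : ℝ} (hK : ∀ w, ‖K w‖ ≤ C)
    (f : WordL1 𝒩) : ‖pair s K f‖ ≤ C * ‖f‖ := by
  rw [WordL1.norm_eq]
  refine tsum_of_norm_bounded (f.summable.hasSum.mul_left C) fun w => ?_
  rw [norm_mul]
  exact mul_le_mul_of_nonneg_right ((norm_div_wt_le _ w).trans (hK w)) (norm_nonneg _)

/-- Pairing with bounded coefficients as a continuous functional. -/
def pairL [Fact (0 ≤ s)] (K : List (Idx 𝒩) → ℂ) (C : ℝ) (hK : ∀ w, ‖K w‖ ≤ C) :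
    WordL1 𝒩 →L[ℂ] ℂ :=
  LinearMap.mkContinuous
    { toFun := pair s K
      map_add' := fun f g => by
        rw [pair, pair, pair, ← (summable_pair hK f).tsum_add (summable_pair hK g)]
        exact tsum_congr fun w => by simp [mul_add]
      map_smul' := fun a f => by
        rw [pair, pair, RingHom.id_apply, smul_eq_mul, ← tsum_mul_left]
        exact tsum_congr fun w => by simp; ring } C fun f => norm_pair_le hK f

@[simp] lemma pairL_apply [Fact (0 ≤ s)] (K : List (Idx 𝒩) → ℂ) (C : ℝ) (hK : ∀ w, ‖K w‖ ≤ C)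
    (f : WordL1 𝒩) : pairL (s := s) K C hK f = pair s K f := rfl

lemma pair_add [Fact (0 ≤ s)] {K K' : List (Idx 𝒩) → ℂ} {C C' : ℝ} (hK : ∀ w, ‖K w‖ ≤ C)
    (hK' : ∀ w, ‖K' w‖ ≤ C') (f : WordL1 𝒩) :
    pair s (fun w => K w + K' w) f = pair s K f + pair s K' f := by
  rw [pair, pair, pair, ← (summable_pair hK f).tsum_add (summable_pair hK' f)]
  exact tsum_congr fun w => by rw [add_div, add_mul]

lemma pair_const_mul (a : ℂ) (K : List (Idx 𝒩) → ℂ) (f : WordL1 𝒩) :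
    pair s (fun w => a * K w) f = a * pair s K f := by
  rw [pair, pair, ← tsum_mul_left]
  exact tsum_congr fun w => by ring

lemma summable_pair_prod [Fact (0 ≤ s)] {k : Idx 𝒩 → List (Idx 𝒩) → ℂ} {C : ℝ}
    (hk : ∀ c w, ‖k c w‖ ≤ C) (y : EllOne 𝒩 s) (f : WordL1 𝒩) :
    Summable fun p : Idx 𝒩 × List (Idx 𝒩) =>
      y.coord p.1 * (k p.1 p.2 / (wt s p.2 : ℂ) * f p.2) := by
  refine Summable.of_norm_bounded ((summable_consFun y f).mul_left C) fun p => ?_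
  rw [norm_mul, norm_mul]
  have h1 := (norm_div_wt_le (s := s) (k p.1 p.2) p.2).trans (hk p.1 p.2)
  have h2 : ‖y.coord p.1‖ ≤ p.1.size ^ s * ‖y.coord p.1‖ :=
    le_mul_of_one_le_left (norm_nonneg _) p.1.one_le_size_rpow
  calc _ = ‖k p.1 p.2 / (wt s p.2 : ℂ)‖ * (‖y.coord p.1‖ * ‖f p.2‖) := by ring
    _ ≤ C * (p.1.size ^ s * ‖y.coord p.1‖ * ‖f p.2‖) := by
      refine mul_le_mul h1 ?_ (by positivity) ((norm_nonneg _).trans h1)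
      exact mul_le_mul_of_nonneg_right h2 (norm_nonneg _)

lemma tsum_coord_mul_pair [Fact (0 ≤ s)] {k : Idx 𝒩 → List (Idx 𝒩) → ℂ} {C : ℝ}
    (hk : ∀ c w, ‖k c w‖ ≤ C) (y : EllOne 𝒩 s) (f : WordL1 𝒩) :
    ∑' c, y.coord c * pair s (k c) f = pair s (fun w => ∑' c, y.coord c * k c w) f := by
  have h := summable_pair_prod hk y f
  have h' : Summable (Function.uncurry fun (c : Idx 𝒩) (w : List (Idx 𝒩)) =>
    y.coord c * (k c w / (wt s w : ℂ) * f w)) := h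
  have := h'.tsum_comm
  simp only [pair, ← tsum_mul_left]
  rw [← this]
  refine tsum_congr fun w => ?_
  rw [div_mul_eq_mul_div, mul_comm, ← tsum_mul_left, ← tsum_div_const]
  exact tsum_congr fun c => by ring

/-- A nonempty word is its first letter followed by a word, and the weight of the first letter put
in by `consL` cancels against the one in `wt`. This identity drives the inductions on the length of
words. -/
lemma pair_consL [Fact (0 ≤ s)] {K : List (Idx 𝒩) → ℂ} {C : ℝ} (hK : ∀ w, ‖K w‖ ≤ C)
    (y : EllOne 𝒩 s) (f : WordL1 𝒩) :
    pair s K (consL 𝒩 s y f) = ∑' c, y.coord c * pair s (fun w => K (c :: w)) f := by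
  have h := summable_pair_prod (k := fun c w => K (c :: w)) (fun c w => hK _) y f
  simp only [pair, ← tsum_mul_left]
  rw [← h.tsum_prod, ← cons_injective.tsum_eq]
  · refine tsum_congr fun p => ?_
    have h1 : ((p.1.size ^ s : ℝ) : ℂ) ≠ 0 := by exact_mod_cast p.1.size_rpow_pos.ne'
    have h2 : (wt s p.2 : ℂ) ≠ 0 := by exact_mod_cast (wt_pos p.2).ne'
    rw [consL_apply, consFun, wt_cons]
    push_cast
    field_simp
  · rintro (_ | ⟨c, w⟩) hw
    · simp [consL_apply, consFun] at hw
    · exact ⟨(c, w), rfl⟩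

end SplittingBEA

end

/-! ### The universal polynomial map; derivatives and products of coefficient families -/

noncomputable section

namespace SplittingBEA

open scoped ENNReal

variable {d : ℕ} {𝒩 : Set (Fin d → ℤ)} {s : ℝ}

/-! ### The universal polynomial map -/

open Classical in
/-- The map `z ↦ (z_{w_1} ⋯ z_{w_n})_w` (with weights), restricted to words of length at
most `r`. -/
def tensors : ℕ → EllOne 𝒩 s → WordL1 𝒩
  | 0, _ => lp.single 1 [] 1
  | r + 1, z => lp.single 1 [] 1 + consL 𝒩 s z (tensors r z)

/-- The Fréchet derivative of `tensors`. -/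
def tensorsDeriv : ℕ → EllOne 𝒩 s → EllOne 𝒩 s →L[ℂ] WordL1 𝒩
  | 0, _ => 0
  | r + 1, z => (consL 𝒩 s).flip (tensors r z) + (consL 𝒩 s z).comp (tensorsDeriv r z)

lemma tensorsDeriv_succ_apply (r : ℕ) (z y : EllOne 𝒩 s) :
    tensorsDeriv (r + 1) z y = consL 𝒩 s y (tensors r z) + consL 𝒩 s z (tensorsDeriv r z y) := rfl

lemma hasFDerivAt_tensors (r : ℕ) (z : EllOne 𝒩 s) :
    HasFDerivAt (tensors r) (tensorsDeriv r z) z := by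
  induction r with
  | zero => exact hasFDerivAt_const _ _
  | succ r ih =>
    have h := ((consL 𝒩 s).hasFDerivAt_of_bilinear (hasFDerivAt_id z) ih).const_add
      (tensors 0 z)
    refine HasFDerivAt.congr_fderiv h ?_
    ext1 y
    rw [tensorsDeriv_succ_apply]
    simp [add_comm]

lemma exists_norm_tensors_le (𝒩 : Set (Fin d → ℤ)) (s : ℝ) (r : ℕ) (R : ℝ) :
    ∃ C, 0 ≤ C ∧ ∀ z : EllOne 𝒩 s, ‖z‖ ≤ R → ‖tensors r z‖ ≤ C := by
  induction r with
  | zero => exact ⟨_, norm_nonneg _, fun z _ => le_rfl⟩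
  | succ r ih =>
    obtain ⟨C, hC, h⟩ := ih
    refine ⟨‖(tensors 0 (0 : EllOne 𝒩 s))‖ + |R| * C, by positivity, fun z hz => ?_⟩
    refine (norm_add_le _ _).trans (add_le_add le_rfl ((norm_consL_le _ _).trans ?_))
    exact mul_le_mul (hz.trans (le_abs_self R)) (h z hz) (norm_nonneg _) (abs_nonneg R)

lemma exists_norm_tensors_sub_le (𝒩 : Set (Fin d → ℤ)) (s : ℝ) (r : ℕ) (R : ℝ) :
    ∃ C, 0 ≤ C ∧ ∀ z z' : EllOne 𝒩 s, ‖z‖ ≤ R → ‖z'‖ ≤ R →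
      ‖tensors r z' - tensors r z‖ ≤ C * ‖z' - z‖ := by
  induction r with
  | zero => exact ⟨0, le_rfl, fun z z' _ _ => by simp [tensors]⟩
  | succ r ih =>
    obtain ⟨C, hC, h⟩ := ih
    obtain ⟨B, hB, hb⟩ := exists_norm_tensors_le 𝒩 s r R
    refine ⟨B + |R| * C, by positivity, fun z z' hz hz' => ?_⟩
    have e : tensors (r + 1) z' - tensors (r + 1) z =
        consL 𝒩 s (z' - z) (tensors r z') + consL 𝒩 s z (tensors r z' - tensors r z) := by
      simp only [tensors, map_sub, sub_apply]; abel
    rw [e, add_mul]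
    refine (norm_add_le _ _).trans (add_le_add ((norm_consL_le _ _).trans ?_)
      ((norm_consL_le _ _).trans ?_))
    · rw [mul_comm]; exact mul_le_mul_of_nonneg_right (hb z' hz') (norm_nonneg _)
    · rw [mul_assoc]
      exact mul_le_mul (hz.trans (le_abs_self R)) (h z z' hz hz') (norm_nonneg _) (abs_nonneg R)

/-- Bilinearity of the recursion is enough: the second-order remainder of $z\otimes T(z)$ is the
increment of $z$ tensored with the increment of $T$, plus $z$ tensored with the remainder of $T$. -/
lemma exists_norm_tensors_taylor_le (𝒩 : Set (Fin d → ℤ)) (s : ℝ) (r : ℕ) (R : ℝ) :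
    ∃ C, 0 ≤ C ∧ ∀ z z' : EllOne 𝒩 s, ‖z‖ ≤ R → ‖z'‖ ≤ R →
      ‖tensors r z' - tensors r z - tensorsDeriv r z (z' - z)‖ ≤ C * ‖z' - z‖ ^ 2 := by
  induction r with
  | zero => exact ⟨0, le_rfl, fun z z' _ _ => by simp [tensors, tensorsDeriv]⟩
  | succ r ih =>
    obtain ⟨C, hC, h⟩ := ih
    obtain ⟨B, hB, hb⟩ := exists_norm_tensors_sub_le 𝒩 s r R
    refine ⟨B + |R| * C, by positivity, fun z z' hz hz' => ?_⟩
    have e : tensors (r + 1) z' - tensors (r + 1) z - tensorsDeriv (r + 1) z (z' - z) =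
        consL 𝒩 s (z' - z) (tensors r z' - tensors r z) +
          consL 𝒩 s z (tensors r z' - tensors r z - tensorsDeriv r z (z' - z)) := by
      rw [tensorsDeriv_succ_apply]
      simp only [tensors, map_sub, sub_apply]; abel
    rw [e, add_mul]
    refine (norm_add_le _ _).trans (add_le_add ((norm_consL_le _ _).trans ?_)
      ((norm_consL_le _ _).trans ?_))
    · calc _ ≤ ‖z' - z‖ * (B * ‖z' - z‖) :=
          mul_le_mul_of_nonneg_left (hb z z' hz hz') (norm_nonneg _)
        _ = B * ‖z' - z‖ ^ 2 := by ring
    · rw [mul_assoc]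
      exact mul_le_mul (hz.trans (le_abs_self R)) (h z z' hz hz') (norm_nonneg _) (abs_nonneg R)

lemma exists_norm_tensorsDeriv_le (𝒩 : Set (Fin d → ℤ)) (s : ℝ) (r : ℕ) (R : ℝ) :
    ∃ C, 0 ≤ C ∧ ∀ z y : EllOne 𝒩 s, ‖z‖ ≤ R → ‖tensorsDeriv r z y‖ ≤ C * ‖y‖ := by
  induction r with
  | zero => exact ⟨0, le_rfl, fun z z' _ => by simp [tensorsDeriv]⟩
  | succ r ih =>
    obtain ⟨C, hC, h⟩ := ih
    obtain ⟨B, hB, hb⟩ := exists_norm_tensors_le 𝒩 s r R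
    refine ⟨B + |R| * C, by positivity, fun z y hz => ?_⟩
    rw [tensorsDeriv_succ_apply, add_mul]
    refine (norm_add_le _ _).trans (add_le_add ((norm_consL_le _ _).trans ?_)
      ((norm_consL_le _ _).trans ?_))
    · rw [mul_comm]; exact mul_le_mul_of_nonneg_right (hb z hz) (norm_nonneg _)
    · rw [mul_assoc]
      exact mul_le_mul (hz.trans (le_abs_self R)) (h z y hz) (norm_nonneg _) (abs_nonneg R)

lemma tensors_apply (r : ℕ) (z : EllOne 𝒩 s) (w : List (Idx 𝒩)) :
    tensors r z w = if w.length ≤ r then (wt s w : ℂ) * (w.map z.coord).prod else 0 := by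
  induction r generalizing w with
  | zero =>
    rcases w with _ | ⟨c, w⟩
    · simp [tensors]
    · simp [tensors, lp.single_apply]
  | succ r ih =>
    rcases w with _ | ⟨c, w⟩
    · simp [tensors, consL_apply, consFun]
    · have : tensors (r + 1) z (c :: w) = consFun z (tensors r z) (c :: w) := by
        simp [tensors, consL_apply, lp.single_apply]
      rw [this, consFun, ih]
      by_cases h : w.length ≤ r
      · simp [h]; ring
      · simp [h]

/-! ### Polynomial coefficient families -/

/-- Coefficients bounded by `C` and vanishing on words longer than `n`. -/
structure IsPoly (n : ℕ) (C : ℝ) (K : List (Idx 𝒩) → ℂ) : Prop where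
  norm_le : ∀ w, ‖K w‖ ≤ C
  eq_zero : ∀ w, n < w.length → K w = 0

lemma IsPoly.nonneg {n : ℕ} {C : ℝ} {K : List (Idx 𝒩) → ℂ} (h : IsPoly n C K) : 0 ≤ C :=
  (norm_nonneg _).trans (h.norm_le [])

lemma IsPoly.mono {n m : ℕ} {C : ℝ} {K : List (Idx 𝒩) → ℂ} (h : IsPoly n C K) (hnm : n ≤ m) :
    IsPoly m C K := ⟨h.norm_le, fun w hw => h.eq_zero w (hnm.trans_lt hw)⟩

lemma IsPoly.cons {n : ℕ} {C : ℝ} {K : List (Idx 𝒩) → ℂ} (h : IsPoly (n + 1) C K) (c : Idx 𝒩) :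
    IsPoly n C (fun w => K (c :: w)) :=
  ⟨fun w => h.norm_le _, fun w hw => h.eq_zero _ (by simpa using hw)⟩

lemma pair_tensors_succ [Fact (0 ≤ s)] {K : List (Idx 𝒩) → ℂ} {C : ℝ} (hK : ∀ w, ‖K w‖ ≤ C)
    (r : ℕ) (z : EllOne 𝒩 s) : pair s K (tensors (r + 1) z) =
      K [] + ∑' c, z.coord c * pair s (fun w => K (c :: w)) (tensors r z) := by
  classical
  rw [← pair_consL hK, tensors, ← pairL_apply K C hK, map_add, pairL_apply, pairL_apply]
  congr 1
  rw [pair, tsum_eq_single []]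
  · simp
  · intro w hw; simp [lp.single_apply, hw]

lemma pair_tensors_zero (K : List (Idx 𝒩) → ℂ) (z : EllOne 𝒩 s) :
    pair s K (tensors 0 z) = K [] := by
  rw [pair, tsum_eq_single []]
  · simp [tensors]
  · intro w hw; simp [tensors, lp.single_apply, hw]

lemma IsPoly.pair_tensors_eq {n r : ℕ} {C : ℝ} {K : List (Idx 𝒩) → ℂ} (h : IsPoly n C K)
    (hr : n ≤ r) (z : EllOne 𝒩 s) : pair s K (tensors r z) = pair s K (tensors n z) := by
  refine tsum_congr fun w => ?_
  by_cases hw : n < w.length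
  · simp [h.eq_zero w hw]
  · rw [tensors_apply, tensors_apply, if_pos (by omega), if_pos (by omega)]

/-- Coefficients of the partial derivative in the direction `c`. -/
def Dw (c : Idx 𝒩) : (List (Idx 𝒩) → ℂ) → List (Idx 𝒩) → ℂ
  | K, [] => K [c]
  | K, b :: w => K (c :: b :: w) + Dw c (fun u => K (b :: u)) w

/-- `Dw c K w` adds up the values of `K` at the `w.length + 1` words obtained by inserting `c` into
`w`; coefficient families are not assumed symmetric. -/
lemma norm_Dw_le {K : List (Idx 𝒩) → ℂ} {C : ℝ} (hK : ∀ w, ‖K w‖ ≤ C) (c : Idx 𝒩)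
    (w : List (Idx 𝒩)) : ‖Dw c K w‖ ≤ (w.length + 1) * C := by
  induction w generalizing K with
  | nil => simpa [Dw] using hK [c]
  | cons b w ih =>
    rw [Dw]
    refine (norm_add_le _ _).trans ((add_le_add (hK _) (ih fun u => hK _)).trans ?_)
    push_cast [List.length_cons]
    linarith

/-- A nonzero derivative comes from a nonzero coefficient. -/
lemma exists_perm_of_Dw_ne_zero {K : List (Idx 𝒩) → ℂ} {c : Idx 𝒩} {w : List (Idx 𝒩)}
    (h : Dw c K w ≠ 0) : ∃ u, K u ≠ 0 ∧ u.Perm (c :: w) := by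
  induction w generalizing K with
  | nil => exact ⟨[c], h, List.Perm.refl _⟩
  | cons b w ih =>
    rw [Dw] at h
    by_cases h1 : K (c :: b :: w) = 0
    · rw [h1, zero_add] at h
      obtain ⟨u, hu, hp⟩ := ih h
      exact ⟨b :: u, hu, (hp.cons b).trans (List.Perm.swap c b w)⟩
    · exact ⟨_, h1, List.Perm.refl _⟩

lemma IsPoly.deriv {n : ℕ} {C : ℝ} {K : List (Idx 𝒩) → ℂ} (h : IsPoly (n + 1) C K) (c : Idx 𝒩) :
    IsPoly n ((n + 1) * C) (Dw c K) := by
  have h0 : ∀ w : List (Idx 𝒩), n < w.length → Dw c K w = 0 := fun w hw => by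
    by_contra hne
    obtain ⟨u, hu, hp⟩ := exists_perm_of_Dw_ne_zero hne
    exact hu (h.eq_zero u (by rw [hp.length_eq]; simpa using hw))
  refine ⟨fun w => ?_, h0⟩
  rcases lt_or_ge n w.length with hw | hw
  · rw [h0 w hw, norm_zero]
    have := h.nonneg
    positivity
  · refine (norm_Dw_le h.norm_le c w).trans (mul_le_mul_of_nonneg_right ?_ h.nonneg)
    exact_mod_cast Nat.succ_le_succ hw

lemma Dw_comm (b c : Idx 𝒩) (K : List (Idx 𝒩) → ℂ) : Dw b (Dw c K) = Dw c (Dw b K) := by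
  funext w
  have add : ∀ (c : Idx 𝒩) (K K' : List (Idx 𝒩) → ℂ) (w : List (Idx 𝒩)),
      Dw c (fun u => K u + K' u) w = Dw c K w + Dw c K' w := by
    intro c K K' w
    induction w generalizing K K' with
    | nil => simp [Dw]
    | cons b w ih => rw [Dw, Dw, Dw, ih]; ring
  induction w generalizing K with
  | nil => simp only [Dw]; ring
  | cons a w ih =>
    simp only [Dw, add, ih (fun u => K (a :: u))]
    ring

lemma Dw_add (c : Idx 𝒩) (K K' : List (Idx 𝒩) → ℂ) (w : List (Idx 𝒩)) :
    Dw c (fun u => K u + K' u) w = Dw c K w + Dw c K' w := by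
  induction w generalizing K K' with
  | nil => simp [Dw]
  | cons b w ih => rw [Dw, Dw, Dw, ih]; ring

lemma Dw_const_mul (c : Idx 𝒩) (a : ℂ) (K : List (Idx 𝒩) → ℂ) (w : List (Idx 𝒩)) :
    Dw c (fun u => a * K u) w = a * Dw c K w := by
  induction w generalizing K with
  | nil => simp [Dw]
  | cons b w ih => rw [Dw, Dw, ih]; ring

/-- Inserting `c` changes an additive function of the word by `θ c`, wherever the insertion takes
place. The constant `a` collects the letters already passed in the induction. -/
lemma Dw_add_sum_mul (c : Idx 𝒩) (a : ℂ) (θ : Idx 𝒩 → ℂ) (K : List (Idx 𝒩) → ℂ)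
    (w : List (Idx 𝒩)) : Dw c (fun u => (a + (u.map θ).sum) * K u) w =
      (a + θ c + (w.map θ).sum) * Dw c K w := by
  induction w generalizing K a with
  | nil => simp [Dw]
  | cons b w ih =>
    have h := ih (a + θ b) (fun u => K (b :: u))
    rw [Dw, Dw]
    simp only [List.map_cons, List.sum_cons, ← add_assoc] at h ⊢
    rw [h]; ring

lemma Dw_star {K : List (Idx 𝒩) → ℂ} (h : ∀ w, K (w.map Idx.bar) = starRingEnd ℂ (K w))
    (c : Idx 𝒩) (w : List (Idx 𝒩)) : Dw c.bar K (w.map Idx.bar) = starRingEnd ℂ (Dw c K w) := by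
  have key : ∀ (K K' : List (Idx 𝒩) → ℂ), (∀ w, K (w.map Idx.bar) = starRingEnd ℂ (K' w)) →
      Dw c.bar K (w.map Idx.bar) = starRingEnd ℂ (Dw c K' w) := by
    induction w with
    | nil => intro K K' h; exact h [c]
    | cons b w ih =>
      intro K K' h
      rw [List.map_cons, Dw, Dw, map_add, ← h, ih (fun u => K (b.bar :: u)) (fun u => K' (b :: u))
        fun u => h (b :: u)]
      rfl
  exact key K K h

lemma hasSum_Dw {ι : Type*} {k : ι → List (Idx 𝒩) → ℂ} {S : List (Idx 𝒩) → ℂ}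
    (h : ∀ w, HasSum (fun i => k i w) (S w)) (c : Idx 𝒩) (w : List (Idx 𝒩)) :
    HasSum (fun i => Dw c (k i) w) (Dw c S w) := by
  induction w generalizing k S with
  | nil => exact h [c]
  | cons b w ih => exact (h _).add (ih fun u => h (b :: u))

lemma summable_norm_Dw {ι : Type*} {k : ι → List (Idx 𝒩) → ℂ} {C : ℝ}
    (h : ∀ w, Summable (fun i => ‖k i w‖) ∧ ∑' i, ‖k i w‖ ≤ C) (c : Idx 𝒩) (w : List (Idx 𝒩)) :
    Summable (fun i => ‖Dw c (k i) w‖) ∧ ∑' i, ‖Dw c (k i) w‖ ≤ (w.length + 1) * C := by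
  induction w generalizing k with
  | nil => simpa [Dw] using h [c]
  | cons b w ih =>
    obtain ⟨h1, h2⟩ := h (c :: b :: w)
    obtain ⟨h3, h4⟩ := ih fun u => h (b :: u)
    have h5 : Summable fun i => ‖Dw c (k i) (b :: w)‖ :=
      Summable.of_nonneg_of_le (fun _ => norm_nonneg _) (fun i => norm_add_le _ _) (h1.add h3)
    refine ⟨h5, (h5.tsum_le_tsum (fun i => norm_add_le _ _) (h1.add h3)).trans ?_⟩
    rw [h1.tsum_add h3]
    push_cast [List.length_cons]
    linarith

/-- The chain rule $DK(z)y=\sum_c y_c\,\partial_cK(z)$ at the level of coefficients. Differentiation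
removes one letter, hence `tensors r` on the right against `r + 1` on the left. -/
lemma pair_tensorsDeriv_succ [Fact (0 ≤ s)] {n : ℕ} {C : ℝ} {K : List (Idx 𝒩) → ℂ}
    (hK : IsPoly (n + 1) C K) (r : ℕ) (z y : EllOne 𝒩 s) :
    pair s K (tensorsDeriv (r + 1) z y) =
      pair s (fun w => ∑' c, y.coord c * Dw c K w) (tensors r z) := by
  induction r generalizing K n with
  | zero =>
    rw [tensorsDeriv_succ_apply, tensorsDeriv, zero_apply, map_zero, add_zero,
      pair_consL hK.norm_le, pair_tensors_zero]
    simp only [pair_tensors_zero, Dw]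
  | succ r ih =>
    have hc : ∀ a, IsPoly (n + 1) C fun w => K (a :: w) := fun a => (hK.cons a).mono (by omega)
    have b1 : ∀ w : List (Idx 𝒩), ‖∑' c, y.coord c * K (c :: w)‖ ≤ C * ‖y‖ := fun w =>
      y.norm_tsum_coord_mul_le fun c => hK.norm_le _
    have b2 : ∀ w : List (Idx 𝒩), ‖∑' c, y.coord c * Dw c K w‖ ≤ (n + 1) * C * ‖y‖ := fun w =>
      y.norm_tsum_coord_mul_le fun c => (hK.deriv c).norm_le _
    have b3 : ∀ (a : Idx 𝒩) (w : List (Idx 𝒩)),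
        ‖∑' c, y.coord c * Dw c (fun u => K (a :: u)) w‖ ≤ (n + 1) * C * ‖y‖ := fun a w =>
      y.norm_tsum_coord_mul_le fun c => ((hc a).deriv c).norm_le _
    rw [tensorsDeriv_succ_apply, ← pairL_apply K C hK.norm_le, map_add, pairL_apply, pairL_apply,
      pair_consL hK.norm_le, pair_consL hK.norm_le,
      tsum_coord_mul_pair (k := fun c w => K (c :: w)) fun c w => hK.norm_le _,
      pair_tensors_succ b1, pair_tensors_succ b2]
    simp only [ih (hc _), Dw]
    -- The head of a word is either hit by the derivative or kept; the two contributions are the two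
    -- terms in the recursion of `Dw`.
    rw [add_assoc, ← Summable.tsum_add]
    · congr 1
      refine tsum_congr fun a => ?_
      rw [← mul_add, ← pair_add (fun w => b1 (a :: w)) (b3 a)]
      congr 2
      funext w
      rw [← Summable.tsum_add (y.summable_coord_mul fun c => hK.norm_le _)
        (y.summable_coord_mul fun c => ((hc a).deriv c).norm_le _)]
      exact tsum_congr fun c => by ring
    · exact z.summable_coord_mul fun a => norm_pair_le (fun w => b1 (a :: w)) _
    · exact z.summable_coord_mul fun a => norm_pair_le (b3 a) _

lemma IsPoly.pair_tensorsDeriv [Fact (0 ≤ s)] {n r : ℕ} {C : ℝ} {K : List (Idx 𝒩) → ℂ}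
    (hK : IsPoly (n + 1) C K) (hr : n + 1 ≤ r) (z y : EllOne 𝒩 s) :
    pair s K (tensorsDeriv r z y) = ∑' c, y.coord c * pair s (Dw c K) (tensors r z) := by
  obtain ⟨r, rfl⟩ := Nat.exists_eq_add_of_le' hr
  rw [← add_assoc, pair_tensorsDeriv_succ hK,
    ← tsum_coord_mul_pair fun c w => (hK.deriv c).norm_le w]
  refine tsum_congr fun c => ?_
  rw [(hK.deriv c).pair_tensors_eq (r := r + n) (by omega) z,
    (hK.deriv c).pair_tensors_eq (r := r + n + 1) (by omega) z]

/-! ### Products -/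

/-- Coefficients of a product. -/
def conv (l : List (Idx 𝒩) → ℂ) : (List (Idx 𝒩) → ℂ) → List (Idx 𝒩) → ℂ
  | k, [] => k [] * l []
  | k, a :: w => k [] * l (a :: w) + conv l (fun u => k (a :: u)) w

lemma conv_eq_sum (l k : List (Idx 𝒩) → ℂ) (w : List (Idx 𝒩)) :
    conv l k w = ∑ i ∈ Finset.range (w.length + 1), k (w.take i) * l (w.drop i) := by
  induction w generalizing k with
  | nil => simp [conv]
  | cons a w ih =>
    rw [conv, ih, List.length_cons, Finset.sum_range_succ' _ (w.length + 1), add_comm]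
    simp only [List.take_succ_cons, List.drop_succ_cons, List.take_zero, List.drop_zero]

lemma IsPoly.conv {n m : ℕ} {C C' : ℝ} {k l : List (Idx 𝒩) → ℂ} (hk : IsPoly n C k)
    (hl : IsPoly m C' l) : IsPoly (n + m) ((n + m + 1) * (C * C')) (conv l k) := by
  have h0 : ∀ w : List (Idx 𝒩), n + m < w.length → SplittingBEA.conv l k w = 0 := fun w hw => by
    rw [conv_eq_sum]
    refine Finset.sum_eq_zero fun i hi => ?_
    have hi' := Finset.mem_range.mp hi
    rcases lt_or_ge n i with h | h
    · rw [hk.eq_zero _ (by simp; omega), zero_mul]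
    · rw [hl.eq_zero _ (by simp; omega), mul_zero]
  refine ⟨fun w => ?_, h0⟩
  have := hk.nonneg
  have := hl.nonneg
  rcases lt_or_ge (n + m) w.length with hw | hw
  · rw [h0 w hw, norm_zero]; positivity
  · rw [conv_eq_sum]
    refine (norm_sum_le_of_le (f := fun i => k (w.take i) * l (w.drop i)) _
      fun i _ => (norm_mul_le _ _).trans
      (mul_le_mul (hk.norm_le _) (hl.norm_le _) (norm_nonneg _) hk.nonneg)).trans ?_
    rw [Finset.sum_const, Finset.card_range, nsmul_eq_mul]
    refine mul_le_mul_of_nonneg_right ?_ (by positivity)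
    exact_mod_cast Nat.succ_le_succ hw

lemma conv_add_left (l k k' : List (Idx 𝒩) → ℂ) (w : List (Idx 𝒩)) :
    conv l (fun u => k u + k' u) w = conv l k w + conv l k' w := by
  simp only [conv_eq_sum, ← Finset.sum_add_distrib, add_mul]

lemma Dw_conv (b : Idx 𝒩) (l k : List (Idx 𝒩) → ℂ) (w : List (Idx 𝒩)) :
    Dw b (conv l k) w = conv l (Dw b k) w + conv (Dw b l) k w := by
  induction w generalizing k with
  | nil => simp only [Dw, conv]; ring
  | cons a w ih =>
    simp only [Dw, conv, Dw_add, Dw_const_mul, ih, conv_add_left]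
    ring

/-- Induction on the degree of `k`, splitting off the first letter. In degree zero only the empty
prefix contributes, and the product is with the constant `k []`. -/
lemma IsPoly.pair_conv [Fact (0 ≤ s)] {n m r : ℕ} {C C' : ℝ} {k l : List (Idx 𝒩) → ℂ}
    (hk : IsPoly n C k) (hl : IsPoly m C' l) (hr : n + m ≤ r) (z : EllOne 𝒩 s) :
    pair s (SplittingBEA.conv l k) (tensors r z) =
      pair s k (tensors r z) * pair s l (tensors r z) := by
  induction n generalizing k r with
  | zero =>
    have h1 : SplittingBEA.conv l k = fun w => k [] * l w := funext fun w => by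
      rw [conv_eq_sum, Finset.sum_range_succ', Finset.sum_eq_zero, zero_add]
      · simp
      · intro i hi
        have := Finset.mem_range.mp hi
        rw [hk.eq_zero _ (by simp; omega), zero_mul]
    rw [h1, pair_const_mul, hk.pair_tensors_eq (Nat.zero_le r), pair_tensors_zero]
  | succ n ih =>
    obtain ⟨r, rfl⟩ : ∃ r', r = r' + 1 := ⟨r - 1, by omega⟩
    have hl1 : pair s l (tensors (r + 1) z) = pair s l (tensors r z) := by
      rw [hl.pair_tensors_eq (r := r + 1) (by omega), hl.pair_tensors_eq (r := r) (by omega)]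
    have hlc : ∀ a w, ‖l (a :: w)‖ ≤ C' := fun a w => hl.norm_le _
    have hkc : ∀ a, IsPoly n C fun w => k (a :: w) := fun a => hk.cons a
    have hcc : ∀ a w, ‖SplittingBEA.conv l (fun u => k (a :: u)) w‖ ≤ _ := fun a =>
      ((hkc a).conv hl).norm_le
    have s1 : Summable fun a => z.coord a * pair s (fun w => l (a :: w)) (tensors r z) :=
      z.summable_coord_mul fun a => norm_pair_le (hlc a) _
    have s2 : Summable fun a => z.coord a * pair s (fun w => k (a :: w)) (tensors r z) :=
      z.summable_coord_mul fun a => norm_pair_le (hkc a).norm_le _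
    rw [pair_tensors_succ (hk.conv hl).norm_le, pair_tensors_succ hk.norm_le]
    have e : ∀ a, z.coord a * pair s (fun w => SplittingBEA.conv l k (a :: w)) (tensors r z) =
        k [] * (z.coord a * pair s (fun w => l (a :: w)) (tensors r z)) +
        (z.coord a * pair s (fun w => k (a :: w)) (tensors r z)) * pair s l (tensors r z) := by
      intro a
      have hh : ∀ w, ‖k [] * l (a :: w)‖ ≤ ‖k []‖ * C' := fun w => by
        rw [norm_mul]; exact mul_le_mul_of_nonneg_left (hlc a w) (norm_nonneg _)
      simp only [SplittingBEA.conv]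
      rw [pair_add hh (hcc a), pair_const_mul, ih (hkc a) (by omega)]
      ring
    rw [tsum_congr e, Summable.tsum_add (s1.mul_left _) (s2.mul_right _), tsum_mul_left,
      tsum_mul_right, add_mul]
    have h2 := pair_tensors_succ hl.norm_le r z
    rw [hl1]
    rw [hl1] at h2
    rw [SplittingBEA.conv]
    linear_combination (-(k [])) * h2

end SplittingBEA

end

/-! ### Momentum, Hamiltonian vector fields and the Poisson bracket -/

noncomputable section

namespace SplittingBEA

open scoped ENNReal

variable {d : ℕ} {𝒩 : Set (Fin d → ℤ)} {s : ℝ}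

/-! ### Momentum -/

/-- The momentum `δ a` of an index. -/
def idxMom (j : Idx 𝒩) : Fin d → ℤ := (j.2 : ℤ) • (j.1 : Fin d → ℤ)

/-- The momentum of a word. -/
def mom (w : List (Idx 𝒩)) : Fin d → ℤ := (w.map idxMom).sum

@[simp] lemma mom_nil : mom ([] : List (Idx 𝒩)) = 0 := rfl

@[simp] lemma mom_cons (c : Idx 𝒩) (w : List (Idx 𝒩)) : mom (c :: w) = idxMom c + mom w := by
  simp [mom]

lemma idxMom_bar (c : Idx 𝒩) : idxMom c.bar = -idxMom c := by simp [idxMom]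

lemma mom_append (u v : List (Idx 𝒩)) : mom (u ++ v) = mom u + mom v := by simp [mom]

lemma mom_perm {u v : List (Idx 𝒩)} (h : u.Perm v) : mom u = mom v := (h.map _).sum_eq

open Classical in
/-- The indices `c` such that `c :: w` has zero momentum. -/
def partners (w : List (Idx 𝒩)) : Finset (Idx 𝒩) :=
  (Finset.univ : Finset ℤˣ).biUnion fun δ =>
    if h : (δ : ℤ) • (-mom w) ∈ 𝒩 then {(⟨_, h⟩, δ)} else ∅

lemma mem_partners {c : Idx 𝒩} {w : List (Idx 𝒩)} : c ∈ partners w ↔ idxMom c + mom w = 0 := by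
  obtain ⟨⟨a, ha⟩, δ⟩ := c
  have hδ : ∀ v : Fin d → ℤ, (δ : ℤ) • (δ : ℤ) • v = v := fun v => by
    rw [smul_smul, ← Units.val_mul]; simp
  have key : a = (δ : ℤ) • (-mom w) ↔ idxMom (⟨⟨a, ha⟩, δ⟩ : Idx 𝒩) + mom w = 0 := by
    rw [add_eq_zero_iff_eq_neg, idxMom]
    constructor
    · rintro h
      change (δ : ℤ) • a = _
      rw [h, hδ]
    · intro h
      rw [← h, hδ]
  rw [← key, partners, Finset.mem_biUnion]
  constructor
  · rintro ⟨ε, -, h⟩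
    split_ifs at h with hm
    · have := Finset.mem_singleton.mp h
      simp only [Prod.mk.injEq, Subtype.mk.injEq] at this
      obtain ⟨h1, rfl⟩ := this
      exact h1
    · simp at h
  · intro h
    refine ⟨δ, Finset.mem_univ _, ?_⟩
    rw [dif_pos (by rw [← h]; exact ha), Finset.mem_singleton]
    simp [← h]

/-- Once the sign is chosen, zero momentum determines the mode. This finiteness is what replaces
decay of the coefficients throughout. -/
lemma card_partners_le (w : List (Idx 𝒩)) : (partners w).card ≤ 2 := by
  classical
  refine (Finset.card_biUnion_le_card_mul _ _ 1 fun δ _ => ?_).trans (by simp)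
  split_ifs <;> simp

/-- The weight of a momentum. -/
def latticeSize (a : Fin d → ℤ) : ℝ := Real.sqrt (max 1 (∑ i, (a i : ℝ) ^ 2))

lemma latticeSize_eq (a : Fin d → ℤ) :
    latticeSize a = max 1 ‖(WithLp.toLp 2 fun i => (a i : ℝ) : EuclideanSpace ℝ (Fin d))‖ := by
  rw [latticeSize, EuclideanSpace.norm_eq, Real.sqrt_monotone.map_max, Real.sqrt_one]
  simp

lemma latticeSize_add_le (a b : Fin d → ℤ) :
    latticeSize (a + b) ≤ latticeSize a + latticeSize b := by
  simp only [latticeSize_eq]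
  have h : (WithLp.toLp 2 fun i => (((a + b) i : ℤ) : ℝ) : EuclideanSpace ℝ (Fin d)) =
      WithLp.toLp 2 (fun i => (a i : ℝ)) + WithLp.toLp 2 (fun i => (b i : ℝ)) := by
    ext i; simp
  rw [h]
  refine max_le ?_ ((norm_add_le _ _).trans (add_le_add (le_max_right _ _) (le_max_right _ _)))
  linarith [le_max_left 1 ‖(WithLp.toLp 2 fun i => (a i : ℝ) : EuclideanSpace ℝ (Fin d))‖,
    le_max_left 1 ‖(WithLp.toLp 2 fun i => (b i : ℝ) : EuclideanSpace ℝ (Fin d))‖]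

lemma latticeSize_neg (a : Fin d → ℤ) : latticeSize (-a) = latticeSize a := by simp [latticeSize]

lemma latticeSize_idxMom (c : Idx 𝒩) : latticeSize (idxMom c) = c.size := by
  rw [latticeSize, Idx.size]
  congr 2
  refine Finset.sum_congr rfl fun i _ => ?_
  rcases Int.units_eq_one_or c.2 with h | h <;> simp [idxMom, h]

/-- By the triangle inequality the momentum is at most a sum of sizes, and a sum of $n$ numbers that
are at least 1 is at most $n$ times their product. The extra 1 covers the empty word, whose momentum
has size 1. -/
lemma latticeSize_mom_rpow_le [hs : Fact (0 ≤ s)] (w : List (Idx 𝒩)) :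
    latticeSize (mom w) ^ s ≤ ((w.length : ℝ) + 1) ^ s * wt s w := by
  have hP : ∀ w : List (Idx 𝒩), 1 ≤ (w.map Idx.size).prod ∧
      latticeSize (mom w) ≤ (w.length + 1) * (w.map Idx.size).prod ∧
      (w.map Idx.size).prod ^ s = wt s w := by
    intro w
    induction w with
    | nil => simp [latticeSize]
    | cons c w ih =>
      obtain ⟨h1, h2, h3⟩ := ih
      have hc := c.one_le_size
      simp only [List.map_cons, List.prod_cons, mom_cons, wt_cons, List.length_cons]
      refine ⟨one_le_mul_of_one_le_of_one_le hc h1, ?_, ?_⟩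
      · refine (latticeSize_add_le _ _).trans ?_
        rw [latticeSize_idxMom]
        push_cast
        have a1 : c.size ≤ c.size * (w.map Idx.size).prod :=
          le_mul_of_one_le_right c.size_pos.le h1
        have a2 : (w.length + 1) * (w.map Idx.size).prod ≤
            c.size * ((w.length + 1) * (w.map Idx.size).prod) :=
          le_mul_of_one_le_left (by positivity) hc
        nlinarith
      · rw [Real.mul_rpow c.size_pos.le (zero_le_one.trans h1), h3]
  obtain ⟨h1, h2, h3⟩ := hP w
  rw [← h3, ← Real.mul_rpow (by positivity) (zero_le_one.trans h1)]
  exact Real.rpow_le_rpow (Real.sqrt_nonneg _) h2 hs.out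

/-! ### Hamiltonian vector fields of coefficient families -/

/-- The factor `-i δ`. -/
def symplSign (j : Idx 𝒩) : ℂ := -Complex.I * ((j.2 : ℤ) : ℂ)

lemma symplSign_bar (j : Idx 𝒩) : symplSign j.bar = -symplSign j := by simp [symplSign]

lemma norm_symplSign (j : Idx 𝒩) : ‖symplSign j‖ = 1 := by
  rcases Int.units_eq_one_or j.2 with h | h <;> simp [symplSign, h]

lemma star_symplSign (j : Idx 𝒩) : starRingEnd ℂ (symplSign j) = symplSign j.bar := by
  simp [symplSign]

/-- The contribution of the word `w` to the Hamiltonian vector field. -/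
def hamVec (s : ℝ) (r : ℕ) (F : List (Idx 𝒩) → ℂ) (w : List (Idx 𝒩)) : EllOne 𝒩 s :=
  if w.length ≤ r then
    ∑ c ∈ partners w, (symplSign c.bar * Dw c F w) • EllOne.single c.bar
  else 0

lemma hamVec_add (r : ℕ) (F G : List (Idx 𝒩) → ℂ) (w : List (Idx 𝒩)) :
    hamVec s r (fun u => F u + G u) w = hamVec s r F w + hamVec s r G w := by
  unfold hamVec
  split_ifs
  · simp only [Dw_add, mul_add, add_smul, Finset.sum_add_distrib]
  · simp

lemma hamVec_const_mul (r : ℕ) (a : ℂ) (F : List (Idx 𝒩) → ℂ) (w : List (Idx 𝒩)) :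
    hamVec s r (fun u => a * F u) w = a • hamVec s r F w := by
  unfold hamVec
  split_ifs
  · rw [Finset.smul_sum]
    exact Finset.sum_congr rfl fun c _ => by rw [Dw_const_mul, smul_smul]; ring_nf
  · simp

/-- A partner `c` of `w` has the size of the momentum of `w`, so the norm of its basis vector is at
most $(r+1)^s$ times the weight of `w`. The remaining factors count the partners and the insertions
in `Dw`. After division by the weight this makes the vector field bounded on $\ell^1_s$. -/
lemma norm_hamVec_le [hs : Fact (0 ≤ s)] (r : ℕ) {F : List (Idx 𝒩) → ℂ} {C : ℝ}
    (hF : ∀ w, ‖F w‖ ≤ C) (w : List (Idx 𝒩)) :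
    ‖hamVec s r F w‖ ≤ 2 * (r + 1) * ((r : ℝ) + 1) ^ s * C * wt s w := by
  have hC : 0 ≤ C := (norm_nonneg _).trans (hF [])
  have hw := wt_pos (s := s) w
  unfold hamVec
  split_ifs with h
  · have hr : ((w.length : ℝ) + 1) ≤ r + 1 := by exact_mod_cast Nat.succ_le_succ h
    have key : ∀ c ∈ partners w, ‖(symplSign c.bar * Dw c F w) •
        (EllOne.single c.bar : EllOne 𝒩 s)‖ ≤ (r + 1) * C * (((r : ℝ) + 1) ^ s * wt s w) := by
      intro c hc
      rw [norm_smul, norm_mul, norm_symplSign, one_mul, EllOne.norm_single, Idx.size_bar]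
      have h1 : ‖Dw c F w‖ ≤ (r + 1) * C :=
        (norm_Dw_le hF c w).trans (mul_le_mul_of_nonneg_right hr hC)
      refine mul_le_mul h1 ?_ c.size_rpow_pos.le (by positivity)
      rw [← latticeSize_idxMom, add_eq_zero_iff_eq_neg.mp (mem_partners.mp hc), latticeSize_neg]
      refine (latticeSize_mom_rpow_le w).trans (mul_le_mul_of_nonneg_right ?_ hw.le)
      exact Real.rpow_le_rpow (by positivity) hr hs.out
    refine (norm_sum_le_of_le _ key).trans ?_
    rw [Finset.sum_const, nsmul_eq_mul]
    have h2 : ((partners w).card : ℝ) ≤ 2 := by exact_mod_cast card_partners_le w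
    refine (mul_le_mul_of_nonneg_right h2 (by positivity)).trans (le_of_eq (by ring))
  · rw [norm_zero]; positivity

lemma norm_smul_hamVec_le [Fact (0 ≤ s)] (r : ℕ) (F : Coeffs 𝒩) (f : WordL1 𝒩)
    (w : List (Idx 𝒩)) : ‖(f w / (wt s w : ℂ)) • hamVec s r F w‖ ≤
      2 * (r + 1) * ((r : ℝ) + 1) ^ s * ‖F‖ * ‖f w‖ := by
  rw [norm_smul, norm_div, Complex.norm_real, Real.norm_eq_abs, abs_of_pos (wt_pos w)]
  have h := norm_hamVec_le (s := s) r F.norm_apply_le w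
  have hw := wt_pos (s := s) w
  rw [div_mul_eq_mul_div, div_le_iff₀ hw]
  calc _ ≤ ‖f w‖ * (2 * (r + 1) * ((r : ℝ) + 1) ^ s * ‖F‖ * wt s w) :=
        mul_le_mul_of_nonneg_left h (norm_nonneg _)
    _ = _ := by ring

lemma summable_smul_hamVec [Fact (0 ≤ s)] (r : ℕ) (F : Coeffs 𝒩) (f : WordL1 𝒩) :
    Summable fun w => (f w / (wt s w : ℂ)) • hamVec s r F w :=
  Summable.of_norm_bounded (f.summable.mul_left _) (norm_smul_hamVec_le r F f)

/-- The bilinear map with `X_F(z) = hamL F (tensors z)`. -/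
def hamL (𝒩 : Set (Fin d → ℤ)) (s : ℝ) [Fact (0 ≤ s)] (r : ℕ) :
    Coeffs 𝒩 →L[ℂ] WordL1 𝒩 →L[ℂ] EllOne 𝒩 s :=
  LinearMap.mkContinuous₂
    (LinearMap.mk₂ ℂ
      (fun (F : Coeffs 𝒩) (f : WordL1 𝒩) => ∑' w, (f w / (wt s w : ℂ)) • hamVec s r F w)
      (fun F G f => by
        rw [← (summable_smul_hamVec r F f).tsum_add (summable_smul_hamVec r G f)]
        refine tsum_congr fun w => ?_
        rw [← smul_add, ← hamVec_add]; rfl)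
      (fun a F f => by
        rw [← tsum_const_smul'']
        refine tsum_congr fun w => ?_
        have h : hamVec s r (a • F : Coeffs 𝒩) w = a • hamVec s r F w := hamVec_const_mul r a F w
        rw [h, smul_comm])
      (fun F f g => by
        rw [← (summable_smul_hamVec r F f).tsum_add (summable_smul_hamVec r F g)]
        refine tsum_congr fun w => ?_
        rw [← add_smul, ← add_div]; rfl)
      (fun a F f => by
        rw [← tsum_const_smul'']
        refine tsum_congr fun w => ?_
        rw [smul_smul, ← mul_div_assoc]; rfl))
    (2 * (r + 1) * ((r : ℝ) + 1) ^ s) (fun F f => by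
      rw [f.norm_eq]
      exact tsum_of_norm_bounded (f.summable.hasSum.mul_left _) (norm_smul_hamVec_le r F f))

lemma hamL_apply [Fact (0 ≤ s)] (r : ℕ) (F : Coeffs 𝒩) (f : WordL1 𝒩) :
    hamL 𝒩 s r F f = ∑' w, (f w / (wt s w : ℂ)) • hamVec s r F w := rfl

/-- Only words of zero momentum carry nonzero coefficients. -/
def ZeroMom (K : List (Idx 𝒩) → ℂ) : Prop := ∀ w, K w ≠ 0 → mom w = 0

lemma ZeroMom.mem_partners {K : List (Idx 𝒩) → ℂ} (hK : ZeroMom K) {c : Idx 𝒩}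
    {w : List (Idx 𝒩)} (h : Dw c K w ≠ 0) : c ∈ partners w := by
  obtain ⟨u, hu, hp⟩ := exists_perm_of_Dw_ne_zero h
  rw [SplittingBEA.mem_partners, ← mom_cons, ← mom_perm hp, hK u hu]

/-- `hamVec` keeps only the partners so as to be defined and linear for every family. For families
of zero momentum nothing is lost, because the derivative in any other direction vanishes. -/
lemma coord_hamVec {r : ℕ} {K : List (Idx 𝒩) → ℂ} (hK : ZeroMom K)
    (hr : ∀ w : List (Idx 𝒩), r < w.length → K w = 0) (w : List (Idx 𝒩)) (b : Idx 𝒩) :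
    (hamVec s r K w).coord b = symplSign b * Dw b.bar K w := by
  have hsum : ∀ (t : Finset (Idx 𝒩)) (g : Idx 𝒩 → EllOne 𝒩 s),
      (∑ c ∈ t, g c).coord b = ∑ c ∈ t, (g c).coord b := by
    classical
    intro t g
    induction t using Finset.induction_on with
    | empty => simp
    | insert a t ha ih => rw [Finset.sum_insert ha, Finset.sum_insert ha, EllOne.coord_add, ih]
  unfold hamVec
  split_ifs with h
  · rw [hsum, Finset.sum_eq_single b.bar]
    · rw [EllOne.coord_smul, Idx.bar_bar, EllOne.coord_single_same, mul_one]
    · intro c _ hc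
      rw [EllOne.coord_smul, EllOne.coord_single_ne, mul_zero]
      rintro rfl
      exact hc (Idx.bar_bar c).symm
    · intro hb
      have : Dw b.bar K w = 0 := by
        by_contra hne
        exact hb (hK.mem_partners hne)
      rw [this, mul_zero, zero_smul, EllOne.coord_zero]
  · have : Dw b.bar K w = 0 := by
      by_contra hne
      obtain ⟨u, hu, hp⟩ := exists_perm_of_Dw_ne_zero hne
      refine hu (hr u ?_)
      rw [hp.length_eq, List.length_cons]
      omega
    rw [this, mul_zero, EllOne.coord_zero]

lemma coord_hamL [Fact (0 ≤ s)] {r : ℕ} {F : Coeffs 𝒩} (hF : ZeroMom F)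
    (hr : ∀ w : List (Idx 𝒩), r < w.length → F w = 0) (f : WordL1 𝒩) (b : Idx 𝒩) :
    (hamL 𝒩 s r F f).coord b = symplSign b * pair s (Dw b.bar F) f := by
  rw [hamL_apply, ← EllOne.coordL_apply, ContinuousLinearMap.map_tsum _
    (summable_smul_hamVec r F f), pair, ← tsum_mul_left]
  refine tsum_congr fun w => ?_
  rw [EllOne.coordL_apply, EllOne.coord_smul, coord_hamVec hF hr]
  ring

/-! ### The Poisson bracket -/

/-- Coefficients of the Poisson bracket. -/
def bracketFun (F G : List (Idx 𝒩) → ℂ) (w : List (Idx 𝒩)) : ℂ :=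
  ∑ i ∈ Finset.range (w.length + 1), ∑ c ∈ partners (w.take i),
    symplSign c * (Dw c F (w.take i) * Dw c.bar G (w.drop i))

/-- The bracket is $\sum_c\partial_cF\cdot(X_G)_c$, formally an infinite sum. For each splitting of
`w`, zero momentum of `F` leaves only the partners of the prefix. -/
lemma hasSum_bracketFun {F : List (Idx 𝒩) → ℂ} (hF : ZeroMom F) (G : List (Idx 𝒩) → ℂ)
    (w : List (Idx 𝒩)) :
    HasSum (fun c => symplSign c * conv (Dw c.bar G) (Dw c F) w) (bracketFun F G w) := by
  simp only [conv_eq_sum, Finset.mul_sum]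
  refine hasSum_sum fun i _ => hasSum_sum_of_ne_finset_zero fun c hc => ?_
  have : Dw c F (w.take i) = 0 := by
    by_contra hne
    exact hc (hF.mem_partners hne)
  simp [this]

lemma summable_norm_bracket {F G : List (Idx 𝒩) → ℂ} {A B : ℝ} (hF : ZeroMom F)
    (hA0 : 0 ≤ A) (hB0 : 0 ≤ B) (hA : ∀ c w, ‖Dw c F w‖ ≤ A) (hB : ∀ c w, ‖Dw c G w‖ ≤ B)
    (w : List (Idx 𝒩)) :
    Summable (fun c => ‖symplSign c * conv (Dw c.bar G) (Dw c F) w‖) ∧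
      ∑' c, ‖symplSign c * conv (Dw c.bar G) (Dw c F) w‖ ≤ (w.length + 1) * (2 * (A * B)) := by
  have h1 : HasSum (fun c => ∑ i ∈ Finset.range (w.length + 1),
      ‖Dw c F (w.take i)‖ * ‖Dw c.bar G (w.drop i)‖) (∑ i ∈ Finset.range (w.length + 1),
        ∑ c ∈ partners (w.take i), ‖Dw c F (w.take i)‖ * ‖Dw c.bar G (w.drop i)‖) := by
    refine hasSum_sum fun i _ => hasSum_sum_of_ne_finset_zero fun c hc => ?_
    have : Dw c F (w.take i) = 0 := by
      by_contra hne
      exact hc (hF.mem_partners hne)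
    simp [this]
  have h2 : ∀ c, ‖symplSign c * conv (Dw c.bar G) (Dw c F) w‖ ≤
      ∑ i ∈ Finset.range (w.length + 1), ‖Dw c F (w.take i)‖ * ‖Dw c.bar G (w.drop i)‖ := by
    intro c
    rw [norm_mul, norm_symplSign, one_mul, conv_eq_sum]
    exact norm_sum_le_of_le _ fun i _ => norm_mul_le _ _
  have h3 := Summable.of_nonneg_of_le (fun c => norm_nonneg _) h2 h1.summable
  refine ⟨h3, (h3.tsum_le_tsum h2 h1.summable).trans ?_⟩
  rw [h1.tsum_eq]
  refine (Finset.sum_le_card_nsmul _ _ (2 * (A * B)) fun i _ => ?_).trans (by simp)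
  refine (Finset.sum_le_card_nsmul _ _ (A * B) fun c _ => mul_le_mul (hA _ _) (hB _ _)
    (norm_nonneg _) hA0).trans ?_
  rw [nsmul_eq_mul]
  exact mul_le_mul_of_nonneg_right (by exact_mod_cast card_partners_le _) (by positivity)

lemma pair_tsum [Fact (0 ≤ s)] {k : Idx 𝒩 → List (Idx 𝒩) → ℂ} {S : List (Idx 𝒩) → ℂ} {C : ℝ}
    (hS : ∀ w, HasSum (fun c => k c w) (S w))
    (hk : ∀ w, Summable (fun c => ‖k c w‖) ∧ ∑' c, ‖k c w‖ ≤ C) (f : WordL1 𝒩) :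
    pair s S f = ∑' c, pair s (k c) f := by
  have hsum : Summable (Function.uncurry fun (w : List (Idx 𝒩)) (c : Idx 𝒩) =>
      k c w / (wt s w : ℂ) * f w) := by
    refine Summable.of_norm ?_
    rw [summable_prod_of_nonneg fun p => norm_nonneg _]
    have hle : ∀ w c, ‖k c w / (wt s w : ℂ) * f w‖ ≤ ‖k c w‖ * ‖f w‖ := fun w c => by
      rw [norm_mul]
      exact mul_le_mul_of_nonneg_right (norm_div_wt_le _ w) (norm_nonneg _)
    have h1 : ∀ w, Summable fun c => ‖k c w / (wt s w : ℂ) * f w‖ := fun w =>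
      Summable.of_nonneg_of_le (fun _ => norm_nonneg _) (hle w) ((hk w).1.mul_right _)
    refine ⟨h1, Summable.of_nonneg_of_le (fun _ => tsum_nonneg fun _ => norm_nonneg _)
      (fun w => ?_) (f.summable.mul_left C)⟩
    refine ((h1 w).tsum_le_tsum (hle w) ((hk w).1.mul_right _)).trans ?_
    rw [tsum_mul_right]
    exact mul_le_mul_of_nonneg_right (hk w).2 (norm_nonneg _)
  have := hsum.tsum_comm
  simp only [pair]
  rw [this]
  refine tsum_congr fun w => ?_
  rw [tsum_mul_right, tsum_div_const, (hS w).tsum_eq]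

/-- Differentiating $\sum_c\partial_cF\,(X_G)_c$ in direction $b$ gives by Leibniz one term with
$\partial_b\partial_cF$ and one with $\partial_b\partial_{\bar c}G$. Commuting the derivatives turns
them into derivatives of $\partial_bF$ along $X_G$ and of $\partial_bG$ along $X_F$. The absolute
bounds on the sums over `c` justify the exchanges. -/
lemma pair_Dw_bracketFun [Fact (0 ≤ s)] {n m r : ℕ} {F G : Coeffs 𝒩}
    (hF : ZeroMom F) (hG : ZeroMom G) (hn : IsPoly (n + 1) ‖F‖ F) (hm : IsPoly (m + 1) ‖G‖ G)
    (hr : n + m ≤ r) (hnr : n + 1 ≤ r) (hmr : m + 1 ≤ r) (b : Idx 𝒩) (z : EllOne 𝒩 s) :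
    pair s (Dw b (bracketFun F G)) (tensors r z) =
      pair s (Dw b F) (tensorsDeriv r z (hamL 𝒩 s r G (tensors r z))) -
      pair s (Dw b G) (tensorsDeriv r z (hamL 𝒩 s r F (tensors r z))) := by
  set A : ℝ := (n + 1) * ‖F‖
  set B : ℝ := (m + 1) * ‖G‖
  have hFr : ∀ w : List (Idx 𝒩), r < w.length → F w = 0 := fun w hw => hn.eq_zero w (by omega)
  have hGr : ∀ w : List (Idx 𝒩), r < w.length → G w = 0 := fun w hw => hm.eq_zero w (by omega)
  have dF : ∀ c, IsPoly n A (Dw c F) := fun c => hn.deriv c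
  have dG : ∀ c, IsPoly m B (Dw c G) := fun c => hm.deriv c
  have dF' : ∀ b c, IsPoly n ((n + 1) * A) (Dw b (Dw c F)) := fun b c =>
    ((dF c).mono (Nat.le_succ n)).deriv b
  have dG' : ∀ b c, IsPoly m ((m + 1) * B) (Dw b (Dw c G)) := fun b c =>
    ((dG c).mono (Nat.le_succ m)).deriv b
  let k : Idx 𝒩 → List (Idx 𝒩) → ℂ := fun c w => symplSign c * conv (Dw c.bar G) (Dw c F) w
  have hA0 : 0 ≤ A := by positivity
  have hB0 : 0 ≤ B := by positivity
  have hk : ∀ w, Summable (fun c => ‖k c w‖) ∧ ∑' c, ‖k c w‖ ≤ (n + m + 1) * (2 * (A * B)) := by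
    intro w
    obtain ⟨h1, h2⟩ := summable_norm_bracket hF hA0 hB0 (fun c => (dF c).norm_le)
      (fun c => (dG c).norm_le) w
    refine ⟨h1, ?_⟩
    rcases lt_or_ge (n + m) w.length with h | h
    · have : ∀ c, ‖k c w‖ = 0 := fun c => by
        simp only [k]
        rw [((dF c).conv (dG c.bar)).eq_zero w h, mul_zero, norm_zero]
      simp only [this, tsum_zero]
      positivity
    · refine h2.trans (mul_le_mul_of_nonneg_right ?_ (by positivity))
      exact_mod_cast Nat.succ_le_succ h
  have hDk : ∀ w, Summable (fun c => ‖Dw b (k c) w‖) ∧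
      ∑' c, ‖Dw b (k c) w‖ ≤ (n + m + 1) * ((n + m + 1) * (2 * (A * B))) := by
    intro w
    obtain ⟨h1, h2⟩ := summable_norm_Dw hk b w
    refine ⟨h1, ?_⟩
    rcases lt_or_ge (n + m) w.length with h | h
    · have : ∀ c, ‖Dw b (k c) w‖ = 0 := fun c => by
        simp only [k]
        rw [Dw_const_mul, ((((dF c).conv (dG c.bar)).mono (Nat.le_succ _)).deriv b).eq_zero w h,
          mul_zero, norm_zero]
      simp only [this, tsum_zero]
      positivity
    · refine h2.trans (mul_le_mul_of_nonneg_right ?_ (by positivity))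
      exact_mod_cast Nat.succ_le_succ h
  rw [pair_tsum (hasSum_Dw (hasSum_bracketFun hF G) b) hDk]
  have hterm : ∀ c, pair s (Dw b (k c)) (tensors r z) =
      (hamL 𝒩 s r G (tensors r z)).coord c * pair s (Dw c (Dw b F)) (tensors r z) -
      (hamL 𝒩 s r F (tensors r z)).coord c.bar * pair s (Dw c.bar (Dw b G)) (tensors r z) := by
    intro c
    have e : Dw b (k c) = fun w => symplSign c *
        (conv (Dw c.bar G) (Dw b (Dw c F)) w + conv (Dw b (Dw c.bar G)) (Dw c F) w) := by
      funext w
      simp only [k]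
      rw [Dw_const_mul, Dw_conv]
    rw [e, pair_const_mul, pair_add ((dF' b c).conv (dG c.bar)).norm_le
      ((dF c).conv (dG' b c.bar)).norm_le, (dF' b c).pair_conv (dG c.bar) hr,
      (dF c).pair_conv (dG' b c.bar) hr, coord_hamL hG hGr, coord_hamL hF hFr, symplSign_bar,
      Idx.bar_bar, Dw_comm b c, Dw_comm b c.bar]
    ring
  have hbF : ∀ c, ‖pair s (Dw c (Dw b F)) (tensors r z)‖ ≤ (n + 1) * A * ‖tensors r z‖ :=
    fun c => norm_pair_le (dF' c b).norm_le _
  have hbG : ∀ c, ‖pair s (Dw c (Dw b G)) (tensors r z)‖ ≤ (m + 1) * B * ‖tensors r z‖ :=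
    fun c => norm_pair_le (dG' c b).norm_le _
  have s1 := (hamL 𝒩 s r G (tensors r z)).summable_coord_mul hbF
  have s2 := (hamL 𝒩 s r F (tensors r z)).summable_coord_mul hbG
  -- In the second sum the index appears as `c.bar`, and the minus sign comes from `symplSign_bar`;
  -- conjugation of indices is a bijection of the summation set.
  have s3 : Summable fun c : Idx 𝒩 => (hamL 𝒩 s r F (tensors r z)).coord c.bar *
      pair s (Dw c.bar (Dw b G)) (tensors r z) := (barEquiv 𝒩).summable_iff.mpr s2
  have e3 : ∑' c : Idx 𝒩, (hamL 𝒩 s r F (tensors r z)).coord c.bar *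
      pair s (Dw c.bar (Dw b G)) (tensors r z) = _ :=
    (barEquiv 𝒩).tsum_eq (fun c => (hamL 𝒩 s r F (tensors r z)).coord c *
      pair s (Dw c (Dw b G)) (tensors r z))
  rw [tsum_congr hterm, Summable.tsum_sub s1 s3, e3,
    ((dF b).mono (Nat.le_succ n)).pair_tensorsDeriv hnr,
    ((dG b).mono (Nat.le_succ m)).pair_tensorsDeriv hmr]

/-- The constant counts at most `r + 1` splittings of the word, two partners for each, and a factor
`r + 1` for each of the two derivatives. -/
lemma norm_bracketFun_le {F G : List (Idx 𝒩) → ℂ} {A B : ℝ} (hA : ∀ w, ‖F w‖ ≤ A)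
    (hB : ∀ w, ‖G w‖ ≤ B) {r : ℕ} {w : List (Idx 𝒩)} (hw : w.length ≤ r) :
    ‖bracketFun F G w‖ ≤ 2 * (r + 1) ^ 3 * A * B := by
  have hA0 : 0 ≤ A := (norm_nonneg _).trans (hA [])
  have hB0 : 0 ≤ B := (norm_nonneg _).trans (hB [])
  have hr : ((w.length : ℝ) + 1) ≤ r + 1 := by exact_mod_cast Nat.succ_le_succ hw
  have key : ∀ i, ‖∑ c ∈ partners (w.take i),
      symplSign c * (Dw c F (w.take i) * Dw c.bar G (w.drop i))‖ ≤
        2 * (((r + 1) * A) * ((r + 1) * B)) := by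
    intro i
    have h1 : ∀ c ∈ partners (w.take i), ‖symplSign c * (Dw c F (w.take i) *
        Dw c.bar G (w.drop i))‖ ≤ ((r + 1) * A) * ((r + 1) * B) := fun c _ => by
      rw [norm_mul, norm_symplSign, one_mul, norm_mul]
      refine mul_le_mul ((norm_Dw_le hA c _).trans (mul_le_mul_of_nonneg_right ?_ hA0))
        ((norm_Dw_le hB _ _).trans (mul_le_mul_of_nonneg_right ?_ hB0)) (norm_nonneg _)
        (by positivity)
      · refine le_trans ?_ hr
        gcongr
        simp
      · refine le_trans ?_ hr
        gcongr
        simp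
    refine (norm_sum_le_of_le _ h1).trans ?_
    rw [Finset.sum_const, nsmul_eq_mul]
    exact mul_le_mul_of_nonneg_right (by exact_mod_cast card_partners_le _) (by positivity)
  refine (norm_sum_le_of_le _ fun i _ => key i).trans ?_
  rw [Finset.sum_const, Finset.card_range, nsmul_eq_mul]
  push_cast
  refine (mul_le_mul_of_nonneg_right hr (by positivity)).trans (le_of_eq (by ring))

/-- The Poisson bracket, truncated to words of length at most `r`. -/
def bracketL (𝒩 : Set (Fin d → ℤ)) (r : ℕ) : Coeffs 𝒩 →L[ℂ] Coeffs 𝒩 →L[ℂ] Coeffs 𝒩 :=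
  have hb : ∀ (F G : Coeffs 𝒩) (w : List (Idx 𝒩)),
      ‖(if w.length ≤ r then bracketFun F G w else 0 : ℂ)‖ ≤
        2 * ((r : ℝ) + 1) ^ 3 * ‖F‖ * ‖G‖ := fun F G w => by
    split_ifs with h
    · exact norm_bracketFun_le F.norm_apply_le G.norm_apply_le h
    · rw [norm_zero]; positivity
  LinearMap.mkContinuous₂
    (LinearMap.mk₂ ℂ
      (fun (F G : Coeffs 𝒩) => (⟨fun w => if w.length ≤ r then bracketFun F G w else 0,
        memℓp_infty ⟨_, Set.forall_mem_range.mpr (hb F G)⟩⟩ : Coeffs 𝒩))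
      (fun F F' G => lp.ext (funext fun w => by
        change (if w.length ≤ r then bracketFun (fun u => F u + F' u) G w else 0) =
          (if w.length ≤ r then bracketFun F G w else 0) +
            (if w.length ≤ r then bracketFun F' G w else 0)
        split_ifs
        · simp only [bracketFun, Dw_add, add_mul, mul_add, Finset.sum_add_distrib]
        · simp))
      (fun a F G => lp.ext (funext fun w => by
        change (if w.length ≤ r then bracketFun (fun u => a * F u) G w else 0) =
          a * (if w.length ≤ r then bracketFun F G w else 0)
        split_ifs
        · simp only [bracketFun, Dw_const_mul, Finset.mul_sum]
          exact Finset.sum_congr rfl fun i _ => Finset.sum_congr rfl fun c _ => by ring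
        · simp))
      (fun F G G' => lp.ext (funext fun w => by
        change (if w.length ≤ r then bracketFun F (fun u => G u + G' u) w else 0) =
          (if w.length ≤ r then bracketFun F G w else 0) +
            (if w.length ≤ r then bracketFun F G' w else 0)
        split_ifs
        · simp only [bracketFun, Dw_add, mul_add, Finset.sum_add_distrib]
        · simp))
      (fun a F G => lp.ext (funext fun w => by
        change (if w.length ≤ r then bracketFun F (fun u => a * G u) w else 0) =
          a * (if w.length ≤ r then bracketFun F G w else 0)
        split_ifs
        · simp only [bracketFun, Dw_const_mul, Finset.mul_sum]
          exact Finset.sum_congr rfl fun i _ => Finset.sum_congr rfl fun c _ => by ring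
        · simp)))
    (2 * ((r : ℝ) + 1) ^ 3) (fun F G => lp.norm_le_of_forall_le (by positivity) (hb F G))

lemma bracketL_apply (r : ℕ) (F G : Coeffs 𝒩) (w : List (Idx 𝒩)) :
    bracketL 𝒩 r F G w = if w.length ≤ r then bracketFun F G w else 0 := rfl

end SplittingBEA

end

/-! ### Admissible families, the quadratic part, and evaluation of polynomials -/

noncomputable section

namespace SplittingBEA

open scoped ENNReal

variable {d : ℕ} {𝒩 : Set (Fin d → ℤ)} {s : ℝ}

/-! ### Admissible coefficient families -/

/-- The charge of a word: the number of `ξ`'s minus the number of `η`'s. -/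
def charge (w : List (Idx 𝒩)) : ℤ := (w.map fun j => (j.2 : ℤ)).sum

/-- The words allowed in a Hamiltonian of degree at most `n`; if `σ` holds, only words of zero
charge are allowed. -/
structure IsAllowed (σ : Prop) (n : ℕ) (w : List (Idx 𝒩)) : Prop where
  mom_eq : mom w = 0
  charge_eq : σ → charge w = 0
  two_le : 2 ≤ w.length
  length_le : w.length ≤ n

/-- Real coefficient families supported on the allowed words. -/
structure IsAdmissible (σ : Prop) (n : ℕ) (F : List (Idx 𝒩) → ℂ) : Prop where
  allowed : ∀ w, F w ≠ 0 → IsAllowed σ n w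
  real : ∀ w, F (w.map Idx.bar) = starRingEnd ℂ (F w)

variable {σ : Prop} {n m : ℕ} {F G : List (Idx 𝒩) → ℂ}

lemma IsAdmissible.zeroMom (h : IsAdmissible σ n F) : ZeroMom F := fun w hw =>
  (h.allowed w hw).mom_eq

lemma IsAdmissible.eq_zero (h : IsAdmissible σ n F) {w : List (Idx 𝒩)} (hw : n < w.length) :
    F w = 0 := by
  by_contra hne
  exact absurd (h.allowed w hne).length_le (not_le.mpr hw)

lemma IsAdmissible.isPoly {F : Coeffs 𝒩} (h : IsAdmissible σ n F) : IsPoly n ‖F‖ F :=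
  ⟨F.norm_apply_le, fun _ hw => h.eq_zero hw⟩

lemma IsAdmissible.mono (h : IsAdmissible σ n F) (hnm : n ≤ m) : IsAdmissible σ m F :=
  ⟨fun w hw => { h.allowed w hw with length_le := (h.allowed w hw).length_le.trans hnm }, h.real⟩

lemma IsAllowed.map_bar {w : List (Idx 𝒩)} (h : IsAllowed σ n w) :
    IsAllowed σ n (w.map Idx.bar) := by
  have h1 : ∀ v : List (Idx 𝒩), mom (v.map Idx.bar) = -mom v := fun v => by
    induction v with
    | nil => simp
    | cons a v ih => rw [List.map_cons, mom_cons, mom_cons, ih, idxMom_bar, neg_add]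
  have h2 : ∀ v : List (Idx 𝒩), charge (v.map Idx.bar) = -charge v := fun v => by
    induction v with
    | nil => simp [charge]
    | cons a v ih =>
      simp only [charge, List.map_cons, List.sum_cons, Idx.bar_snd, Units.val_neg] at ih ⊢
      rw [ih, neg_add]
  exact ⟨by rw [h1, h.mom_eq, neg_zero], fun hs => by rw [h2, h.charge_eq hs, neg_zero],
    by simpa using h.two_le, by simpa using h.length_le⟩

lemma isAllowed_map_bar_iff {w : List (Idx 𝒩)} :
    IsAllowed σ n (w.map Idx.bar) ↔ IsAllowed σ n w := by
  refine ⟨fun h => ?_, IsAllowed.map_bar⟩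
  have := h.map_bar
  rwa [List.map_map, show (Idx.bar ∘ Idx.bar : Idx 𝒩 → Idx 𝒩) = id from
    funext Idx.bar_bar, List.map_id] at this

lemma exists_of_bracketFun_ne_zero {w : List (Idx 𝒩)} (h : bracketFun F G w ≠ 0) :
    ∃ (c : Idx 𝒩) (u v u' v' : List (Idx 𝒩)), w = u ++ v ∧ F u' ≠ 0 ∧ G v' ≠ 0 ∧
      u'.Perm (c :: u) ∧ v'.Perm (c.bar :: v) := by
  obtain ⟨i, -, hi⟩ := Finset.exists_ne_zero_of_sum_ne_zero h
  obtain ⟨c, -, hc⟩ := Finset.exists_ne_zero_of_sum_ne_zero hi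
  have h1 := right_ne_zero_of_mul hc
  obtain ⟨u', hu', hpu⟩ := exists_perm_of_Dw_ne_zero (left_ne_zero_of_mul h1)
  obtain ⟨v', hv', hpv⟩ := exists_perm_of_Dw_ne_zero (right_ne_zero_of_mul h1)
  exact ⟨c, _, _, u', v', (List.take_append_drop i w).symm, hu', hv', hpu, hpv⟩

lemma conv_map_bar {k l k' l' : List (Idx 𝒩) → ℂ}
    (hk : ∀ w, k (w.map Idx.bar) = starRingEnd ℂ (k' w))
    (hl : ∀ w, l (w.map Idx.bar) = starRingEnd ℂ (l' w)) (w : List (Idx 𝒩)) :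
    conv l k (w.map Idx.bar) = starRingEnd ℂ (conv l' k' w) := by
  rw [conv_eq_sum, conv_eq_sum, map_sum, List.length_map]
  exact Finset.sum_congr rfl fun i _ => by
    rw [← List.map_take, ← List.map_drop, hk, hl, map_mul]

/-- A word of the bracket joins a word of `F` with `c` removed and a word of `G` with `c.bar`
removed. The momenta and charges of `c` and `c.bar` cancel, and two letters are lost, whence the
degree. -/
lemma IsAdmissible.bracketFun (hF : IsAdmissible σ (n + 2) F) (hG : IsAdmissible σ (m + 2) G) :
    IsAdmissible σ (n + m + 2) (bracketFun F G) := by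
  constructor
  · intro w hw
    obtain ⟨c, u, v, u', v', rfl, hu', hv', hpu, hpv⟩ := exists_of_bracketFun_ne_zero hw
    have au := hF.allowed u' hu'
    have av := hG.allowed v' hv'
    have lu := hpu.length_eq
    have lv := hpv.length_eq
    have mu := (mom_perm hpu).symm.trans au.mom_eq
    have mv := (mom_perm hpv).symm.trans av.mom_eq
    rw [mom_cons] at mu mv
    rw [idxMom_bar] at mv
    simp only [List.length_cons] at lu lv
    have := au.two_le
    have := av.two_le
    have := au.length_le
    have := av.length_le
    refine ⟨?_, fun hs => ?_, by simp; omega, by simp; omega⟩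
    · rw [mom_append]
      linear_combination (exp := 1) mu + mv
    · have cu := ((hpu.map fun j : Idx 𝒩 => (j.2 : ℤ)).sum_eq).symm.trans (au.charge_eq hs)
      have cv := ((hpv.map fun j : Idx 𝒩 => (j.2 : ℤ)).sum_eq).symm.trans (av.charge_eq hs)
      simp only [List.map_cons, List.sum_cons, Idx.bar_snd, Units.val_neg] at cu cv
      simp only [charge, List.map_append, List.sum_append]
      linarith
  · intro w
    -- Reality: complex conjugation exchanges the terms of index `c` and `c.bar`, so the two sums
    -- agree after reindexing by conjugation.
    have h1 := (barEquiv 𝒩).hasSum_iff.mpr (hasSum_bracketFun hF.zeroMom G (w.map Idx.bar))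
    have h2 := (Complex.hasSum_conj').mpr (hasSum_bracketFun hF.zeroMom G w)
    refine h1.unique (h2.congr_fun fun c => ?_)
    change symplSign c.bar * conv (Dw c.bar.bar G) (Dw c.bar F) (w.map Idx.bar) = _
    rw [conv_map_bar (Dw_star hF.real c) (Dw_star hG.real c.bar), map_mul, star_symplSign]

/-- Admissible brackets of low degree are not truncated. -/
lemma IsAdmissible.bracketL_apply {F G : Coeffs 𝒩} {r : ℕ} (hF : IsAdmissible σ (n + 2) F)
    (hG : IsAdmissible σ (m + 2) G) (hr : n + m + 2 ≤ r) :
    (bracketL 𝒩 r F G : List (Idx 𝒩) → ℂ) = SplittingBEA.bracketFun F G := by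
  funext w
  rw [SplittingBEA.bracketL_apply]
  split_ifs with h
  · rfl
  · exact ((hF.bracketFun hG).eq_zero (by omega)).symm

lemma IsAdmissible.bracketL {F G : Coeffs 𝒩} {r : ℕ} (hF : IsAdmissible σ (n + 2) F)
    (hG : IsAdmissible σ (m + 2) G) (hr : n + m + 2 ≤ r) :
    IsAdmissible σ (n + m + 2) (bracketL 𝒩 r F G) := by
  rw [hF.bracketL_apply hG hr]
  exact hF.bracketFun hG

/-- The vector field of the Poisson bracket is the Lie bracket of the vector fields. -/
lemma IsAdmissible.hamL_bracketL [Fact (0 ≤ s)] {F G : Coeffs 𝒩} {r : ℕ}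
    (hF : IsAdmissible σ (n + 2) F) (hG : IsAdmissible σ (m + 2) G) (hr : n + m + 2 ≤ r)
    (z : EllOne 𝒩 s) :
    hamL 𝒩 s r (SplittingBEA.bracketL 𝒩 r F G) (tensors r z) =
      hamL 𝒩 s r F (tensorsDeriv r z (hamL 𝒩 s r G (tensors r z))) -
      hamL 𝒩 s r G (tensorsDeriv r z (hamL 𝒩 s r F (tensors r z))) := by
  have hB := hF.bracketL hG hr
  refine EllOne.ext fun b => ?_
  rw [EllOne.coord_sub, coord_hamL hB.zeroMom (fun w hw => hB.eq_zero (by omega)),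
    coord_hamL hF.zeroMom (fun w hw => hF.eq_zero (by omega)),
    coord_hamL hG.zeroMom (fun w hw => hG.eq_zero (by omega)), ← mul_sub,
    hF.bracketL_apply hG hr, pair_Dw_bracketFun hF.zeroMom hG.zeroMom hF.isPoly hG.isPoly
      (by omega) (by omega) (by omega)]

/-! ### Quadratic Hamiltonians -/

/-- Euler's identity: every monomial is an eigenvector of the linear field $z_j\mapsto\mu_jz_j$,
with eigenvalue the sum of $\mu$ over its letters. -/
lemma tensorsDeriv_diag_apply (μ : Idx 𝒩 → ℂ) (C : ℝ) (hμ : ∀ j, ‖μ j‖ ≤ C) (r : ℕ)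
    (z : EllOne 𝒩 s) (w : List (Idx 𝒩)) :
    tensorsDeriv r z (EllOne.diag μ C hμ z) w = (w.map μ).sum * tensors r z w := by
  induction r generalizing w with
  | zero =>
    rcases w with _ | ⟨c, w⟩
    · simp [tensorsDeriv]
    · simp [tensorsDeriv, tensors, lp.single_apply]
  | succ r ih =>
    rw [tensorsDeriv_succ_apply]
    change consFun _ _ w + consFun _ _ w = _
    rcases w with _ | ⟨c, w⟩
    · simp [consFun]
    · have : tensors (r + 1) z (c :: w) = consFun z (tensors r z) (c :: w) := by
        simp [tensors, consL_apply, lp.single_apply]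
      rw [this]
      simp only [consFun, EllOne.coord_diag, List.map_cons, List.sum_cons, ih]
      ring

lemma pair_tensorsDeriv_diag (μ : Idx 𝒩 → ℂ) (C : ℝ) (hμ : ∀ j, ‖μ j‖ ≤ C) (r : ℕ)
    (K : List (Idx 𝒩) → ℂ) (z : EllOne 𝒩 s) :
    pair s K (tensorsDeriv r z (EllOne.diag μ C hμ z)) =
      pair s (fun w => (w.map μ).sum * K w) (tensors r z) :=
  tsum_congr fun w => by rw [tensorsDeriv_diag_apply]; ring

lemma norm_sum_map_le {μ : Idx 𝒩 → ℂ} {C : ℝ} (hμ : ∀ j, ‖μ j‖ ≤ C) (w : List (Idx 𝒩)) :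
    ‖(w.map μ).sum‖ ≤ w.length * C := by
  induction w with
  | nil => simp
  | cons c w ih =>
    rw [List.map_cons, List.sum_cons, List.length_cons]
    push_cast
    refine (norm_add_le _ _).trans ?_
    linarith [hμ c]

/-- The commutator of the linear field with $X_W$. The bracket with the quadratic part acts on
coefficients by multiplication, which is why the recursion decouples over words. -/
lemma IsAdmissible.hamL_mul [Fact (0 ≤ s)] {W V : Coeffs 𝒩} {r : ℕ} (hW : IsAdmissible σ n W)
    (hr : n ≤ r) {μ : Idx 𝒩 → ℂ} {C : ℝ} (hC : 0 ≤ C) (hμ : ∀ j, ‖μ j‖ ≤ C)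
    (hbar : ∀ j, μ j.bar = -μ j) (hV : ∀ w, V w = -(w.map μ).sum * W w)
    (z : EllOne 𝒩 s) :
    hamL 𝒩 s r V (tensors r z) =
      EllOne.diag μ C hμ (hamL 𝒩 s r W (tensors r z)) -
      hamL 𝒩 s r W (tensorsDeriv r z (EllOne.diag μ C hμ z)) := by
  have hV0 : ∀ w, V w ≠ 0 → W w ≠ 0 := fun w hw => by
    rw [hV] at hw; exact right_ne_zero_of_mul hw
  refine EllOne.ext fun b => ?_
  rw [EllOne.coord_sub, EllOne.coord_diag,
    coord_hamL (fun w hw => hW.zeroMom w (hV0 w hw)) (fun w hw => by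
      rw [hV, hW.eq_zero (by omega), mul_zero]),
    coord_hamL hW.zeroMom (fun w hw => hW.eq_zero (by omega)),
    coord_hamL hW.zeroMom (fun w hw => hW.eq_zero (by omega)), pair_tensorsDeriv_diag]
  -- Differentiation in direction `b.bar` shifts the eigenvalue by `μ b.bar = -μ b`.
  have hD : ∀ w, Dw b.bar V w = μ b * Dw b.bar W w + -1 * ((w.map μ).sum * Dw b.bar W w) := by
    intro w
    have e : (V : List (Idx 𝒩) → ℂ) = fun u => -1 * ((0 + (u.map μ).sum) * W u) :=
      funext fun u => by rw [hV]; ring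
    rw [e, Dw_const_mul, Dw_add_sum_mul, hbar]
    ring
  have hP := (hW.isPoly.mono (Nat.le_succ n)).deriv b.bar
  have b1 : ∀ w : List (Idx 𝒩), ‖μ b * Dw b.bar W w‖ ≤ C * ((n + 1) * ‖W‖) := fun w => by
    rw [norm_mul]; exact mul_le_mul (hμ b) (hP.norm_le w) (norm_nonneg _) hC
  have b2 : ∀ w : List (Idx 𝒩), ‖-1 * ((w.map μ).sum * Dw b.bar W w)‖ ≤
      n * C * ((n + 1) * ‖W‖) := fun w => by
    rw [neg_one_mul, norm_neg, norm_mul]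
    rcases lt_or_ge n w.length with h | h
    · rw [hP.eq_zero w h, norm_zero, mul_zero]; positivity
    · refine mul_le_mul ((norm_sum_map_le hμ w).trans ?_) (hP.norm_le w) (norm_nonneg _)
        (by positivity)
      exact mul_le_mul_of_nonneg_right (by exact_mod_cast h) hC
  rw [funext hD, pair_add b1 b2, pair_const_mul, pair_const_mul]
  ring

open Classical in
/-- The symmetrised coefficients of `∑ λ_a ξ_a η_a`. -/
def quadFun (lam : 𝒩 → ℝ) : List (Idx 𝒩) → ℂ
  | [b, c] => if c = b.bar then (lam b.1 : ℂ) / 2 else 0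
  | _ => 0

lemma isAdmissible_quadFun (σ : Prop) (lam : 𝒩 → ℝ) : IsAdmissible σ 2 (quadFun lam) := by
  constructor
  · intro w hw
    unfold quadFun at hw
    split at hw
    · rename_i b c
      split_ifs at hw with h
      · subst h
        exact ⟨by simp [idxMom_bar], fun _ => by simp [charge], by simp, by simp⟩
      · exact absurd rfl hw
    · exact absurd rfl hw
  · intro w
    rcases w with _ | ⟨a, _ | ⟨b, _ | ⟨c, w⟩⟩⟩
    · simp [quadFun]
    · simp [quadFun]
    · have : b.bar = a.bar.bar ↔ b = a.bar := by
        rw [Idx.bar_bar]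
        exact ⟨fun h => by rw [← h, Idx.bar_bar], fun h => by rw [h, Idx.bar_bar]⟩
      simp only [List.map_cons, List.map_nil, quadFun, this]
      split_ifs
      · rw [map_div₀, Complex.conj_ofReal, Complex.conj_ofNat, Idx.bar_fst]
      · simp
    · simp [quadFun]

lemma Dw_quadFun (lam : 𝒩 → ℝ) (c : Idx 𝒩) (w : List (Idx 𝒩)) (hw : w ≠ [c.bar]) :
    Dw c (quadFun lam) w = 0 := by
  by_contra hne
  obtain ⟨u, hu, hp⟩ := exists_perm_of_Dw_ne_zero hne
  have := hp.length_eq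
  rcases w with _ | ⟨b, _ | ⟨e, w⟩⟩
  · rw [List.perm_singleton.mp hp] at hu
    simp [quadFun] at hu
  · have hb : b ≠ c.bar := fun h => hw (by rw [h])
    have hb' : c ≠ b.bar := fun h => hb (by rw [h, Idx.bar_bar])
    simp [Dw, quadFun, hb, hb'] at hne
  · rcases u with _ | ⟨x, _ | ⟨y, _ | ⟨t, u⟩⟩⟩
    · simp at this
    · simp at this
    · simp at this
    · simp [quadFun] at hu

lemma hamL_quadFun [Fact (0 ≤ s)] {lam : 𝒩 → ℝ} {Q : Coeffs 𝒩} (hQ : ∀ w, Q w = quadFun lam w)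
    {r : ℕ} (hr : 2 ≤ r) {C : ℝ} (hμ : ∀ j : Idx 𝒩, ‖symplSign j * (lam j.1 : ℂ)‖ ≤ C)
    (z : EllOne 𝒩 s) :
    hamL 𝒩 s r Q (tensors r z) = EllOne.diag (fun j => symplSign j * (lam j.1 : ℂ)) C hμ z := by
  have e : (Q : List (Idx 𝒩) → ℂ) = quadFun lam := funext hQ
  have hA := isAdmissible_quadFun True lam
  refine EllOne.ext fun b => ?_
  rw [coord_hamL (by rw [e]; exact hA.zeroMom) (fun w hw => by rw [e]; exact hA.eq_zero (by omega)),
    EllOne.coord_diag, e, pair, tsum_eq_single [b]]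
  -- The words `[b.bar, b]` and `[b, b.bar]` each contribute half of the frequency.
  · have h1 : Dw b.bar (quadFun lam) [b] = lam b.1 := by
      simp [Dw, quadFun]
    have h2 : (wt s [b] : ℂ) ≠ 0 := by exact_mod_cast (wt_pos [b]).ne'
    rw [h1, tensors_apply, if_pos (by simp; omega)]
    simp only [List.map_cons, List.map_nil, List.prod_cons, List.prod_nil]
    field_simp
  · intro w hw
    rw [Dw_quadFun lam b.bar w (by rwa [Idx.bar_bar])]
    simp

/-! ### Polynomial Hamiltonians -/

lemma tsum_list_eq {α : Type*} {g : List α → ℂ} (hg : Summable g) :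
    ∑' w, g w = ∑' l, ∑' j : Fin l → α, g (List.ofFn j) := by
  have h : Summable fun c : Σ l, Fin l → α => g (List.ofFn c.2) :=
    List.equivSigmaTuple.symm.summable_iff.mpr hg
  rw [← List.equivSigmaTuple.symm.tsum_eq]
  exact h.tsum_sigma

lemma PolyHam.eval_eq_pair [Fact (0 ≤ s)] {k r : ℕ} (H : PolyHam 𝒩 k) {F : List (Idx 𝒩) → ℂ}
    {C : ℝ} (hF : ∀ w, ‖F w‖ ≤ C) (hH : ∀ l j, H.coeff l j = F (List.ofFn j)) (hkr : k ≤ r)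
    (z : EllOne 𝒩 s) : H.eval z.coord = pair s F (tensors r z) := by
  have e : (fun w => F w / (wt s w : ℂ) * tensors r z w) =
      fun w => if w.length ≤ r then F w * (w.map z.coord).prod else 0 := by
    funext w
    have h2 : (wt s w : ℂ) ≠ 0 := by exact_mod_cast (wt_pos w).ne'
    rw [tensors_apply]
    split_ifs
    · field_simp
    · rw [mul_zero]
  have hs := summable_pair (s := s) hF (tensors r z)
  rw [e] at hs
  rw [pair, e, tsum_list_eq hs, PolyHam.eval, tsum_eq_sum (s := Finset.Icc 2 k)]
  · refine Finset.sum_congr rfl fun l hl => tsum_congr fun j => ?_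
    have hl' := Finset.mem_Icc.mp hl
    rw [if_pos (by rw [List.length_ofFn]; omega), List.map_ofFn, List.prod_ofFn, hH]
    rfl
  · intro l hl
    refine (tsum_congr fun j => ?_).trans tsum_zero
    have : F (List.ofFn j) = 0 := by
      by_contra hne
      rw [← hH] at hne
      exact hl (Finset.mem_Icc.mpr (H.degree l j hne))
    rw [this, zero_mul, ite_self]

/-- Varying one coordinate means moving along the line $z+(w-z_c)e_c$ in $\ell^1_s$, so the partial
derivatives of the definition are read off from the Fréchet derivative of `tensors`. -/
lemma PolyHam.hamField_eval [Fact (0 ≤ s)] {k n r : ℕ} (H : PolyHam 𝒩 k) {F : Coeffs 𝒩}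
    (hF : IsAdmissible σ (n + 1) F) (hH : ∀ l j, H.coeff l j = F (List.ofFn j)) (hkr : k ≤ r)
    (hn : n + 1 ≤ r) (z : EllOne 𝒩 s) (b : Idx 𝒩) :
    hamField H.eval z.coord b = (hamL 𝒩 s r F (tensors r z)).coord b := by
  rw [coord_hamL (s := s) hF.zeroMom fun w hw => hF.eq_zero (by omega)]
  have hupd : ∀ (c : Idx 𝒩) (w : ℂ), Function.update z.coord c w =
      (z + (w - z.coord c) • (EllOne.single c : EllOne 𝒩 s)).coord := by
    intro c w
    funext j
    rw [EllOne.coord_add, EllOne.coord_smul]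
    by_cases h : j = c
    · subst h; simp [EllOne.coord_single_same]
    · simp [Function.update_of_ne h, EllOne.coord_single_ne h]
  have hd : ∀ c, partialDeriv H.eval z.coord c = pair s (Dw c F) (tensors r z) := by
    intro c
    have hfun : (fun w : ℂ => H.eval (Function.update z.coord c w)) =
        fun w => pairL (s := s) F ‖F‖ F.norm_apply_le
          (tensors r (z + (w - z.coord c) • (EllOne.single c : EllOne 𝒩 s))) := by
      funext w
      rw [hupd, H.eval_eq_pair F.norm_apply_le hH hkr, pairL_apply]
    have hline : HasDerivAt
        (fun w : ℂ => z + (w - z.coord c) • (EllOne.single c : EllOne 𝒩 s))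
        (EllOne.single c) (z.coord c) := by
      simpa using (((hasDerivAt_id (z.coord c)).sub_const (z.coord c)).smul_const
        (EllOne.single c : EllOne 𝒩 s)).const_add z
    have hT : HasFDerivAt (tensors r) (tensorsDeriv r z)
        (z + (z.coord c - z.coord c) • (EllOne.single c : EllOne 𝒩 s)) := by
      simpa using hasFDerivAt_tensors r z
    rw [partialDeriv, hfun]
    have := ((pairL (s := s) F ‖F‖ F.norm_apply_le).hasFDerivAt.comp_hasDerivAt _
      (hT.comp_hasDerivAt _ hline)).deriv
    refine this.trans ?_
    rw [pairL_apply, hF.isPoly.pair_tensorsDeriv hn, tsum_eq_single c]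
    · rw [EllOne.coord_single_same, one_mul]
    · intro j hj
      rw [EllOne.coord_single_ne hj, zero_mul]
  rw [hamField, hd, symplSign]

end SplittingBEA

end

/-! ### The recursion for the modified Hamiltonian in an abstract commutative algebra -/

noncomputable section

namespace SplittingBEA

open MeasureTheory

/-! ### The recursion for the modified Hamiltonian -/

section Recursion

variable {B : Type*} [NormedCommRing B] [NormedAlgebra ℝ B]

/-- The pairs `(Z_{n+1}, W_n)`: the Taylor coefficients of the modified Hamiltonian and of the
generator of its interpolation. -/
def interp (br : B →L[ℝ] B →L[ℝ] B) (e : ℝ → B) (q P : B) : ℕ → B × (ℝ → B)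
  | n =>
    -- Order $n$ in $t$ of $\{Z,W\}$: the coefficient `Z i` carries $t^{i+1}$, so its companion has
    -- index `n - 1 - i`.
    let G : ℝ → B := fun t => ∑ i : Fin n,
      br (interp br e q P i).1 ((interp br e q P (n - 1 - i)).2 t)
    -- Chosen so that the generator equals `P` at $x=1$ for order zero and vanishes there for the
    -- other orders; `q` stands for the inverse of the mean of `e`.
    let Z : B := ((n : ℝ) + 1)⁻¹ •
      (q * ((if n = 0 then P else 0) - ∫ t in (0 : ℝ)..1, e (1 - t) * G t))
    (Z, fun x => e x * ∫ t in (0 : ℝ)..x, e (-t) * (((n : ℝ) + 1) • Z + G t))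
  termination_by n => n

variable (br : B →L[ℝ] B →L[ℝ] B) (e : ℝ → B) (q P : B)

/-- The coefficient of order `n + 1` of the modified Hamiltonian. -/
def modCoeff (n : ℕ) : B := (interp br e q P n).1

/-- The coefficient of order `n` of the generator. -/
def genCoeff (n : ℕ) : ℝ → B := (interp br e q P n).2

/-- The source term of the equation for `genCoeff`. -/
def source (n : ℕ) (t : ℝ) : B :=
  ∑ i : Fin n, br (modCoeff br e q P i) (genCoeff br e q P (n - 1 - i) t)

lemma modCoeff_eq (n : ℕ) : modCoeff br e q P n = ((n : ℝ) + 1)⁻¹ •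
    (q * ((if n = 0 then P else 0) - ∫ t in (0 : ℝ)..1, e (1 - t) * source br e q P n t)) := by
  rw [modCoeff, interp]; rfl

lemma genCoeff_eq (n : ℕ) (x : ℝ) : genCoeff br e q P n x =
    e x * ∫ t in (0 : ℝ)..x, e (-t) * (((n : ℝ) + 1) • modCoeff br e q P n +
      source br e q P n t) := by
  rw [genCoeff, modCoeff, interp]; rfl

variable {br e q P}

lemma continuous_source_of {n : ℕ} (h : ∀ m < n, Continuous (genCoeff br e q P m)) :
    Continuous (source br e q P n) := by
  refine continuous_finsetSum _ fun i _ => ?_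
  exact (br _).continuous.comp (h _ (by have := i.2; omega))

lemma continuous_genCoeff (he : Continuous e) (n : ℕ) : Continuous (genCoeff br e q P n) := by
  induction n using Nat.strong_induction_on with
  | _ n ih =>
    have hs := continuous_source_of ih
    rw [funext (genCoeff_eq br e q P n)]
    refine he.mul ?_
    refine intervalIntegral.continuous_primitive (fun a b => Continuous.intervalIntegrable ?_ a b) 0
    exact (he.comp continuous_neg).mul (continuous_const.add hs)

lemma continuous_source (he : Continuous e) (n : ℕ) : Continuous (source br e q P n) :=
  continuous_source_of fun m _ => continuous_genCoeff he m

lemma genCoeff_zero (n : ℕ) : genCoeff br e q P n 0 = 0 := by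
  rw [genCoeff_eq, intervalIntegral.integral_same, mul_zero]

/-- Duhamel's formula: this is the coefficient of $t^n$ in the zero-curvature equation, with `l` the
diagonal action of the quadratic part. -/
lemma hasDerivAt_genCoeff [CompleteSpace B] {l : B} (he : ∀ x, HasDerivAt e (l * e x) x)
    (hinv : ∀ x, e x * e (-x) = 1) (n : ℕ) (x : ℝ) :
    HasDerivAt (genCoeff br e q P n) (l * genCoeff br e q P n x +
      (((n : ℝ) + 1) • modCoeff br e q P n + source br e q P n x)) x := by
  have hc : Continuous e := continuous_iff_continuousAt.mpr fun x => (he x).continuousAt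
  have hcont : Continuous fun t => e (-t) * (((n : ℝ) + 1) • modCoeff br e q P n +
      source br e q P n t) :=
    (hc.comp continuous_neg).mul (continuous_const.add (continuous_source hc n))
  have h1 := (he x).mul (hcont.integral_hasStrictDerivAt 0 x).hasDerivAt
  rw [funext (genCoeff_eq br e q P n)]
  refine h1.congr_deriv ?_
  rw [← mul_assoc (e x), hinv, one_mul, mul_assoc]

/-- Duhamel's integral at $x=1$ is the mean of `e` times $(n+1)Z_n$ plus the integral of the source,
and $Z_n$ was built to cancel the latter. Inversion of the mean by `q` is required only on the
element concerned, since `q` will vanish off the allowed words. -/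
lemma genCoeff_one [CompleteSpace B] (he : Continuous e) (hadd : ∀ x y, e (x + y) = e x * e y)
    (n : ℕ)
    (hq : q * (∫ t in (0 : ℝ)..1, e (1 - t)) * ((if n = 0 then P else 0) -
      ∫ t in (0 : ℝ)..1, e (1 - t) * source br e q P n t) = (if n = 0 then P else 0) -
      ∫ t in (0 : ℝ)..1, e (1 - t) * source br e q P n t) :
    genCoeff br e q P n 1 = if n = 0 then P else 0 := by
  have hs := continuous_source (br := br) (q := q) (P := P) he n
  have he1 : Continuous fun t => e (1 - t) := he.comp (continuous_const.sub continuous_id)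
  have hmul : ∀ g : ℝ → B, Continuous g →
      e 1 * ∫ t in (0 : ℝ)..1, e (-t) * g t = ∫ t in (0 : ℝ)..1, e (1 - t) * g t := by
    intro g hg
    have hi : IntervalIntegrable (fun t => e (-t) * g t) volume 0 1 :=
      ((he.comp continuous_neg).mul hg).intervalIntegrable 0 1
    rw [← show _ = e 1 * _ from (ContinuousLinearMap.mul ℝ B (e 1)).intervalIntegral_comp_comm hi]
    simp only [ContinuousLinearMap.mul_apply']
    simp only [sub_eq_add_neg, hadd, mul_assoc]
  have hconst : ∀ c : B, ∫ t in (0 : ℝ)..1, e (1 - t) * c = (∫ t in (0 : ℝ)..1, e (1 - t)) * c :=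
    fun c => ((ContinuousLinearMap.mul ℝ B).flip c).intervalIntegral_comp_comm
      (he1.intervalIntegrable (μ := volume) 0 1)
  rw [genCoeff_eq, hmul (fun t => ((n : ℝ) + 1) • modCoeff br e q P n + source br e q P n t)
    (continuous_const.add hs)]
  have hi1 : IntervalIntegrable (fun t => e (1 - t) * (((n : ℝ) + 1) • modCoeff br e q P n))
    volume 0 1 := (he1.mul continuous_const).intervalIntegrable 0 1
  have hi2 : IntervalIntegrable (fun t => e (1 - t) * source br e q P n t) volume 0 1 :=
    (he1.mul hs).intervalIntegrable 0 1
  simp only [mul_add]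
  rw [intervalIntegral.integral_add hi1 hi2, hconst, modCoeff_eq,
    smul_smul, mul_inv_cancel₀ (by positivity), one_smul, ← mul_assoc, mul_comm _ q, hq,
    sub_add_cancel]

/-- Bounds that depend on `e` and `q` only through their norms. -/
lemma exists_interp_bound (br : B →L[ℝ] B →L[ℝ] B) (P : B) (K : ℝ) (n : ℕ) :
    ∃ C, 0 ≤ C ∧ ∀ (e : ℝ → B) (q : B), (∀ x, ‖e x‖ ≤ 1) → ‖q‖ ≤ K →
      ‖modCoeff br e q P n‖ ≤ C ∧ ∀ x ∈ Set.Icc (0 : ℝ) 1, ‖genCoeff br e q P n x‖ ≤ C := by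
  induction n using Nat.strong_induction_on with
  | _ n ih =>
    choose! C hC h using ih
    set S : ℝ := ∑ i : Fin n, ‖br‖ * C i * C (n - 1 - i)
    have hS0 : 0 ≤ S := Finset.sum_nonneg fun i _ => by
      have h1 := hC i i.2
      have h2 := hC (n - 1 - i) (by have := i.2; omega)
      positivity
    set Z : ℝ := |K| * (‖P‖ + S)
    have hZ0 : 0 ≤ Z := by positivity
    -- The first summand bounds the modified coefficient; the second bounds Duhamel's integral over
    -- a subinterval of $[0,1]$, the phases having norm at most 1.
    refine ⟨Z + ((n + 1) * Z + S), by positivity, fun e q he hq => ?_⟩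
    have hS : ∀ x ∈ Set.Icc (0 : ℝ) 1, ‖source br e q P n x‖ ≤ S := fun x hx =>
      norm_sum_le_of_le _ fun i _ => by
        have hi : n - 1 - (i : ℕ) < n := by have := i.2; omega
        refine (br.le_opNorm₂ _ _).trans ?_
        have h1 := (h i i.2 e q he hq).1
        have h2 := (h _ hi e q he hq).2 x hx
        have h3 := hC i i.2
        gcongr
    have hint : ∀ (g : ℝ → B) (D : ℝ) (y : ℝ) (f : ℝ → ℝ), y ∈ Set.Icc (0 : ℝ) 1 → 0 ≤ D →
        (∀ x ∈ Set.Icc (0 : ℝ) 1, ‖g x‖ ≤ D) → ‖∫ t in (0 : ℝ)..y, e (f t) * g t‖ ≤ D := by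
      intro g D y f hy hD hg
      refine (intervalIntegral.norm_integral_le_of_norm_le_const (C := D) fun t ht => ?_).trans ?_
      · rw [Set.uIoc_of_le hy.1] at ht
        refine (norm_mul_le _ _).trans ?_
        calc _ ≤ 1 * D := mul_le_mul (he _) (hg t ⟨ht.1.le, ht.2.trans hy.2⟩) (norm_nonneg _)
              zero_le_one
          _ = D := one_mul D
      · rw [sub_zero, abs_of_nonneg hy.1]
        exact mul_le_of_le_one_right hD hy.2
    have hZ : ‖modCoeff br e q P n‖ ≤ Z := by
      rw [modCoeff_eq, norm_smul, norm_inv, Real.norm_of_nonneg (by positivity)]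
      have h1 : ‖(if n = 0 then P else 0 : B)‖ ≤ ‖P‖ := by split_ifs <;> simp
      have h2 := hint (source br e q P n) S 1 (fun t => 1 - t) ⟨zero_le_one, le_rfl⟩ hS0 hS
      have h3 : ‖q * ((if n = 0 then P else 0) -
          ∫ t in (0 : ℝ)..1, e (1 - t) * source br e q P n t)‖ ≤ Z := by
        refine (norm_mul_le _ _).trans ?_
        exact mul_le_mul (hq.trans (le_abs_self K)) ((norm_sub_le _ _).trans (add_le_add h1 h2))
          (norm_nonneg _) (abs_nonneg K)
      have h4 : ((n : ℝ) + 1)⁻¹ ≤ 1 := inv_le_one_of_one_le₀ (by linarith [n.cast_nonneg (α := ℝ)])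
      calc _ ≤ 1 * Z := mul_le_mul h4 h3 (norm_nonneg _) zero_le_one
        _ = Z := one_mul Z
    refine ⟨hZ.trans (le_add_of_nonneg_right (by positivity)), fun x hx => ?_⟩
    rw [genCoeff_eq]
    refine (norm_mul_le _ _).trans ?_
    have h5 := hint (fun t => ((n : ℝ) + 1) • modCoeff br e q P n + source br e q P n t)
      ((n + 1) * Z + S) x (fun t => -t) hx (by positivity) fun t ht => by
        refine (norm_add_le _ _).trans (add_le_add ?_ (hS t ht))
        rw [norm_smul, Real.norm_of_nonneg (by positivity)]
        exact mul_le_mul_of_nonneg_left hZ (by positivity)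
    calc _ ≤ 1 * ((n + 1) * Z + S) := mul_le_mul (he x) h5 (norm_nonneg _) zero_le_one
      _ ≤ _ := by rw [one_mul]; exact le_add_of_nonneg_left hZ0

end Recursion

end SplittingBEA

end

/-! ### Existence of trajectories and Gronwall comparisons -/

noncomputable section

namespace SplittingBEA

open Set Filter Topology
open scoped NNReal

/-! ### Ordinary differential equations -/

section ODE

variable {E : Type*} [NormedAddCommGroup E] [NormedSpace ℝ E]

lemma HasDerivWithinAt.Ici_of_Icc {u : ℝ → E} {v : E} {T t : ℝ}
    (h : HasDerivWithinAt u v (Icc 0 T) t) (ht : t ∈ Ico 0 T) : HasDerivWithinAt u v (Ici t) t :=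
  (h.mono (Icc_subset_Icc_left ht.1)).mono_of_mem_nhdsWithin (Icc_mem_nhdsGE ht.2)

/-- An isometric linear flow. -/
structure IsIsometricFlow (A : E →L[ℝ] E) (U : ℝ → E →L[ℝ] E) : Prop where
  hasDerivAt : ∀ t, HasDerivAt U (A.comp (U t)) t
  norm_apply : ∀ t z, ‖U t z‖ = ‖z‖
  zero_apply : ∀ z, U 0 z = z
  apply_neg_apply : ∀ t z, U t (U (-t) z) = z

/-- Solutions of `u' = A u + F(u)` on `[0, 1]`, where `A` generates an isometric flow and `F` is
bounded by `1`. -/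
lemma exists_trajectory [CompleteSpace E] {A : E →L[ℝ] E} {U : ℝ → E →L[ℝ] E}
    (hU : IsIsometricFlow A U) {F : E → E} {R : ℝ} {K : ℝ≥0} {z : E} (hz : ‖z‖ + 1 ≤ R)
    (hF : ∀ y, ‖y‖ ≤ R → ‖F y‖ ≤ 1)
    (hL : ∀ y y', ‖y‖ ≤ R → ‖y'‖ ≤ R → ‖F y - F y'‖ ≤ K * ‖y - y'‖) :
    ∃ u : ℝ → E, u 0 = z ∧ ∀ t ∈ Icc (0 : ℝ) 1, ‖u t‖ ≤ R ∧
      HasDerivWithinAt u (A (u t) + F (u t)) (Icc 0 1) t := by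
  have hUc : Continuous U := continuous_iff_continuousAt.mpr fun t => (hU.hasDerivAt t).continuousAt
  have hball : ∀ y ∈ Metric.closedBall z ((1 : ℝ≥0) : ℝ), ‖y‖ ≤ R := fun y hy => by
    have h1 : ‖y - z‖ ≤ 1 := by simpa [dist_eq_norm] using hy
    have h2 := norm_add_le (y - z) z
    rw [sub_add_cancel] at h2
    linarith
  -- Interaction picture: with $u=U(t)v$ the equation becomes $v'=U(-t)F(U(t)v)$. As $U$ is
  -- isometric, its right side is bounded by 1 and $K$-Lipschitz on the unit ball around $z$, so
  -- existence on all of $[0,1]$ does not depend on the size of $A$.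
  have hPL : IsPicardLindelof (fun t v => U (-t) (F (U t v))) (tmin := 0) (tmax := 1)
      (⟨0, by simp⟩ : Icc (0 : ℝ) 1) z 1 0 1 K := by
    refine ⟨fun t _ => ?_, fun x hx => ?_, fun t _ x hx => ?_, by simp⟩
    · refine LipschitzOnWith.of_dist_le_mul fun x hx y hy => ?_
      rw [dist_eq_norm, dist_eq_norm, ← map_sub, hU.norm_apply]
      have := hL (U t x) (U t y) (by rw [hU.norm_apply]; exact hball x hx)
        (by rw [hU.norm_apply]; exact hball y hy)
      rwa [← map_sub, hU.norm_apply] at this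
    · have hFc : ContinuousOn F (Metric.closedBall 0 R) := by
        refine (LipschitzOnWith.of_dist_le_mul (K := K) fun y hy y' hy' => ?_).continuousOn
        rw [dist_eq_norm, dist_eq_norm]
        exact hL y y' (by simpa using hy) (by simpa using hy')
      have h1 : ContinuousOn (fun t => F (U t x)) (Icc 0 1) := by
        refine hFc.comp (hUc.clm_apply continuous_const).continuousOn fun t _ => ?_
        simpa [hU.norm_apply] using hball x hx
      exact (hUc.comp continuous_neg).continuousOn.clm_apply h1
    · rw [hU.norm_apply, NNReal.coe_one]
      exact hF _ (by rw [hU.norm_apply]; exact hball x hx)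
  -- The fixed point of the Picard iteration is used directly: it also records that the solution
  -- stays in the unit ball around $z$.
  obtain ⟨α, hα⟩ := ODE.FunSpace.exists_isFixedPt_next hPL (Metric.mem_closedBall_self le_rfl)
  have hmem : ∀ t, α.compProj t ∈ Metric.closedBall z ((1 : ℝ≥0) : ℝ) := fun t =>
    α.compProj_mem_closedBall hPL.mul_max_le
  have hd : ∀ t ∈ Icc (0 : ℝ) 1, HasDerivWithinAt α.compProj
      (U (-t) (F (U t (α.compProj t)))) (Icc 0 1) t := by
    intro t ht
    refine HasDerivWithinAt.congr_of_mem (ODE.hasDerivWithinAt_picard_Icc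
      (⟨0, by simp⟩ : Icc (0 : ℝ) 1).2 hPL.continuousOn_uncurry
      α.continuous_compProj.continuousOn (fun _ _ => hmem _) z ht) (fun t' ht' => ?_) ht
    nth_rw 1 [← hα]
    rw [ODE.FunSpace.compProj_of_mem ht', ODE.FunSpace.next_apply]
  refine ⟨fun t => U t (α.compProj t), ?_, fun t ht => ⟨?_, ?_⟩⟩
  · refine (hU.zero_apply _).trans ?_
    have : α.compProj 0 = α ⟨0, by simp⟩ := ODE.FunSpace.compProj_of_mem (by simp)
    rw [this, ← hα]
    exact ODE.FunSpace.next_apply₀ hPL (Metric.mem_closedBall_self le_rfl) α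
  · rw [hU.norm_apply]; exact hball _ (hmem t)
  · have := ((hU.hasDerivAt t).hasDerivWithinAt (s := Icc 0 1)).clm_apply (hd t ht)
    refine this.congr_deriv ?_
    rw [hU.apply_neg_apply]
    rfl

/-- From $e^y-1\le y\,e^y$; the resulting bound also covers $K=0$. -/
lemma gronwallBound_zero_le {K ε x : ℝ} (hK : 0 ≤ K) (hε : 0 ≤ ε) :
    gronwallBound 0 K ε x ≤ ε * x * Real.exp (K * x) := by
  rcases hK.eq_or_lt with rfl | hK
  · simp [gronwallBound_K0]
  · simp only [gronwallBound_of_K_ne_0 hK.ne', zero_mul, zero_add]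
    have h1 : Real.exp (K * x) - 1 ≤ K * x * Real.exp (K * x) := by
      have h2 := Real.add_one_le_exp (-(K * x))
      have h3 := Real.exp_pos (K * x)
      have h4 : Real.exp (-(K * x)) * Real.exp (K * x) = 1 := by rw [← Real.exp_add]; simp
      nlinarith
    calc ε / K * (Real.exp (K * x) - 1) ≤ ε / K * (K * x * Real.exp (K * x)) :=
          mul_le_mul_of_nonneg_left h1 (by positivity)
      _ = _ := by field_simp

/-- Comparison of an exact and an approximate solution. -/
lemma norm_sub_le_of_approx {f : E → E} {K R ε : ℝ} (hK : 0 ≤ K) (hε : 0 ≤ ε)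
    (hf : ∀ y y', ‖y‖ ≤ R → ‖y'‖ ≤ R → ‖f y - f y'‖ ≤ K * ‖y - y'‖)
    {u w : ℝ → E} {w' : ℝ → E} {T : ℝ} (hT : 0 ≤ T)
    (hu : ∀ t ∈ Icc 0 T, ‖u t‖ ≤ R ∧ HasDerivWithinAt u (f (u t)) (Icc 0 T) t)
    (hw : ∀ t ∈ Icc 0 T, ‖w t‖ ≤ R ∧ HasDerivWithinAt w (w' t) (Icc 0 T) t)
    (hww : ∀ t ∈ Icc 0 T, ‖w' t - f (w t)‖ ≤ ε) (h0 : u 0 = w 0) :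
    ‖u T - w T‖ ≤ ε * T * Real.exp (K * T) := by
  have h := dist_le_of_approx_trajectories_ODE_of_mem (v := fun _ => f)
    (s := fun _ => Metric.closedBall 0 R) (K := ⟨K, hK⟩) (a := 0) (b := T) (δ := 0)
    (εf := 0) (εg := ε) (f := u) (g := w) (f' := fun t => f (u t)) (g' := w')
    (fun t _ => LipschitzOnWith.of_dist_le_mul fun y hy y' hy' => by
      rw [dist_eq_norm, dist_eq_norm]
      exact hf y y' (by simpa using hy) (by simpa using hy'))
    (fun t ht => (hu t ht).2.continuousWithinAt)
    (fun t ht => HasDerivWithinAt.Ici_of_Icc (hu t (Ico_subset_Icc_self ht)).2 ht)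
    (fun t _ => by rw [dist_self])
    (fun t ht => by simpa using (hu t (Ico_subset_Icc_self ht)).1)
    (fun t ht => (hw t ht).2.continuousWithinAt)
    (fun t ht => HasDerivWithinAt.Ici_of_Icc (hw t (Ico_subset_Icc_self ht)).2 ht)
    (fun t ht => by rw [dist_eq_norm]; exact hww t (Ico_subset_Icc_self ht))
    (fun t ht => by simpa using (hw t (Ico_subset_Icc_self ht)).1)
    (by rw [h0, dist_self]) T ⟨hT, le_rfl⟩
  rw [dist_eq_norm, zero_add, sub_zero] at h
  exact h.trans (gronwallBound_zero_le hK hε)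

/-- Comparison of two families, one of which solves a differential equation up to a small
defect. -/
lemma norm_sub_le_of_defect {X : E → E} {K R ρ : ℝ} (hK : 0 ≤ K) (hρ : 0 ≤ ρ)
    (hX : ∀ y y', ‖y‖ ≤ R → ‖y'‖ ≤ R → ‖X y - X y'‖ ≤ K * ‖y - y'‖)
    {a v : ℝ → E} {T : ℝ} (hT : 0 ≤ T)
    (ha : ∀ t ∈ Icc 0 T, ‖a t‖ ≤ R)
    (hv : ∀ t ∈ Icc 0 T, ‖v t‖ ≤ R ∧ HasDerivWithinAt v (X (v t)) (Icc 0 T) t)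
    (had : ∀ t ∈ Icc 0 T, ∀ η > 0, ∃ δ > 0, ∀ t' ∈ Icc 0 T, |t' - t| < δ →
      ‖a t' - a t - (t' - t) • X (a t)‖ ≤ (η + ρ) * |t' - t|) (h0 : a 0 = v 0) :
    ‖a T - v T‖ ≤ ρ * T * Real.exp (K * T) := by
  have hac : ContinuousOn a (Icc 0 T) := by
    intro t ht
    obtain ⟨δ, hδ, h⟩ := had t ht 1 one_pos
    rw [ContinuousWithinAt, tendsto_iff_norm_sub_tendsto_zero]
    have hlim : Tendsto (fun t' => (1 + ρ) * |t' - t| + |t' - t| * ‖X (a t)‖) (𝓝[Icc 0 T] t)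
        (𝓝 0) := by
      have : Continuous fun t' : ℝ => (1 + ρ) * |t' - t| + |t' - t| * ‖X (a t)‖ := by fun_prop
      simpa using (this.tendsto t).mono_left nhdsWithin_le_nhds
    refine squeeze_zero' (Eventually.of_forall fun _ => norm_nonneg _) ?_ hlim
    filter_upwards [self_mem_nhdsWithin, mem_nhdsWithin_of_mem_nhds (Metric.ball_mem_nhds t hδ)]
      with t' ht' hb
    have h1 := h t' ht' (by simpa [Real.dist_eq] using hb)
    have h2 := norm_add_le (a t' - a t - (t' - t) • X (a t)) ((t' - t) • X (a t))
    rw [sub_add_cancel, norm_smul, Real.norm_eq_abs] at h2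
    linarith
  have h := le_gronwallBound_of_liminf_deriv_right_le (f := fun t => ‖a t - v t‖)
    (f' := fun t => K * ‖a t - v t‖ + ρ) (δ := 0) (K := K) (ε := ρ) (a := 0) (b := T)
    ((hac.sub fun t ht => (hv t ht).2.continuousWithinAt).norm) ?_ (by simp [h0])
    (fun _ _ => le_rfl) T ⟨hT, le_rfl⟩
  · rw [sub_zero] at h
    exact h.trans (gronwallBound_zero_le hK hρ)
  · intro x hx r hr
    have hx' := Ico_subset_Icc_self hx
    -- A quarter of the gap to be filled: one $\eta$ is spent on the increment of `a`, one on that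
    -- of `v`, and the rest makes the inequality strict.
    set η : ℝ := (r - (K * ‖a x - v x‖ + ρ)) / 4
    have hη : 0 < η := by simp only [η]; linarith
    obtain ⟨δ, hδ, h⟩ := had x hx' η hη
    have hv' := HasDerivWithinAt.Ici_of_Icc (hv x hx').2 hx
    have hlo := (hasDerivWithinAt_iff_isLittleO.mp hv').def hη
    refine Eventually.frequently ?_
    filter_upwards [nhdsWithin_mono x Ioi_subset_Ici_self hlo, self_mem_nhdsWithin,
      Ioo_mem_nhdsGT hx.2, Ioo_mem_nhdsGT (show x < x + δ by linarith)] with y h1 hy hyT hyδ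
    have hpos : 0 < y - x := sub_pos.mpr hy
    have habs : |y - x| = y - x := abs_of_pos hpos
    have h2 := h y ⟨hx.1.trans hyT.1.le, hyT.2.le⟩ (by rw [habs]; linarith [hyδ.2])
    rw [Real.norm_eq_abs, habs] at h1
    rw [habs] at h2
    have h3 := hX (a x) (v x) (ha x hx') (hv x hx').1
    have e : a y - v y = (a y - a x - (y - x) • X (a x)) + (a x - v x) +
        (y - x) • (X (a x) - X (v x)) - (v y - v x - (y - x) • X (v x)) := by
      rw [smul_sub]; abel
    have h4 : ‖a y - v y‖ ≤ (η + ρ) * (y - x) + ‖a x - v x‖ + (y - x) * (K * ‖a x - v x‖) +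
        η * (y - x) := by
      rw [e]
      refine (norm_sub_le _ _).trans (add_le_add ((norm_add₃_le).trans
        (add_le_add (add_le_add h2 le_rfl) ?_)) h1)
      rw [norm_smul, Real.norm_eq_abs, habs]
      exact mul_le_mul_of_nonneg_left h3 hpos.le
    rw [inv_mul_lt_iff₀ hpos]
    have h5 : 4 * η = r - (K * ‖a x - v x‖ + ρ) := by simp only [η]; ring
    nlinarith [mul_pos hη hpos]

end ODE

end SplittingBEA

end

/-! ### Dependence of the time-one maps on the parameter -/

noncomputable section

namespace SplittingBEA

open Set Filter Topology
open scoped NNReal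

section Interpolation

variable {B V E : Type*} [NormedAddCommGroup B] [NormedSpace ℝ B] [NormedAddCommGroup V]
  [NormedSpace ℝ V] [NormedAddCommGroup E] [NormedSpace ℝ E]

/-- Uniform bounds for a map, its increments and its Taylor remainder on a ball. -/
structure IsTameOn (T : E → V) (T' : E → E →L[ℝ] V) (R τ : ℝ) : Prop where
  hasFDerivAt : ∀ z, HasFDerivAt T (T' z) z
  nonneg : 0 ≤ τ
  norm_le : ∀ z, ‖z‖ ≤ R → ‖T z‖ ≤ τ
  norm_sub_le : ∀ z z', ‖z‖ ≤ R → ‖z'‖ ≤ R → ‖T z' - T z‖ ≤ τ * ‖z' - z‖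
  norm_taylor_le : ∀ z z', ‖z‖ ≤ R → ‖z'‖ ≤ R →
    ‖T z' - T z - T' z (z' - z)‖ ≤ τ * ‖z' - z‖ ^ 2
  norm_deriv_le : ∀ z y, ‖z‖ ≤ R → ‖T' z y‖ ≤ τ * ‖y‖

variable {T : E → V} {T' : E → E →L[ℝ] V} {R τ : ℝ} {L : B →L[ℝ] V →L[ℝ] E} {A : E →L[ℝ] E}

lemma IsTameOn.norm_field_sub_le (hT : IsTameOn T T' R τ) (F : B) (y y' : E) (hy : ‖y‖ ≤ R)
    (hy' : ‖y'‖ ≤ R) : ‖L F (T y) - L F (T y')‖ ≤ ‖L‖ * ‖F‖ * τ * ‖y - y'‖ := by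
  rw [← map_sub]
  refine (L.le_opNorm₂ _ _).trans ?_
  rw [mul_assoc _ τ]
  exact mul_le_mul_of_nonneg_left (hT.norm_sub_le y' y hy' hy) (by positivity)

lemma IsTameOn.norm_field_le (hT : IsTameOn T T' R τ) (F : B) (y : E) (hy : ‖y‖ ≤ R) :
    ‖L F (T y)‖ ≤ ‖L‖ * ‖F‖ * τ :=
  (L.le_opNorm₂ _ _).trans (mul_le_mul_of_nonneg_left (hT.norm_le y hy) (by positivity))

/-- The time-one maps of a family of fields satisfy a differential equation in the parameter, up
to the defect `ρ` of the zero-curvature equation. -/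
lemma IsTameOn.interpolation (hT : IsTameOn T T' R τ) {Z : ℝ → B} {Zd : B} {t h : ℝ}
    (ht : t ∈ Icc 0 h) (hZ : HasDerivAt Z Zd t) {W Wd : ℝ → B} {P : B} {w₀ ρ K R' : ℝ}
    (hW : ∀ x ∈ Icc (0 : ℝ) 1, HasDerivAt W (Wd x) x) (hW0 : W 0 = 0) (hW1 : W 1 = P)
    (hWb : ∀ x ∈ Icc (0 : ℝ) 1, ‖W x‖ ≤ w₀) (hρ0 : 0 ≤ ρ)
    (hρ : ∀ x ∈ Icc (0 : ℝ) 1, ∀ z, ‖z‖ ≤ R →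
      ‖L (Wd x) (T z) + L (W x) (T' z (A z + L (Z t) (T z))) - L Zd (T z) -
        A (L (W x) (T z)) - L (Z t) (T' z (L (W x) (T z)))‖ ≤ ρ)
    (hK : 0 ≤ K) (hR : R' < R)
    (hf : ∀ t ∈ Icc 0 h, ∀ y y', ‖y‖ ≤ R → ‖y'‖ ≤ R →
      ‖(A y + L (Z t) (T y)) - (A y' + L (Z t) (T y'))‖ ≤ K * ‖y - y'‖)
    {u : ℝ → ℝ → E} {z₀ : E} (hu0 : ∀ t ∈ Icc 0 h, u t 0 = z₀)
    (hu : ∀ t ∈ Icc 0 h, ∀ x ∈ Icc (0 : ℝ) 1, ‖u t x‖ ≤ R' ∧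
      HasDerivWithinAt (u t) (A (u t x) + L (Z t) (T (u t x))) (Icc 0 1) x)
    {η : ℝ} (hη : 0 < η) :
    ∃ δ > 0, ∀ t' ∈ Icc 0 h, |t' - t| < δ →
      ‖u t' 1 - u t 1 - (t' - t) • L P (T (u t 1))‖ ≤ (η + ρ * Real.exp K) * |t' - t| := by
  have hτ := hT.nonneg
  have hw₀ : 0 ≤ w₀ := (norm_nonneg _).trans (hWb 0 ⟨le_rfl, zero_le_one⟩)
  -- Gronwall over $x\in[0,1]$ costs $e^K$, and two errors of size $\eta'$ will be made.
  set η' : ℝ := η / Real.exp K / 2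
  have hη' : 0 < η' := by positivity
  set G : ℝ := ‖L‖ * w₀ * τ
  have hG : 0 ≤ G := by positivity
  -- The coefficient of $|\varepsilon|^2$ in the second-order terms `n3` and `n4`.
  set c : ℝ := ‖L‖ * ‖Zd‖ * τ * G + ‖L‖ * ‖Z t‖ * (τ * G ^ 2)
  have hc : 0 ≤ c := by positivity
  have hη1 : 0 < η' / (‖L‖ * τ + 1) := by positivity
  obtain ⟨δ₁, hδ₁, hZδ⟩ := Metric.eventually_nhds_iff.mp
    ((hasDerivAt_iff_isLittleO.mp hZ).def hη1)
  -- Three constraints on $t'-t$: first-order expansion of `Z`, absorption of the quadratic terms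
  -- into $\eta'$, and keeping the perturbed curve within radius `R`.
  refine ⟨min δ₁ (min (η' / (c + 1)) ((R - R') / (G + 1))),
    lt_min hδ₁ (lt_min (by positivity) (div_pos (by linarith) (by positivity))),
    fun t' ht' hlt => ?_⟩
  obtain ⟨hlt1, hlt23⟩ := lt_min_iff.mp hlt
  obtain ⟨hlt2, hlt3⟩ := lt_min_iff.mp hlt23
  set ε : ℝ := t' - t
  have hZε : ‖Z t' - Z t - ε • Zd‖ ≤ η' / (‖L‖ * τ + 1) * |ε| := by
    simpa [Real.norm_eq_abs] using hZδ (by rwa [Real.dist_eq])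
  rw [lt_div_iff₀ (by positivity)] at hlt2 hlt3
  have hεG : |ε| * G ≤ R - R' := by nlinarith [abs_nonneg ε]
  have hεc : |ε| * c ≤ η' := by nlinarith [abs_nonneg ε]
  have h01 : (1 : ℝ) ∈ Icc (0 : ℝ) 1 := ⟨zero_le_one, le_rfl⟩
  set g : ℝ → E := fun x => L (W x) (T (u t x))
  have hg : ∀ x ∈ Icc (0 : ℝ) 1, ‖g x‖ ≤ G := fun x hx => by
    refine (hT.norm_field_le (W x) _ ((hu t ht x hx).1.trans hR.le)).trans ?_
    exact mul_le_mul_of_nonneg_right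
      (mul_le_mul_of_nonneg_left (hWb x hx) (by positivity)) hτ
  -- The first-order guess $u(t,x)+\varepsilon X_{W(x)}(u(t,x))$ for $u(t',x)$. It is compared with
  -- the true trajectory of parameter $t'$, so differentiability of the flow in the parameter is
  -- never needed.
  set w : ℝ → E := fun x => u t x + ε • g x
  have hwR : ∀ x ∈ Icc (0 : ℝ) 1, ‖w x‖ ≤ R := fun x hx => by
    have h1 : ‖ε • g x‖ ≤ |ε| * G := by
      rw [norm_smul, Real.norm_eq_abs]
      exact mul_le_mul_of_nonneg_left (hg x hx) (abs_nonneg _)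
    have h2 := norm_add_le (u t x) (ε • g x)
    have h3 := (hu t ht x hx).1
    linarith
  set w' : ℝ → E := fun x => (A (u t x) + L (Z t) (T (u t x))) +
    ε • (L (Wd x) (T (u t x)) + L (W x) (T' (u t x) (A (u t x) + L (Z t) (T (u t x)))))
  have hwd : ∀ x ∈ Icc (0 : ℝ) 1, HasDerivWithinAt w (w' x) (Icc 0 1) x := fun x hx => by
    have h1 := (hu t ht x hx).2
    have h2 : HasDerivWithinAt (fun x => T (u t x))
        (T' (u t x) (A (u t x) + L (Z t) (T (u t x)))) (Icc 0 1) x :=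
      (hT.hasFDerivAt (u t x)).comp_hasDerivWithinAt x h1
    have h3 : HasDerivWithinAt (fun x => L (W x)) (L (Wd x)) (Icc 0 1) x :=
      (L.hasFDerivAt.comp_hasDerivAt x (hW x hx)).hasDerivWithinAt
    exact h1.add ((h3.clm_apply h2).const_smul ε)
  have hdef : ∀ x ∈ Icc (0 : ℝ) 1, ‖w' x - (A (w x) + L (Z t') (T (w x)))‖ ≤
      (2 * η' + ρ) * |ε| := fun x hx => by
    have hR1 := (hu t ht x hx).1.trans hR.le
    have hdiff : w x - u t x = ε • g x := by simp only [w]; abel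
    have hng : ‖w x - u t x‖ ≤ |ε| * G := by
      rw [hdiff, norm_smul, Real.norm_eq_abs]
      exact mul_le_mul_of_nonneg_left (hg x hx) (abs_nonneg _)
    -- The part linear in $\varepsilon$ is exactly the zero-curvature defect, bounded by $\rho$;
    -- what remains is the Taylor error of `Z` and two quadratic terms.
    have e : w' x - (A (w x) + L (Z t') (T (w x))) =
        ε • (L (Wd x) (T (u t x)) + L (W x) (T' (u t x) (A (u t x) + L (Z t) (T (u t x)))) -
          L Zd (T (u t x)) - A (g x) - L (Z t) (T' (u t x) (g x))) -
        (L (Z t' - Z t - ε • Zd) (T (w x)) + ε • L Zd (T (w x) - T (u t x)) +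
          L (Z t) (T (w x) - T (u t x) - T' (u t x) (w x - u t x))) := by
      rw [hdiff]
      simp only [w', w, map_add, map_sub, map_smul, sub_apply, smul_apply, smul_add,
        smul_sub]
      abel
    rw [e]
    have n1 : ‖ε • (L (Wd x) (T (u t x)) + L (W x) (T' (u t x) (A (u t x) +
        L (Z t) (T (u t x)))) - L Zd (T (u t x)) - A (g x) - L (Z t) (T' (u t x) (g x)))‖ ≤
        |ε| * ρ := by
      rw [norm_smul, Real.norm_eq_abs]
      exact mul_le_mul_of_nonneg_left (hρ x hx _ hR1) (abs_nonneg _)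
    have n2 : ‖L (Z t' - Z t - ε • Zd) (T (w x))‖ ≤ η' * |ε| := by
      refine (hT.norm_field_le _ _ (hwR x hx)).trans ?_
      have h1 : ‖L‖ * τ * (η' / (‖L‖ * τ + 1)) ≤ η' := by
        rw [mul_div_assoc', div_le_iff₀ (by positivity)]
        nlinarith [hη'.le, mul_nonneg (norm_nonneg L) hτ]
      calc ‖L‖ * ‖Z t' - Z t - ε • Zd‖ * τ
          ≤ ‖L‖ * (η' / (‖L‖ * τ + 1) * |ε|) * τ := by gcongr
        _ = ‖L‖ * τ * (η' / (‖L‖ * τ + 1)) * |ε| := by ring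
        _ ≤ _ := mul_le_mul_of_nonneg_right h1 (abs_nonneg _)
    have n3 : ‖ε • L Zd (T (w x) - T (u t x))‖ ≤ |ε| * (‖L‖ * ‖Zd‖ * τ * (|ε| * G)) := by
      rw [norm_smul, Real.norm_eq_abs, map_sub]
      refine mul_le_mul_of_nonneg_left ?_ (abs_nonneg _)
      refine (hT.norm_field_sub_le Zd _ _ (hwR x hx) hR1).trans ?_
      exact mul_le_mul_of_nonneg_left hng (by positivity)
    have n4 : ‖L (Z t) (T (w x) - T (u t x) - T' (u t x) (w x - u t x))‖ ≤
        ‖L‖ * ‖Z t‖ * (τ * (|ε| * G) ^ 2) := by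
      refine (L.le_opNorm₂ _ _).trans (mul_le_mul_of_nonneg_left ?_ (by positivity))
      refine (hT.norm_taylor_le _ _ hR1 (hwR x hx)).trans (mul_le_mul_of_nonneg_left ?_ hτ)
      exact pow_le_pow_left₀ (norm_nonneg _) hng 2
    have n5 : |ε| * (‖L‖ * ‖Zd‖ * τ * (|ε| * G)) + ‖L‖ * ‖Z t‖ * (τ * (|ε| * G) ^ 2) ≤
        η' * |ε| := by
      calc _ = (|ε| * c) * |ε| := by simp only [c]; ring
        _ ≤ _ := mul_le_mul_of_nonneg_right hεc (abs_nonneg _)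
    refine (_root_.norm_sub_le _ _).trans ((add_le_add n1
      ((norm_add₃_le).trans (add_le_add (add_le_add n2 n3) n4))).trans ?_)
    linarith
  have hfin := norm_sub_le_of_approx (f := fun y => A y + L (Z t') (T y)) (u := u t') (w := w)
    (w' := w') (ε := (2 * η' + ρ) * |ε|) hK (by positivity) (hf t' ht') zero_le_one
    (fun x hx => ⟨(hu t' ht' x hx).1.trans hR.le, (hu t' ht' x hx).2⟩)
    (fun x hx => ⟨hwR x hx, hwd x hx⟩) hdef (by
      simp only [w, g, hW0, hu0 t ht, hu0 t' ht']; simp)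
  have e1 : u t' 1 - w 1 = u t' 1 - u t 1 - ε • L P (T (u t 1)) := by
    simp only [w, g, hW1]; abel
  rw [e1, mul_one, mul_one] at hfin
  refine hfin.trans (le_of_eq ?_)
  have : 2 * η' * Real.exp K = η := by simp only [η']; field_simp
  linear_combination |ε| * this

end Interpolation

end SplittingBEA

end

/-! ### Phases, small divisors, and admissibility of the recursion -/

noncomputable section

namespace SplittingBEA

open Set Filter Topology MeasureTheory
open scoped ENNReal

variable {d : ℕ} {𝒩 : Set (Fin d → ℤ)} {s : ℝ}

/-! ### Families of phases -/

section Phase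

variable {ι : Type*}

/-- A bounded complex family. -/
def bddFamily (f : ι → ℂ) (C : ℝ) (hf : ∀ i, ‖f i‖ ≤ C) : lp (fun _ : ι => ℂ) ⊤ :=
  ⟨f, memℓp_infty ⟨C, by rintro _ ⟨i, rfl⟩; exact hf i⟩⟩

@[simp] lemma bddFamily_apply (f : ι → ℂ) (C : ℝ) (hf : ∀ i, ‖f i‖ ≤ C) (i : ι) :
    bddFamily f C hf i = f i := rfl

lemma norm_bddFamily_le (f : ι → ℂ) {C : ℝ} (hf : ∀ i, ‖f i‖ ≤ C) (hC : 0 ≤ C) :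
    ‖bddFamily f C hf‖ ≤ C :=
  lp.norm_le_of_forall_le hC hf

/-- The bounded family `(exp(i x θ_j))_j`. -/
def phase (θ : ι → ℝ) (x : ℝ) : lp (fun _ : ι => ℂ) ⊤ :=
  bddFamily (fun i => Complex.exp (((x * θ i : ℝ) : ℂ) * Complex.I)) 1 fun _ =>
    (Complex.norm_exp_ofReal_mul_I _).le

lemma phase_apply (θ : ι → ℝ) (x : ℝ) (i : ι) :
    phase θ x i = Complex.exp (((x * θ i : ℝ) : ℂ) * Complex.I) := rfl

lemma norm_phase_apply (θ : ι → ℝ) (x : ℝ) (i : ι) : ‖phase θ x i‖ = 1 :=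
  Complex.norm_exp_ofReal_mul_I _

lemma norm_phase_le (θ : ι → ℝ) (x : ℝ) : ‖phase θ x‖ ≤ 1 := norm_bddFamily_le _ _ zero_le_one

lemma phase_add (θ : ι → ℝ) (x y : ℝ) : phase θ (x + y) = phase θ x * phase θ y := by
  refine lp.ext (funext fun i => ?_)
  rw [lp.infty_coeFn_mul, Pi.mul_apply]
  simp only [phase_apply]
  rw [← Complex.exp_add, ← add_mul, ← Complex.ofReal_add, add_mul]

lemma phase_zero (θ : ι → ℝ) : phase θ 0 = 1 := by
  refine lp.ext (funext fun i => ?_)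
  rw [phase_apply]
  simp

lemma hasDerivAt_phase {θ : ι → ℝ} {l : lp (fun _ : ι => ℂ) ⊤}
    (hl : ∀ i, l i = (θ i : ℂ) * Complex.I) (x : ℝ) :
    HasDerivAt (phase θ) (l * phase θ x) x := by
  -- The error $|e^{iy\theta_j}-1-iy\theta_j|\le|y\theta_j|^2$ is uniform in $j$ because the
  -- frequencies are bounded by `‖l‖`; this gives differentiability in the sup norm.
  have key : ∀ y : ℝ, |y| * ‖l‖ ≤ 1 →
      ‖phase θ (x + y) - phase θ x - y • (l * phase θ x)‖ ≤ (‖l‖ * |y|) ^ 2 := fun y hy => by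
    refine lp.norm_le_of_forall_le (by positivity) fun i => ?_
    have hb : ‖((y * θ i : ℝ) : ℂ) * Complex.I‖ ≤ ‖l‖ * |y| := by
      have := lp.norm_apply_le_norm (by simp) l i
      rw [hl] at this
      rw [Complex.ofReal_mul, mul_assoc, norm_mul, Complex.norm_real, Real.norm_eq_abs, mul_comm]
      exact mul_le_mul_of_nonneg_right this (abs_nonneg _)
    have e : (phase θ (x + y) - phase θ x - y • (l * phase θ x)) i = phase θ x i *
        (Complex.exp (((y * θ i : ℝ) : ℂ) * Complex.I) - 1 - ((y * θ i : ℝ) : ℂ) * Complex.I) := by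
      rw [phase_add]
      simp only [lp.coeFn_sub, lp.coeFn_smul, lp.infty_coeFn_mul, Pi.sub_apply, Pi.smul_apply,
        Pi.mul_apply, hl, Complex.real_smul, phase_apply θ y]
      push_cast
      ring
    rw [e, norm_mul, norm_phase_apply, one_mul]
    refine (Complex.norm_exp_sub_one_sub_id_le (hb.trans (by rwa [mul_comm]))).trans ?_
    exact pow_le_pow_left₀ (norm_nonneg _) hb 2
  rw [hasDerivAt_iff_isLittleO_nhds_zero]
  refine Asymptotics.IsBigO.trans_isLittleO (g := fun y : ℝ => y ^ 2) ?_
    (by simpa using Asymptotics.isLittleO_pow_id (one_lt_two))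
  refine Asymptotics.IsBigO.of_bound (‖l‖ ^ 2) ?_
  have hc : Continuous fun y : ℝ => |y| * ‖l‖ := by fun_prop
  filter_upwards [hc.tendsto 0 |>.eventually (ge_mem_nhds (show |(0 : ℝ)| * ‖l‖ < 1 by simp))]
    with y hy
  refine (key y hy).trans (le_of_eq ?_)
  rw [norm_pow, Real.norm_eq_abs, mul_pow]

lemma continuous_phase {θ : ι → ℝ} {C : ℝ} (hθ : ∀ i, |θ i| ≤ C) : Continuous (phase θ) := by
  have hb : ∀ i, ‖(θ i : ℂ) * Complex.I‖ ≤ C := fun i => by simpa using hθ i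
  exact continuous_iff_continuousAt.mpr fun x =>
    (hasDerivAt_phase (l := bddFamily _ C hb) (fun i => rfl) x).continuousAt

end Phase

/-- Multiplication of the coordinates by a bounded family. -/
def diagL (𝒩 : Set (Fin d → ℤ)) (s : ℝ) :
    lp (fun _ : Idx 𝒩 => ℂ) ⊤ →L[ℂ] EllOne 𝒩 s →L[ℂ] EllOne 𝒩 s :=
  LinearMap.mkContinuous
    { toFun := fun f => EllOne.diag f ‖f‖ (lp.norm_apply_le_norm (by simp) f)
      map_add' := fun f g => by
        ext z : 1
        exact EllOne.ext fun j => by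
          simp only [add_apply, EllOne.coord_add, EllOne.coord_diag, lp.coeFn_add, Pi.add_apply,
            add_mul]
      map_smul' := fun c f => by
        ext z : 1
        exact EllOne.ext fun j => by
          simp only [smul_apply, EllOne.coord_smul, EllOne.coord_diag, lp.coeFn_smul,
            Pi.smul_apply, smul_eq_mul, mul_assoc, RingHom.id_apply] } 1 fun f => by
    rw [one_mul]
    exact EllOne.norm_diag_le f (lp.norm_apply_le_norm (by simp) f) (norm_nonneg _)


/-! ### Frequencies of words -/

/-- The frequency `δ₁ λ_{a₁} + ⋯ + δ_ℓ λ_{a_ℓ}` of a word. -/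
def freq (lam : 𝒩 → ℝ) (w : List (Idx 𝒩)) : ℝ := (w.map fun j => ((j.2 : ℤ) : ℝ) * lam j.1).sum

/-- The frequency of a word of length at most `r`. -/
def cutFreq (r : ℕ) (lam : 𝒩 → ℝ) (w : List (Idx 𝒩)) : ℝ := if w.length ≤ r then freq lam w else 0

lemma freq_map_bar (lam : 𝒩 → ℝ) (w : List (Idx 𝒩)) : freq lam (w.map Idx.bar) = -freq lam w := by
  induction w with
  | nil => simp [freq]
  | cons a w ih =>
    simp only [freq, List.map_cons, List.sum_cons, Idx.bar_snd, Idx.bar_fst, Units.val_neg] at ih ⊢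
    rw [ih]
    push_cast
    ring

lemma cutFreq_map_bar (r : ℕ) (lam : 𝒩 → ℝ) (w : List (Idx 𝒩)) :
    cutFreq r lam (w.map Idx.bar) = -cutFreq r lam w := by
  rw [cutFreq, cutFreq, List.length_map, freq_map_bar]
  split_ifs <;> simp

lemma neg_sum_map_symplSign (lam : 𝒩 → ℝ) (w : List (Idx 𝒩)) :
    -(w.map fun j => symplSign j * (lam j.1 : ℂ)).sum = (freq lam w : ℂ) * Complex.I := by
  induction w with
  | nil => simp [freq]
  | cons a w ih =>
    simp only [freq, List.map_cons, List.sum_cons] at ih ⊢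
    rw [neg_add, ih, symplSign]
    push_cast
    ring

lemma abs_freq_le {lam : 𝒩 → ℝ} {C : ℝ} (hlam : ∀ a, |lam a| ≤ C) (w : List (Idx 𝒩)) :
    |freq lam w| ≤ w.length * C := by
  induction w with
  | nil => simp [freq]
  | cons a w ih =>
    simp only [freq, List.map_cons, List.sum_cons, List.length_cons] at ih ⊢
    refine (abs_add_le _ _).trans ?_
    have h : |((a.2 : ℤ) : ℝ) * lam a.1| ≤ C := by
      rcases Int.units_eq_one_or a.2 with h | h <;> simpa [h] using hlam a.1
    push_cast
    linarith

lemma abs_cutFreq_le {lam : 𝒩 → ℝ} {C : ℝ} (hC : 0 ≤ C) (hlam : ∀ a, |lam a| ≤ C) (r : ℕ)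
    (w : List (Idx 𝒩)) : |cutFreq r lam w| ≤ r * C := by
  rw [cutFreq]
  split_ifs with h
  · refine (abs_freq_le hlam w).trans (mul_le_mul_of_nonneg_right (by exact_mod_cast h) hC)
  · rw [abs_zero]; positivity

lemma phase_cutFreq_map_bar (r : ℕ) (lam : 𝒩 → ℝ) (x : ℝ) (w : List (Idx 𝒩)) :
    phase (cutFreq r lam) x (w.map Idx.bar) = starRingEnd ℂ (phase (cutFreq r lam) x w) := by
  rw [phase_apply, phase_apply, cutFreq_map_bar, ← Complex.exp_conj, map_mul, Complex.conj_I,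
    Complex.conj_ofReal]
  push_cast
  ring_nf

/-- The mean of the phases `exp(i x θ)` over `0 ≤ x ≤ 1`. -/
def phaseMean (θ : ℝ) : ℂ := ∫ t in (0 : ℝ)..1, Complex.exp ((((1 - t) * θ : ℝ) : ℂ) * Complex.I)

lemma phaseMean_neg (θ : ℝ) : phaseMean (-θ) = starRingEnd ℂ (phaseMean θ) := by
  rw [phaseMean, phaseMean, ← intervalIntegral.intervalIntegral_conj]
  refine intervalIntegral.integral_congr fun t _ => ?_
  simp only [← Complex.exp_conj, map_mul, Complex.conj_I, Complex.conj_ofReal]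
  push_cast
  ring_nf

/-- For $\theta\neq0$ the mean is $(e^{i\theta}-1)/(i\theta)$, which vanishes only at nonzero
multiples of $2\pi$; at $\theta=0$ it is 1. This is the only small divisor of the construction. -/
lemma phaseMean_ne_zero {θ : ℝ} (hθ : |θ| < 2 * Real.pi) : phaseMean θ ≠ 0 := by
  rcases eq_or_ne θ 0 with rfl | h0
  · simp [phaseMean]
  have h1 : phaseMean θ = (Complex.exp (θ * Complex.I) - 1) / (θ * Complex.I) := by
    rw [phaseMean, intervalIntegral.integral_comp_sub_left
      (fun t => Complex.exp (((t * θ : ℝ) : ℂ) * Complex.I)) 1]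
    have e : ∀ t : ℝ, ((t * θ : ℝ) : ℂ) * Complex.I = (θ * Complex.I) * t := fun t => by
      push_cast; ring
    simp only [e]
    rw [integral_exp_mul_complex (by simp [h0])]
    simp
  rw [h1]
  refine div_ne_zero (fun h => ?_) (by simp [h0])
  obtain ⟨n, hn⟩ := Complex.exp_eq_one_iff.mp (sub_eq_zero.mp h)
  have h2 : (θ : ℂ) = ((n * (2 * Real.pi) : ℝ) : ℂ) := by
    have := mul_right_cancel₀ Complex.I_ne_zero (hn.trans (mul_assoc _ _ _).symm)
    rw [this]; push_cast; ring
  have h3 : θ = n * (2 * Real.pi) := by exact_mod_cast h2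
  have h4 : n ≠ 0 := by rintro rfl; simp at h3; exact h0 h3
  have h5 : (1 : ℝ) ≤ |(n : ℝ)| := by exact_mod_cast Int.one_le_abs h4
  rw [h3, abs_mul, abs_of_pos Real.two_pi_pos] at hθ
  nlinarith [Real.two_pi_pos]

/-- Compactness of $[-\kappa,\kappa]$ makes the bound uniform in the word and in the step size. -/
lemma exists_norm_phaseMean_inv_le {κ : ℝ} (hκ : κ < 2 * Real.pi) :
    ∃ K, ∀ θ, |θ| ≤ κ → ‖(phaseMean θ)⁻¹‖ ≤ K := by
  have hc : Continuous phaseMean :=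
    intervalIntegral.continuous_parametric_intervalIntegral_of_continuous' (by fun_prop) 0 1
  have hci : ContinuousOn (fun θ => ‖(phaseMean θ)⁻¹‖) (Icc (-κ) κ) :=
    (hc.continuousOn.inv₀ fun θ hθ => phaseMean_ne_zero ((abs_le.mpr hθ).trans_lt hκ)).norm
  obtain ⟨K, hK⟩ := isCompact_Icc.bddAbove_image hci
  exact ⟨K, fun θ hθ => hK ⟨θ, abs_le.mp hθ, rfl⟩⟩

/-! ### Admissibility of the modified Hamiltonian -/

/-- Evaluation at a word. -/
def evalWord (w : List (Idx 𝒩)) : Coeffs 𝒩 →L[ℝ] ℂ :=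
  LinearMap.mkContinuous
    { toFun := fun F => F w
      map_add' := fun _ _ => rfl
      map_smul' := fun _ _ => rfl } 1 fun F => by
    rw [one_mul]; exact F.norm_apply_le w

variable {σ : Prop} {n m : ℕ} {F G : Coeffs 𝒩}

lemma isAdmissible_zero : IsAdmissible σ n (0 : Coeffs 𝒩) :=
  ⟨fun _ h => absurd rfl h, fun _ => (map_zero _).symm⟩

lemma IsAdmissible.add (hF : IsAdmissible σ n F) (hG : IsAdmissible σ n G) :
    IsAdmissible σ n (F + G : Coeffs 𝒩) := by
  refine ⟨fun w hw => ?_, fun w => ?_⟩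
  · by_cases h : F w = 0
    · refine hG.allowed w fun h' => hw ?_
      rw [lp.coeFn_add, Pi.add_apply, h, h', add_zero]
    · exact hF.allowed w h
  · rw [lp.coeFn_add, Pi.add_apply, Pi.add_apply, map_add, hF.real, hG.real]

lemma IsAdmissible.smul (hF : IsAdmissible σ n F) (a : ℝ) :
    IsAdmissible σ n (a • F : Coeffs 𝒩) := by
  refine ⟨fun w hw => hF.allowed w fun h => hw ?_, fun w => ?_⟩
  · rw [lp.coeFn_smul, Pi.smul_apply, h, smul_zero]
  · rw [lp.coeFn_smul, Pi.smul_apply, Pi.smul_apply, hF.real, Complex.real_smul, Complex.real_smul,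
      map_mul, Complex.conj_ofReal]

lemma IsAdmissible.sub (hF : IsAdmissible σ n F) (hG : IsAdmissible σ n G) :
    IsAdmissible σ n (F - G : Coeffs 𝒩) := by
  have := hF.add (hG.smul (-1))
  rwa [neg_one_smul, ← sub_eq_add_neg] at this

lemma IsAdmissible.sum {ι : Type*} {t : Finset ι} {f : ι → Coeffs 𝒩}
    (h : ∀ i ∈ t, IsAdmissible σ n (f i)) : IsAdmissible σ n (∑ i ∈ t, f i : Coeffs 𝒩) :=
  Finset.sum_induction f (fun F : Coeffs 𝒩 => IsAdmissible σ n F) (fun _ _ => IsAdmissible.add)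
    isAdmissible_zero h

lemma IsAdmissible.mul_left (hF : IsAdmissible σ n F)
    (hG : ∀ w, G (w.map Idx.bar) = starRingEnd ℂ (G w)) :
    IsAdmissible σ n (G * F : Coeffs 𝒩) := by
  refine ⟨fun w hw => hF.allowed w fun h => hw ?_, fun w => ?_⟩
  · rw [lp.infty_coeFn_mul, Pi.mul_apply, h, mul_zero]
  · rw [lp.infty_coeFn_mul, Pi.mul_apply, Pi.mul_apply, hF.real, hG, map_mul]

/-- Evaluation at a word is continuous and real linear, so it commutes with the integral, and the
support and reality conditions are checked word by word. -/
lemma isAdmissible_integral {g : ℝ → Coeffs 𝒩} (hg : Continuous g)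
    (h : ∀ t, IsAdmissible σ n (g t)) (a b : ℝ) :
    IsAdmissible σ n (∫ t in a..b, g t : Coeffs 𝒩) := by
  have hw : ∀ w, (∫ t in a..b, g t : Coeffs 𝒩) w = ∫ t in a..b, g t w := fun w =>
    ((evalWord w).intervalIntegral_comp_comm (hg.intervalIntegrable a b)).symm
  refine ⟨fun w hne => ?_, fun w => ?_⟩
  · by_contra hn
    refine hne ?_
    have : ∀ t, g t w = 0 := fun t => by
      by_contra h'
      exact hn ((h t).allowed w h')
    simp [hw, this]
  · rw [hw, hw, ← intervalIntegral.intervalIntegral_conj]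
    simp only [(h _).real]

variable {r : ℕ} {e : ℝ → Coeffs 𝒩} {q P : Coeffs 𝒩}

/-- The real bilinear bracket. -/
def realBracketL (𝒩 : Set (Fin d → ℤ)) (r : ℕ) : Coeffs 𝒩 →L[ℝ] Coeffs 𝒩 →L[ℝ] Coeffs 𝒩 :=
  (bracketL 𝒩 r).bilinearRestrictScalars ℝ

lemma realBracketL_apply (r : ℕ) (F G : Coeffs 𝒩) : realBracketL 𝒩 r F G = bracketL 𝒩 r F G := rfl

/-- Degrees add up with a loss of 2 in each bracket: $(i+1)m+2$ and $(k-i)m+2$ combine to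
$(k+1)m+2$. As this is at most `r`, the truncation in `bracketL` is not felt. -/
lemma isAdmissible_source_of (k : ℕ) (hk : (k + 1) * m + 2 ≤ r)
    (h : ∀ i < k,
      IsAdmissible σ ((i + 1) * m + 2) (modCoeff (realBracketL 𝒩 r) e q P i : Coeffs 𝒩) ∧
      ∀ x, IsAdmissible σ ((i + 1) * m + 2) (genCoeff (realBracketL 𝒩 r) e q P i x : Coeffs 𝒩))
    (x : ℝ) :
    IsAdmissible σ ((k + 1) * m + 2) (source (realBracketL 𝒩 r) e q P k x : Coeffs 𝒩) := by
  refine IsAdmissible.sum fun i _ => ?_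
  have hi := i.2
  have e1 : (i + 1 : ℕ) * m + (k - 1 - i + 1) * m + 2 = (k + 1) * m + 2 := by
    rw [← add_mul]; congr 2; omega
  rw [realBracketL_apply]
  exact e1 ▸ (h i hi).1.bracketL ((h (k - 1 - i) (by omega)).2 x) (by rw [e1]; exact hk)

lemma isAdmissible_interp (hc : Continuous e) (hP : IsAdmissible σ (m + 2) P)
    (he : ∀ x w, e x (w.map Idx.bar) = starRingEnd ℂ (e x w))
    (hq : ∀ w, q (w.map Idx.bar) = starRingEnd ℂ (q w)) (k : ℕ) (hk : (k + 1) * m + 2 ≤ r) :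
    IsAdmissible σ ((k + 1) * m + 2) (modCoeff (realBracketL 𝒩 r) e q P k : Coeffs 𝒩) ∧
      ∀ x, IsAdmissible σ ((k + 1) * m + 2) (genCoeff (realBracketL 𝒩 r) e q P k x : Coeffs 𝒩) := by
  induction k using Nat.strong_induction_on with
  | _ k ih =>
    have hs := isAdmissible_source_of k hk fun i hi =>
      ih i hi (le_trans (by gcongr) hk)
    have hsc := continuous_source (br := realBracketL 𝒩 r) (q := q) (P := P) hc k
    have hP' : IsAdmissible σ ((k + 1) * m + 2) (if k = 0 then P else 0 : Coeffs 𝒩) := by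
      split_ifs with h
      · subst h; simpa using hP
      · exact isAdmissible_zero
    have hZ : IsAdmissible σ ((k + 1) * m + 2)
        (modCoeff (realBracketL 𝒩 r) e q P k : Coeffs 𝒩) := by
      rw [modCoeff_eq]
      exact ((hP'.sub (isAdmissible_integral ((hc.comp (continuous_sub_left 1)).mul hsc)
        (fun t => (hs t).mul_left (he _)) 0 1)).mul_left hq).smul _
    refine ⟨hZ, fun x => ?_⟩
    rw [genCoeff_eq]
    exact (isAdmissible_integral ((hc.comp continuous_neg).mul (continuous_const.add hsc))
      (fun t => ((hZ.smul _).add (hs t)).mul_left (he _)) 0 x).mul_left (he x)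

open Classical in
/-- The inverse means of the phases of the allowed words. -/
def invMean (σ : Prop) (r : ℕ) (lam : 𝒩 → ℝ) (w : List (Idx 𝒩)) : ℂ :=
  if IsAllowed σ r w then (phaseMean (cutFreq r lam w))⁻¹ else 0

lemma invMean_map_bar (σ : Prop) (r : ℕ) (lam : 𝒩 → ℝ) (w : List (Idx 𝒩)) :
    invMean σ r lam (w.map Idx.bar) = starRingEnd ℂ (invMean σ r lam w) := by
  rw [invMean, invMean, isAllowed_map_bar_iff, cutFreq_map_bar, phaseMean_neg]
  split_ifs <;> simp

/-- The frequencies are bounded and those of the allowed words avoid the resonances `2 π ℤ*`. -/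
structure IsNonresonant (σ : Prop) (r : ℕ) (C κ : ℝ) (lam : 𝒩 → ℝ) : Prop where
  abs_le : ∀ a, |lam a| ≤ C
  abs_freq_le : ∀ w, IsAllowed σ r w → |freq lam w| ≤ κ

lemma IsNonresonant.abs_cutFreq_le {C κ : ℝ} {lam : 𝒩 → ℝ} (h : IsNonresonant σ r C κ lam)
    {w : List (Idx 𝒩)} (hw : IsAllowed σ r w) : |cutFreq r lam w| ≤ κ := by
  rw [cutFreq, if_pos hw.length_le]
  exact h.abs_freq_le w hw

lemma IsNonresonant.norm_invMean_le {C κ K : ℝ} {lam : 𝒩 → ℝ} (h : IsNonresonant σ r C κ lam)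
    (hK0 : 0 ≤ K) (hK : ∀ θ, |θ| ≤ κ → ‖(phaseMean θ)⁻¹‖ ≤ K) (w : List (Idx 𝒩)) :
    ‖invMean σ r lam w‖ ≤ K := by
  rw [invMean]
  split_ifs with hw
  · exact hK _ (h.abs_cutFreq_le hw)
  · rwa [norm_zero]

/-- On the support of an admissible family `q` is the true inverse of the mean; off it both sides
vanish, so its value 0 there is harmless. -/
lemma IsNonresonant.mul_integral_phase_mul {C κ : ℝ} {lam : 𝒩 → ℝ} (hC : 0 ≤ C)
    (h : IsNonresonant σ r C κ lam) (hκ : κ < 2 * Real.pi) (hq : ∀ w, q w = invMean σ r lam w)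
    (hF : IsAdmissible σ r F) :
    q * (∫ t in (0 : ℝ)..1, phase (cutFreq r lam) (1 - t)) * F = F := by
  have hc := continuous_phase (SplittingBEA.abs_cutFreq_le hC h.abs_le r)
  refine lp.ext (funext fun w => ?_)
  by_cases hw : F w = 0
  · rw [lp.infty_coeFn_mul, Pi.mul_apply, hw, mul_zero]
  · have ha := hF.allowed w hw
    have e1 : (∫ t in (0 : ℝ)..1, phase (cutFreq r lam) (1 - t) : Coeffs 𝒩) w =
        phaseMean (cutFreq r lam w) :=
      ((evalWord w).intervalIntegral_comp_comm
        ((hc.comp (continuous_sub_left 1)).intervalIntegrable 0 1)).symm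
    rw [lp.infty_coeFn_mul, Pi.mul_apply, lp.infty_coeFn_mul, Pi.mul_apply, e1, hq, invMean,
      if_pos ha, inv_mul_cancel₀ (phaseMean_ne_zero ((h.abs_cutFreq_le ha).trans_lt hκ)), one_mul]

end SplittingBEA

end

/-! ### The truncated zero-curvature equation and the linear flow -/

noncomputable section

namespace SplittingBEA

open Set Filter Topology MeasureTheory
open scoped ENNReal

/-! ### The zero-curvature equation -/

section ZeroCurvature

variable {B E : Type*} [NormedAddCommGroup B] [NormedSpace ℝ B] [NormedAddCommGroup E]
  [NormedSpace ℝ E]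

/-- Reindexing by $n=i+j+1$: truncating the series at order $N$ keeps precisely the pairs with
$i+j+1<N$. -/
lemma sum_smul_convolution (a : ℕ → ℕ → E) (t : ℝ) (N : ℕ) :
    ∑ n ∈ Finset.range N, t ^ n • ∑ i : Fin n, a i (n - 1 - i) =
      ∑ i ∈ Finset.range N, ∑ j ∈ Finset.range N,
        if i + j + 1 < N then t ^ (i + j + 1) • a i j else 0 := by
  simp only [fun n => Fin.sum_univ_eq_sum_range (fun i => a i (n - 1 - i)) n, Finset.smul_sum]
  rw [Finset.sum_sigma', ← Finset.sum_product', ← Finset.sum_filter]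
  refine Finset.sum_bij' (fun x _ => (x.2, x.1 - 1 - x.2)) (fun p _ => ⟨p.1 + p.2 + 1, p.1⟩)
    ?_ ?_ ?_ ?_ ?_
  · rintro ⟨n, i⟩ h
    simp only [Finset.mem_sigma, Finset.mem_range, Finset.mem_filter, Finset.mem_product] at h ⊢
    omega
  · rintro ⟨i, j⟩ h
    simp only [Finset.mem_sigma, Finset.mem_range, Finset.mem_filter, Finset.mem_product] at h ⊢
    omega
  · rintro ⟨n, i⟩ h
    simp only [Finset.mem_sigma, Finset.mem_range] at h
    simp only [Sigma.mk.injEq, heq_eq_eq, and_true]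
    omega
  · rintro ⟨i, j⟩ h
    simp only [Prod.mk.injEq, true_and]
    omega
  · rintro ⟨n, i⟩ h
    simp only [Finset.mem_sigma, Finset.mem_range] at h
    have : i + (n - 1 - i) + 1 = n := by omega
    simp only [this]

/-- If the recursion and the Lie bracket identities hold in low order, only the terms of high order
remain in the zero-curvature equation. -/
lemma zeroCurvature_eq {X : B →L[ℝ] E} {Y : B →L[ℝ] E →L[ℝ] E} {A : E →L[ℝ] E} {a : E}
    {br : B →L[ℝ] B →L[ℝ] B} {Z W V : ℕ → B} {N : ℕ} (t : ℝ)
    (hV : ∀ n < N, X (V n) = A (X (W n)) - Y (W n) a)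
    (hbr : ∀ i j, i + j + 1 < N → X (br (Z i) (W j)) = Y (Z i) (X (W j)) - Y (W j) (X (Z i))) :
    X (∑ n ∈ Finset.range N, t ^ n • (V n + (((n : ℝ) + 1) • Z n +
        ∑ i : Fin n, br (Z i) (W (n - 1 - i))))) +
      Y (∑ n ∈ Finset.range N, t ^ n • W n) (a + X (∑ n ∈ Finset.range N, t ^ (n + 1) • Z n)) -
      X (∑ n ∈ Finset.range N, (((n : ℝ) + 1) * t ^ n) • Z n) -
      A (X (∑ n ∈ Finset.range N, t ^ n • W n)) -
      Y (∑ n ∈ Finset.range N, t ^ (n + 1) • Z n) (X (∑ n ∈ Finset.range N, t ^ n • W n)) =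
    -∑ i ∈ Finset.range N, ∑ j ∈ Finset.range N, if i + j + 1 < N then 0 else
      t ^ (i + j + 1) • (Y (Z i) (X (W j)) - Y (W j) (X (Z i))) := by
  have h1 : X (∑ n ∈ Finset.range N, t ^ n • (V n + (((n : ℝ) + 1) • Z n +
      ∑ i : Fin n, br (Z i) (W (n - 1 - i))))) =
      A (X (∑ n ∈ Finset.range N, t ^ n • W n)) - Y (∑ n ∈ Finset.range N, t ^ n • W n) a +
      X (∑ n ∈ Finset.range N, (((n : ℝ) + 1) * t ^ n) • Z n) +
      ∑ n ∈ Finset.range N, t ^ n • ∑ i : Fin n,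
        (Y (Z i) (X (W (n - 1 - i))) - Y (W (n - 1 - i)) (X (Z i))) := by
    simp only [map_sum, _root_.map_smul, sum_apply, smul_apply]
    rw [← Finset.sum_sub_distrib, ← Finset.sum_add_distrib, ← Finset.sum_add_distrib]
    refine Finset.sum_congr rfl fun n hn => ?_
    have hn' := Finset.mem_range.mp hn
    rw [map_add, map_add, hV n hn', _root_.map_smul, map_sum, smul_add, smul_add, smul_sub,
      smul_smul, mul_comm (t ^ n), ← add_assoc]
    congr 2
    exact Finset.sum_congr rfl fun i _ => hbr _ _ (by have := i.2; omega)
  have h2 : Y (∑ n ∈ Finset.range N, t ^ (n + 1) • Z n) (X (∑ n ∈ Finset.range N, t ^ n • W n)) -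
      Y (∑ n ∈ Finset.range N, t ^ n • W n) (X (∑ n ∈ Finset.range N, t ^ (n + 1) • Z n)) =
      ∑ i ∈ Finset.range N, ∑ j ∈ Finset.range N,
        t ^ (i + j + 1) • (Y (Z i) (X (W j)) - Y (W j) (X (Z i))) := by
    have e1 : Y (∑ n ∈ Finset.range N, t ^ (n + 1) • Z n) (X (∑ n ∈ Finset.range N, t ^ n • W n)) =
        ∑ i ∈ Finset.range N, ∑ j ∈ Finset.range N, t ^ (i + j + 1) • Y (Z i) (X (W j)) := by
      rw [map_sum, sum_apply]
      refine Finset.sum_congr rfl fun i _ => ?_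
      rw [map_sum, map_sum]
      refine Finset.sum_congr rfl fun j _ => ?_
      simp only [_root_.map_smul, smul_apply, smul_smul]
      ring_nf
    have e2 : Y (∑ n ∈ Finset.range N, t ^ n • W n) (X (∑ n ∈ Finset.range N, t ^ (n + 1) • Z n)) =
        ∑ i ∈ Finset.range N, ∑ j ∈ Finset.range N, t ^ (i + j + 1) • Y (W j) (X (Z i)) := by
      rw [map_sum X, map_sum]
      refine Finset.sum_congr rfl fun i _ => ?_
      rw [map_sum, sum_apply]
      refine Finset.sum_congr rfl fun j _ => ?_
      simp only [_root_.map_smul, smul_apply, smul_smul]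
      ring_nf
    rw [e1, e2, ← Finset.sum_sub_distrib]
    refine Finset.sum_congr rfl fun i _ => ?_
    rw [← Finset.sum_sub_distrib]
    exact Finset.sum_congr rfl fun j _ => (smul_sub _ _ _).symm
  have h3 : ∑ n ∈ Finset.range N, t ^ n • ∑ i : Fin n,
        (Y (Z i) (X (W (n - 1 - i))) - Y (W (n - 1 - i)) (X (Z i))) +
      ∑ i ∈ Finset.range N, ∑ j ∈ Finset.range N, (if i + j + 1 < N then 0 else
        t ^ (i + j + 1) • (Y (Z i) (X (W j)) - Y (W j) (X (Z i)))) =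
      ∑ i ∈ Finset.range N, ∑ j ∈ Finset.range N,
        t ^ (i + j + 1) • (Y (Z i) (X (W j)) - Y (W j) (X (Z i))) := by
    rw [sum_smul_convolution (fun i j => Y (Z i) (X (W j)) - Y (W j) (X (Z i))),
      ← Finset.sum_add_distrib]
    refine Finset.sum_congr rfl fun i _ => ?_
    rw [← Finset.sum_add_distrib]
    refine Finset.sum_congr rfl fun j _ => ?_
    split_ifs <;> simp
  rw [← h3] at h2
  rw [h1, map_add]
  have aux : ∀ p q v S D y yz : E, yz - y = S + D →
      p - q + v + S + (q + y) - v - p - yz = -D := by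
    intro p q v S D y yz h
    rw [sub_eq_iff_eq_add.mp h]
    abel
  exact aux _ _ _ _ _ _ _ h2

/-- The surviving pairs have $i+j+1\ge N$, hence a factor $t^{i+j+1}\le h^N$ since $t\le h\le1$;
there are at most $N^2$ of them, each with two terms. -/
lemma norm_zeroCurvature_le {X : B →L[ℝ] E} {Y : B →L[ℝ] E →L[ℝ] E} {Z W : ℕ → B} {N : ℕ}
    {t h D : ℝ} (ht : t ∈ Icc 0 h) (hh : h ≤ 1) (hD : 0 ≤ D)
    (hY : ∀ i < N, ∀ j < N, ‖Y (Z i) (X (W j))‖ ≤ D ∧ ‖Y (W j) (X (Z i))‖ ≤ D) :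
    ‖∑ i ∈ Finset.range N, ∑ j ∈ Finset.range N, if i + j + 1 < N then 0 else
      t ^ (i + j + 1) • (Y (Z i) (X (W j)) - Y (W j) (X (Z i)))‖ ≤ N * N * (2 * D) * h ^ N := by
  have key : ∀ i ∈ Finset.range N, ∀ j ∈ Finset.range N, ‖(if i + j + 1 < N then 0 else
      t ^ (i + j + 1) • (Y (Z i) (X (W j)) - Y (W j) (X (Z i))) : E)‖ ≤ h ^ N * (2 * D) := by
    intro i hi j hj
    have h0 : 0 ≤ h := ht.1.trans ht.2
    split_ifs with hij
    · rw [norm_zero]; positivity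
    · obtain ⟨h1, h2⟩ := hY i (Finset.mem_range.mp hi) j (Finset.mem_range.mp hj)
      rw [norm_smul, norm_pow, Real.norm_of_nonneg ht.1]
      refine mul_le_mul ?_ ((norm_sub_le _ _).trans (by linarith)) (norm_nonneg _) (by positivity)
      exact (pow_le_pow_of_le_one ht.1 (ht.2.trans hh) (not_lt.mp hij)).trans
        (pow_le_pow_left₀ ht.1 ht.2 N)
  refine (norm_sum_le_of_le _ fun i hi => norm_sum_le_of_le _ (key i hi)).trans (le_of_eq ?_)
  simp only [Finset.sum_const, Finset.card_range, nsmul_eq_mul]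
  ring

end ZeroCurvature

variable {d : ℕ} {𝒩 : Set (Fin d → ℤ)} {s : ℝ}

/-! ### The vector fields as real analytic maps -/

/-- The real bilinear map underlying `hamL`. -/
def realHamL (𝒩 : Set (Fin d → ℤ)) (s : ℝ) [Fact (0 ≤ s)] (r : ℕ) :
    Coeffs 𝒩 →L[ℝ] WordL1 𝒩 →L[ℝ] EllOne 𝒩 s :=
  (hamL 𝒩 s r).bilinearRestrictScalars ℝ

/-- The real derivative of `tensors`. -/
def realTensorsDeriv (r : ℕ) (z : EllOne 𝒩 s) : EllOne 𝒩 s →L[ℝ] WordL1 𝒩 :=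
  (tensorsDeriv r z).restrictScalars ℝ

lemma exists_isTameOn_tensors (𝒩 : Set (Fin d → ℤ)) (s : ℝ) (r : ℕ) (R : ℝ) :
    ∃ τ, IsTameOn (tensors r : EllOne 𝒩 s → WordL1 𝒩) (realTensorsDeriv r) R τ := by
  obtain ⟨C₁, h₁, H₁⟩ := exists_norm_tensors_le 𝒩 s r R
  obtain ⟨C₂, h₂, H₂⟩ := exists_norm_tensors_sub_le 𝒩 s r R
  obtain ⟨C₃, h₃, H₃⟩ := exists_norm_tensors_taylor_le 𝒩 s r R
  obtain ⟨C₄, h₄, H₄⟩ := exists_norm_tensorsDeriv_le 𝒩 s r R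
  refine ⟨C₁ + C₂ + C₃ + C₄, fun z => (hasFDerivAt_tensors r z).restrictScalars ℝ, by positivity,
    fun z hz => (H₁ z hz).trans (by linarith), fun z z' hz hz' => (H₂ z z' hz hz').trans ?_,
    fun z z' hz hz' => (H₃ z z' hz hz').trans ?_, fun z y hz => (H₄ z y hz).trans ?_⟩
  all_goals
    refine mul_le_mul_of_nonneg_right ?_ (by positivity)
    linarith

/-- The generator of the linear flow. -/
def linL (s : ℝ) (lam : 𝒩 → ℝ) (C : ℝ) (h : ∀ j : Idx 𝒩, ‖symplSign j * (lam j.1 : ℂ)‖ ≤ C) :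
    EllOne 𝒩 s →L[ℝ] EllOne 𝒩 s :=
  (EllOne.diag (fun j => symplSign j * (lam j.1 : ℂ)) C h).restrictScalars ℝ

/-- The linear flow. -/
def linFlow (s : ℝ) (lam : 𝒩 → ℝ) (t : ℝ) : EllOne 𝒩 s →L[ℝ] EllOne 𝒩 s :=
  (diagL 𝒩 s).bilinearRestrictScalars ℝ (phase (fun j => -(((j.2 : ℤ) : ℝ) * lam j.1)) t)

lemma coord_linFlow (lam : 𝒩 → ℝ) (t : ℝ) (z : EllOne 𝒩 s) (j : Idx 𝒩) :
    (linFlow s lam t z).coord j =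
      phase (fun j : Idx 𝒩 => -(((j.2 : ℤ) : ℝ) * lam j.1)) t j * z.coord j := rfl

lemma isIsometricFlow_linFlow (lam : 𝒩 → ℝ) (C : ℝ)
    (h : ∀ j : Idx 𝒩, ‖symplSign j * (lam j.1 : ℂ)‖ ≤ C) :
    IsIsometricFlow (linL s lam C h) (linFlow s lam) := by
  constructor
  · intro t
    have hl : ∀ j : Idx 𝒩, bddFamily (fun j : Idx 𝒩 => symplSign j * (lam j.1 : ℂ)) C h j =
        ((-(((j.2 : ℤ) : ℝ) * lam j.1) : ℝ) : ℂ) * Complex.I := fun j => by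
      rw [bddFamily_apply, symplSign]; push_cast; ring
    have := (((diagL 𝒩 s).bilinearRestrictScalars ℝ).hasFDerivAt.comp_hasDerivAt t
      (hasDerivAt_phase hl t))
    refine this.congr_deriv ?_
    ext z : 1
    refine EllOne.ext fun j => ?_
    exact mul_assoc _ _ _
  · intro t z
    rw [EllOne.norm_def, EllOne.norm_def]
    refine tsum_congr fun j => ?_
    rw [coord_linFlow, norm_mul, norm_phase_apply, one_mul]
  · intro z
    refine EllOne.ext fun j => ?_
    rw [coord_linFlow, phase_zero]
    simp
  · intro t z
    refine EllOne.ext fun j => ?_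
    have := congrArg (fun f : lp (fun _ : Idx 𝒩 => ℂ) ⊤ => f j)
      (phase_add (fun j : Idx 𝒩 => -(((j.2 : ℤ) : ℝ) * lam j.1)) t (-t))
    simp only [add_neg_cancel, phase_zero, lp.infty_coeFn_mul, Pi.mul_apply, lp.infty_coeFn_one,
      Pi.one_apply] at this
    rw [coord_linFlow, coord_linFlow, ← mul_assoc, ← this, one_mul]

lemma linFlow_one (lam : 𝒩 → ℝ) (z : EllOne 𝒩 s) : linFlow s lam 1 z = phaseFlow lam z := by
  refine EllOne.ext fun j => ?_
  rw [coord_linFlow, phase_apply]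
  change _ = Complex.exp (((-((j.2 : ℤ) : ℝ) * lam j.1 : ℝ) : ℂ) * Complex.I) * z.coord j
  rw [one_mul, neg_mul]

lemma norm_phaseFlow (lam : 𝒩 → ℝ) (z : EllOne 𝒩 s) : ‖phaseFlow lam z‖ = ‖z‖ := by
  rw [EllOne.norm_def, EllOne.norm_def]
  refine tsum_congr fun j => ?_
  change _ * ‖Complex.exp _ * z.coord j‖ = _
  rw [norm_mul, Complex.norm_exp_ofReal_mul_I, one_mul]

end SplittingBEA

end

/-! ### Size of the defect and rescaling of time -/

noncomputable section

namespace SplittingBEA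

open Set Filter Topology MeasureTheory
open scoped ENNReal

variable {d : ℕ} {𝒩 : Set (Fin d → ℤ)} {s : ℝ}

/-! ### The modified Hamiltonian -/

section ModHam

variable {B : Type*} [NormedCommRing B] [NormedAlgebra ℝ B]

/-- The truncated modified Hamiltonian, without its linear part. -/
def modHam (br : B →L[ℝ] B →L[ℝ] B) (e : ℝ → B) (q P : B) (N : ℕ) (t : ℝ) : B :=
  ∑ n ∈ Finset.range N, t ^ (n + 1) • modCoeff br e q P n

/-- The truncated generator. -/
def genHam (br : B →L[ℝ] B →L[ℝ] B) (e : ℝ → B) (q P : B) (N : ℕ) (t x : ℝ) : B :=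
  ∑ n ∈ Finset.range N, t ^ n • genCoeff br e q P n x

variable {br : B →L[ℝ] B →L[ℝ] B} {e : ℝ → B} {q P : B} {N : ℕ}

lemma hasDerivAt_modHam (t : ℝ) : HasDerivAt (modHam br e q P N)
    (∑ n ∈ Finset.range N, (((n : ℝ) + 1) * t ^ n) • modCoeff br e q P n) t := by
  refine HasDerivAt.fun_sum fun n _ => ?_
  have := (hasDerivAt_pow (n + 1) t).smul_const (modCoeff br e q P n)
  simpa using this

lemma modHam_zero : modHam br e q P N 0 = 0 := by simp [modHam]

lemma hasDerivAt_genHam [CompleteSpace B] {l : B} (he : ∀ x, HasDerivAt e (l * e x) x)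
    (hinv : ∀ x, e x * e (-x) = 1) (t x : ℝ) : HasDerivAt (genHam br e q P N t)
    (∑ n ∈ Finset.range N, t ^ n • (l * genCoeff br e q P n x +
      (((n : ℝ) + 1) • modCoeff br e q P n + ∑ i : Fin n,
        br (modCoeff br e q P i) (genCoeff br e q P (n - 1 - i) x)))) x :=
  HasDerivAt.fun_sum fun n _ => (hasDerivAt_genCoeff he hinv n x).const_smul (t ^ n)

lemma genHam_zero (t : ℝ) : genHam br e q P N t 0 = 0 := by
  simp [genHam, genCoeff_zero]

lemma genHam_one (t : ℝ) (hN : 1 ≤ N)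
    (h : ∀ n < N, genCoeff br e q P n 1 = if n = 0 then P else 0) : genHam br e q P N t 1 = P := by
  rw [genHam, Finset.sum_eq_single_of_mem 0 (Finset.mem_range.mpr hN), h 0 hN]
  · simp
  · intro n hn h0
    rw [h n (Finset.mem_range.mp hn), if_neg h0, smul_zero]

lemma norm_modHam_le {c : ℕ → ℝ} {t : ℝ} (ht : t ∈ Icc (0 : ℝ) 1)
    (h : ∀ n < N, ‖modCoeff br e q P n‖ ≤ c n) :
    ‖modHam br e q P N t‖ ≤ t * ∑ n ∈ Finset.range N, c n := by
  rw [Finset.mul_sum]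
  refine norm_sum_le_of_le _ fun n hn => ?_
  rw [norm_smul, norm_pow, Real.norm_of_nonneg ht.1]
  exact mul_le_mul (pow_le_of_le_one ht.1 ht.2 n.succ_ne_zero) (h n (Finset.mem_range.mp hn))
    (norm_nonneg _) ht.1

lemma norm_genHam_le {c : ℕ → ℝ} {t x : ℝ} (ht : t ∈ Icc (0 : ℝ) 1)
    (h : ∀ n < N, ‖genCoeff br e q P n x‖ ≤ c n) :
    ‖genHam br e q P N t x‖ ≤ ∑ n ∈ Finset.range N, c n := by
  refine norm_sum_le_of_le _ fun n hn => ?_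
  rw [norm_smul, norm_pow, Real.norm_of_nonneg ht.1]
  exact (mul_le_of_le_one_left (norm_nonneg _) (pow_le_one₀ ht.1 ht.2)).trans
    (h n (Finset.mem_range.mp hn))

end ModHam

section Defect

variable {σ : Prop} {r m N : ℕ} {lam : 𝒩 → ℝ} {C : ℝ}

lemma norm_symplSign_mul_le (h : ∀ a, |lam a| ≤ C) (j : Idx 𝒩) :
    ‖symplSign j * (lam j.1 : ℂ)‖ ≤ C := by
  rw [norm_mul, norm_symplSign, one_mul, Complex.norm_real, Real.norm_eq_abs]
  exact h j.1

/-- The zero-curvature equation holds up to terms of high order. -/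
lemma norm_defect_le [Fact (0 ≤ s)] (hC : 0 ≤ C) (hlam : ∀ a, |lam a| ≤ C) (hN : N * m + 2 ≤ r)
    {l : Coeffs 𝒩} (hl : ∀ w, l w = (cutFreq r lam w : ℂ) * Complex.I) {Z W : ℕ → Coeffs 𝒩}
    (hadm : ∀ n < N, IsAdmissible σ ((n + 1) * m + 2) (Z n : Coeffs 𝒩) ∧
      IsAdmissible σ ((n + 1) * m + 2) (W n : Coeffs 𝒩))
    {R τ D : ℝ} (hT : IsTameOn (tensors r : EllOne 𝒩 s → WordL1 𝒩) (realTensorsDeriv r) R τ)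
    {t h : ℝ} (ht : t ∈ Icc 0 h) (hh : h ≤ 1) (hZ : ∀ n < N, ‖Z n‖ ≤ D) (hW : ∀ n < N, ‖W n‖ ≤ D)
    (L : Coeffs 𝒩 →L[ℝ] WordL1 𝒩 →L[ℝ] EllOne 𝒩 s) (hL : L = realHamL 𝒩 s r)
    (A : EllOne 𝒩 s →L[ℝ] EllOne 𝒩 s) (hA : A = linL s lam C (norm_symplSign_mul_le hlam))
    {z : EllOne 𝒩 s} (hz : ‖z‖ ≤ R) :
    ‖L (∑ n ∈ Finset.range N, t ^ n • (l * W n + (((n : ℝ) + 1) • Z n +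
        ∑ i : Fin n, realBracketL 𝒩 r (Z i) (W (n - 1 - i))))) (tensors r z) +
      L (∑ n ∈ Finset.range N, t ^ n • W n) (realTensorsDeriv r z
        (A z + L (∑ n ∈ Finset.range N, t ^ (n + 1) • Z n) (tensors r z))) -
      L (∑ n ∈ Finset.range N, (((n : ℝ) + 1) * t ^ n) • Z n) (tensors r z) -
      A (L (∑ n ∈ Finset.range N, t ^ n • W n) (tensors r z)) -
      L (∑ n ∈ Finset.range N, t ^ (n + 1) • Z n) (realTensorsDeriv r z
        (L (∑ n ∈ Finset.range N, t ^ n • W n) (tensors r z)))‖ ≤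
    N * N * (2 * (‖L‖ * D * (τ * (‖L‖ * D * τ)))) * h ^ N := by
  have hdeg : ∀ n < N, (n + 1) * m + 2 ≤ r := fun n hn => le_trans (by gcongr; omega) hN
  have hτ := hT.nonneg
  -- At a fixed point $z$, `X F` is the field $X_F(z)$ and `Y F` its derivative there, both linear
  -- in `F`; the zero-curvature identity becomes algebra in these two maps.
  set X : Coeffs 𝒩 →L[ℝ] EllOne 𝒩 s := L.flip (tensors r z) with hX
  have hXa : ∀ F, L F (tensors r z) = X F := fun _ => rfl
  set Y : Coeffs 𝒩 →L[ℝ] EllOne 𝒩 s →L[ℝ] EllOne 𝒩 s :=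
    ((ContinuousLinearMap.compL ℝ (EllOne 𝒩 s) (WordL1 𝒩) (EllOne 𝒩 s)).flip
      (realTensorsDeriv r z)).comp L with hY
  have hYa : ∀ F y, L F (realTensorsDeriv r z y) = Y F y := fun _ _ => rfl
  have hV : ∀ n < N, X (l * W n) = A (X (W n)) - Y (W n) (A z) := fun n hn => by
    rw [← hXa, ← hXa, ← hYa, hL, hA]
    refine (hadm n hn).2.hamL_mul (hdeg n hn) hC (norm_symplSign_mul_le hlam)
      (fun j => by rw [symplSign_bar, Idx.bar_fst, neg_mul]) (fun w => ?_) z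
    rw [neg_sum_map_symplSign, lp.infty_coeFn_mul, Pi.mul_apply, hl]
    -- The cut-off of the frequencies is invisible on the support, where words have length at most
    -- `r`.
    by_cases hw : W n w = 0
    · rw [hw, mul_zero, mul_zero]
    · rw [cutFreq, if_pos (((hadm n hn).2.allowed w hw).length_le.trans (hdeg n hn))]
  have hbr : ∀ i j, i + j + 1 < N → X (realBracketL 𝒩 r (Z i) (W j)) =
      Y (Z i) (X (W j)) - Y (W j) (X (Z i)) := fun i j hij => by
    rw [← hXa, ← hXa, ← hXa, ← hYa, ← hYa, hL]
    refine (hadm i (by omega)).1.hamL_bracketL (hadm j (by omega)).2 ?_ z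
    rw [← add_mul]
    exact le_trans (by gcongr; omega) hN
  have hb : ∀ F G : Coeffs 𝒩, ‖F‖ ≤ D → ‖G‖ ≤ D → ‖Y F (X G)‖ ≤
      ‖L‖ * D * (τ * (‖L‖ * D * τ)) := fun F G hF hG => by
    have hD : 0 ≤ D := (norm_nonneg _).trans hF
    have h1 : ‖X G‖ ≤ ‖L‖ * D * τ :=
      (hT.norm_field_le G z hz).trans (mul_le_mul_of_nonneg_right
        (mul_le_mul_of_nonneg_left hG (by positivity)) hτ)
    have h2 : ‖realTensorsDeriv r z (X G)‖ ≤ τ * (‖L‖ * D * τ) :=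
      (hT.norm_deriv_le z _ hz).trans (mul_le_mul_of_nonneg_left h1 hτ)
    rw [← hYa]
    exact (L.le_opNorm₂ F _).trans (mul_le_mul (mul_le_mul_of_nonneg_left hF (by positivity)) h2
      (norm_nonneg _) (by positivity))
  rcases Nat.eq_zero_or_pos N with rfl | hN0
  · simp
  have hD : 0 ≤ D := (norm_nonneg _).trans (hZ 0 hN0)
  simp only [hXa, hYa]
  rw [zeroCurvature_eq t hV hbr, norm_neg]
  exact norm_zeroCurvature_le ht hh (by positivity) fun i hi j hj =>
    ⟨hb _ _ (hZ i hi) (hW j hj), hb _ _ (hW j hj) (hZ i hi)⟩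

end Defect

/-! ### Rescaling of time -/

lemma hasDerivWithinAt_rescale {E : Type*} [NormedAddCommGroup E] [NormedSpace ℝ E] {u : ℝ → E}
    {v : E} {h t : ℝ} (hh : 0 < h) (hu : HasDerivWithinAt u v (Icc 0 1) (t / h)) :
    HasDerivWithinAt (fun t => u (t / h)) (h⁻¹ • v) (Icc 0 h) t := by
  have h1 : HasDerivWithinAt (fun t : ℝ => t / h) h⁻¹ (Icc 0 h) t := by
    simpa using ((hasDerivAt_id t).div_const h).hasDerivWithinAt
  refine hu.scomp t h1 fun x hx => ?_
  exact ⟨div_nonneg hx.1 hh.le, (div_le_one hh).mpr hx.2⟩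

lemma isIsometricFlow_zero (E : Type*) [NormedAddCommGroup E] [NormedSpace ℝ E] :
    IsIsometricFlow (0 : E →L[ℝ] E) fun _ => ContinuousLinearMap.id ℝ E :=
  ⟨fun t => by simpa using hasDerivAt_const t (ContinuousLinearMap.id ℝ E), fun _ _ => rfl,
    fun _ => rfl, fun _ _ => rfl⟩

end SplittingBEA

end

/-! ### Backward error of one splitting step -/

noncomputable section

namespace SplittingBEA

open Set Filter Topology MeasureTheory
open scoped ENNReal

variable {d : ℕ} {𝒩 : Set (Fin d → ℤ)} {s : ℝ}

/-- `u` solves `u' = A u + X_F(u)` on `[0, T]`. -/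
def IsSolution [Fact (0 ≤ s)] (r : ℕ) (A : EllOne 𝒩 s →L[ℝ] EllOne 𝒩 s) (F : Coeffs 𝒩) (T : ℝ)
    (u : ℝ → EllOne 𝒩 s) : Prop :=
  ∀ t ∈ Icc 0 T, HasDerivWithinAt u (A (u t) + realHamL 𝒩 s r F (tensors r (u t))) (Icc 0 T) t

lemma IsTameOn.norm_vectorField_sub_le {B V E : Type*} [NormedAddCommGroup B] [NormedSpace ℝ B]
    [NormedAddCommGroup V] [NormedSpace ℝ V] [NormedAddCommGroup E] [NormedSpace ℝ E]
    {T : E → V} {T' : E → E →L[ℝ] V} {R τ : ℝ} {L : B →L[ℝ] V →L[ℝ] E} {A : E →L[ℝ] E}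
    (hT : IsTameOn T T' R τ) (F : B) {a b : ℝ} (hA : ‖A‖ ≤ a) (hb : ‖L‖ * ‖F‖ * τ ≤ b)
    (y y' : E) (hy : ‖y‖ ≤ R) (hy' : ‖y'‖ ≤ R) :
    ‖(A y + L F (T y)) - (A y' + L F (T y'))‖ ≤ (a + b) * ‖y - y'‖ := by
  have e : (A y + L F (T y)) - (A y' + L F (T y')) =
      A (y - y') + (L F (T y) - L F (T y')) := by rw [map_sub]; abel
  rw [e, add_mul]
  refine (norm_add_le _ _).trans (add_le_add ?_ ?_)
  · exact (A.le_opNorm _).trans (mul_le_mul_of_nonneg_right hA (norm_nonneg _))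
  · exact (hT.norm_field_sub_le F y y' hy hy').trans
      (mul_le_mul_of_nonneg_right hb (norm_nonneg _))

lemma exists_isSolution [Fact (0 ≤ s)] {r : ℕ} {A : EllOne 𝒩 s →L[ℝ] EllOne 𝒩 s}
    {U : ℝ → EllOne 𝒩 s →L[ℝ] EllOne 𝒩 s} (hU : IsIsometricFlow A U) {R τ : ℝ}
    (hT : IsTameOn (tensors r : EllOne 𝒩 s → WordL1 𝒩) (realTensorsDeriv r) R τ) {F : Coeffs 𝒩}
    (hF : ‖realHamL 𝒩 s r‖ * ‖F‖ * τ ≤ 1) {z : EllOne 𝒩 s} (hz : ‖z‖ + 1 ≤ R) :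
    ∃ u : ℝ → EllOne 𝒩 s, u 0 = z ∧ (∀ t ∈ Icc (0 : ℝ) 1, ‖u t‖ ≤ R) ∧ IsSolution r A F 1 u := by
  obtain ⟨u, hu0, hu⟩ := exists_trajectory hU (F := fun y => realHamL 𝒩 s r F (tensors r y))
    (K := 1) hz (fun y hy => (hT.norm_field_le F y hy).trans hF) fun y y' hy hy' => by
      refine (hT.norm_field_sub_le F y y' hy hy').trans ?_
      exact mul_le_mul_of_nonneg_right (by simpa using hF) (norm_nonneg _)
  exact ⟨u, hu0, fun t ht => (hu t ht).1, fun t ht => (hu t ht).2⟩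

lemma IsSolution.rescale [Fact (0 ≤ s)] {r : ℕ} {F : Coeffs 𝒩} {h : ℝ} (hh : 0 < h)
    {u : ℝ → EllOne 𝒩 s} (hu : IsSolution r 0 (h • F) 1 u) :
    IsSolution r 0 F h fun t => u (t / h) := fun t ht => by
  have := hasDerivWithinAt_rescale hh
    (hu (t / h) ⟨div_nonneg ht.1 hh.le, (div_le_one hh).mpr ht.2⟩)
  refine this.congr_deriv ?_
  simp only [zero_apply, zero_add]
  rw [_root_.map_smul, smul_apply, smul_smul,
    inv_mul_cancel₀ hh.ne', one_smul]

/-- One splitting step is the flow of a modified Hamiltonian up to a small error, uniformly over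
the nonresonant frequencies. -/
theorem exists_modified [Fact (0 ≤ s)] {σ : Prop} {r m N : ℕ} (hN1 : 1 ≤ N) (hN : N * m + 2 ≤ r)
    {C κ : ℝ} (hC : 0 ≤ C) (hκ : κ < 2 * Real.pi) {P : Coeffs 𝒩} (hP : IsAdmissible σ (m + 2) P)
    (M : ℝ) :
    ∃ h₀ > 0, ∃ C' : ℝ, ∀ lam : 𝒩 → ℝ, ∀ hlam : IsNonresonant σ r C κ lam, ∀ h, 0 < h → h ≤ h₀ →
      ∃ Z : Coeffs 𝒩, IsAdmissible σ r Z ∧ ∀ z : EllOne 𝒩 s, ‖z‖ ≤ M →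
        ∃ u v : ℝ → EllOne 𝒩 s, u 0 = z ∧ v 0 = phaseFlow lam z ∧
          IsSolution r (linL s lam C (norm_symplSign_mul_le hlam.abs_le)) Z 1 u ∧
          IsSolution r 0 P h v ∧ ‖u 1 - v h‖ ≤ C' * h ^ (N + 1) := by
  obtain ⟨K, hK⟩ := exists_norm_phaseMean_inv_le hκ
  -- Trajectories start in the ball of radius $M$ and stay in that of radius $M+1$; the radius $M+2$
  -- leaves room for the first-order perturbations of the interpolation.
  obtain ⟨τ, hT1⟩ := exists_isTameOn_tensors 𝒩 s r (M + 2)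
  obtain ⟨τ', hT'⟩ := exists_isTameOn_tensors 𝒩 s r (M + 1)
  choose D hD0 hD using exists_interp_bound (realBracketL 𝒩 r) P |K|
  have hτ := hT1.nonneg
  have hτ' := hT'.nonneg
  set L := realHamL 𝒩 s r with hL
  set S : ℝ := ∑ n ∈ Finset.range N, D n
  have hS : 0 ≤ S := Finset.sum_nonneg fun n _ => hD0 n
  set G : ℝ := ‖L‖ * (S + ‖P‖) * (τ + τ')
  have hG : 0 ≤ G := by positivity
  set ρ₀ : ℝ := N * N * (2 * (‖L‖ * S * (τ * (‖L‖ * S * τ))))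
  have hρ₀ : 0 ≤ ρ₀ := by positivity
  -- The bound on $h$ makes the nonlinear fields at most 1 in norm and in Lipschitz constant. In the
  -- error constant, $e^{C+1}$ comes from Gronwall in $x$ and $e^1$ from Gronwall in $t$.
  refine ⟨min 1 (1 / (G + 1)), lt_min one_pos (by positivity),
    ρ₀ * Real.exp (C + 1) * Real.exp 1, fun lam hlam h hh0 hhle => ?_⟩
  obtain ⟨hh1, hhG⟩ := le_min_iff.mp hhle
  rw [le_div_iff₀ (by positivity)] at hhG
  have hGle : ∀ t ∈ Icc 0 h, t * G ≤ 1 := fun t ht => by nlinarith [ht.1, ht.2]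
  set q : Coeffs 𝒩 := bddFamily (invMean σ r lam) |K|
    (hlam.norm_invMean_le (abs_nonneg K) fun θ hθ => (hK θ hθ).trans (le_abs_self K))
  have hqn : ‖q‖ ≤ |K| := norm_bddFamily_le _ _ (abs_nonneg K)
  have hqbar : ∀ w, q (w.map Idx.bar) = starRingEnd ℂ (q w) := invMean_map_bar σ r lam
  set e := phase (cutFreq r lam) with he
  have hcut := abs_cutFreq_le hC hlam.abs_le r
  have hec : Continuous e := continuous_phase hcut
  set l : Coeffs 𝒩 := bddFamily (fun w => (cutFreq r lam w : ℂ) * Complex.I) (r * C)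
    (fun w => by simpa using hcut w)
  have hl : ∀ w, l w = (cutFreq r lam w : ℂ) * Complex.I := fun w => rfl
  have hbound := fun n => hD n e q (norm_phase_le _) hqn
  set br := realBracketL 𝒩 r
  set Z : ℝ → Coeffs 𝒩 := modHam br e q P N with hZdef
  have h01 : ∀ t ∈ Icc 0 h, t ∈ Icc (0 : ℝ) 1 := fun t ht => ⟨ht.1, ht.2.trans hh1⟩
  have hdeg : ∀ n < N, (n + 1) * m + 2 ≤ r := fun n hn => le_trans (by gcongr; omega) hN
  have hadm : ∀ n < N, IsAdmissible σ ((n + 1) * m + 2) (modCoeff br e q P n : Coeffs 𝒩) ∧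
      ∀ x, IsAdmissible σ ((n + 1) * m + 2) (genCoeff br e q P n x : Coeffs 𝒩) := fun n hn =>
    isAdmissible_interp hec hP (phase_cutFreq_map_bar r lam) hqbar n (hdeg n hn)
  have hZadm : ∀ t, IsAdmissible σ r (Z t : Coeffs 𝒩) := fun t =>
    IsAdmissible.sum fun n hn =>
      ((hadm n (Finset.mem_range.mp hn)).1.mono (hdeg n (Finset.mem_range.mp hn))).smul _
  have hgen1 : ∀ n < N, genCoeff br e q P n 1 = if n = 0 then P else 0 := fun n hn => by
    refine genCoeff_one hec (phase_add _) n ?_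
    refine hlam.mul_integral_phase_mul hC hκ (fun w => rfl) ?_
    refine IsAdmissible.sub ?_ (isAdmissible_integral ((hec.comp (continuous_sub_left 1)).mul
      (continuous_source hec n)) (fun t => IsAdmissible.mul_left ?_ (phase_cutFreq_map_bar r lam _))
      0 1)
    · split_ifs
      · exact hP.mono ((by simpa using hdeg 0 hN1))
      · exact isAdmissible_zero
    · refine (isAdmissible_source_of n (hdeg n hn) (fun i hi => hadm i (hi.trans hn)) t).mono
        (hdeg n hn)
  have hZn : ∀ t ∈ Icc 0 h, ‖Z t‖ ≤ t * S := fun t ht =>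
    norm_modHam_le (h01 t ht) fun n _ => (hbound n).1
  have hDS : ∀ n < N, D n ≤ S := fun n hn =>
    Finset.single_le_sum (fun i _ => hD0 i) (Finset.mem_range.mpr hn)
  have hsmall : ∀ t ∈ Icc 0 h, ∀ τ₁, 0 ≤ τ₁ → τ₁ ≤ τ + τ' → ∀ F : Coeffs 𝒩,
      ‖F‖ ≤ t * (S + ‖P‖) → ‖L‖ * ‖F‖ * τ₁ ≤ 1 := fun t ht τ₁ h1 h2 F hF =>
    calc ‖L‖ * ‖F‖ * τ₁ ≤ ‖L‖ * (t * (S + ‖P‖)) * (τ + τ') := by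
          have := ht.1
          gcongr
      _ = t * G := by simp only [G]; ring
      _ ≤ 1 := hGle t ht
  have hZs : ∀ t ∈ Icc 0 h, ‖Z t‖ ≤ t * (S + ‖P‖) := fun t ht =>
    (hZn t ht).trans (mul_le_mul_of_nonneg_left (le_add_of_nonneg_right (norm_nonneg _)) ht.1)
  set A := linL s lam C (norm_symplSign_mul_le hlam.abs_le) with hA
  have hflow : IsIsometricFlow A (linFlow s lam) := isIsometricFlow_linFlow _ _ _
  have hAn : ‖A‖ ≤ C := by
    refine A.opNorm_le_bound hC fun y => ?_
    exact (EllOne.diag (s := s) _ C (norm_symplSign_mul_le hlam.abs_le)).le_of_opNorm_le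
      (EllOne.norm_diag_le _ _ hC) y
  refine ⟨Z h, hZadm h, fun z hz => ?_⟩
  have hhI : h ∈ Icc 0 h := ⟨hh0.le, le_rfl⟩
  -- For $t$ outside $[0,h]$ a dummy curve serves, so that one curve can be chosen for every real
  -- $t$.
  have hex : ∀ t, ∃ u : ℝ → EllOne 𝒩 s, t ∈ Icc 0 h →
      u 0 = z ∧ (∀ x ∈ Icc (0 : ℝ) 1, ‖u x‖ ≤ M + 1) ∧ IsSolution r A (Z t) 1 u := fun t => by
    by_cases ht : t ∈ Icc 0 h
    · obtain ⟨u, hu⟩ := exists_isSolution hflow hT' (F := Z t)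
        (hsmall t ht τ' hτ' (by linarith) _ (hZs t ht)) (z := z) (by linarith)
      exact ⟨u, fun _ => hu⟩
    · exact ⟨0, fun h => absurd h ht⟩
  choose u hu using hex
  obtain ⟨v, hv0, hvR, hv⟩ := exists_isSolution (isIsometricFlow_zero (EllOne 𝒩 s)) hT' (F := h • P)
    (hsmall h hhI τ' hτ' (by linarith) _ (by
      rw [norm_smul, Real.norm_of_nonneg hh0.le]
      exact mul_le_mul_of_nonneg_left (le_add_of_nonneg_left hS) hh0.le)) (z := phaseFlow lam z)
    (by rw [norm_phaseFlow]; linarith)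
  have hv' := hv.rescale hh0
  refine ⟨u h, fun t => v (t / h), (hu h hhI).1, by simpa using hv0, (hu h hhI).2.2, hv', ?_⟩
  have hf : ∀ t ∈ Icc 0 h, ∀ y y' : EllOne 𝒩 s, ‖y‖ ≤ M + 2 → ‖y'‖ ≤ M + 2 →
      ‖(A y + L (Z t) (tensors r y)) - (A y' + L (Z t) (tensors r y'))‖ ≤
        (C + 1) * ‖y - y'‖ := fun t ht y y' hy hy' =>
    hT1.norm_vectorField_sub_le (Z t) hAn
      (hsmall t ht τ hτ (by linarith) _ (hZs t ht)) y y' hy hy'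
  -- Since $Z(0)=0$, the trajectory for parameter $0$ is the linear flow, by comparison with zero
  -- error.
  have hu01 : u 0 1 = phaseFlow lam z := by
    have h0I : (0 : ℝ) ∈ Icc 0 h := ⟨le_rfl, hh0.le⟩
    have h1 := norm_sub_le_of_approx (f := fun y => A y + L (Z 0) (tensors r y)) (u := u 0)
      (w := fun x => linFlow s lam x z) (w' := fun x => A (linFlow s lam x z)) (R := M + 2)
      (K := C + 1) (ε := 0) (T := 1) (by positivity) le_rfl (hf 0 h0I) zero_le_one
      (fun x hx => ⟨((hu 0 h0I).2.1 x hx).trans (by linarith), (hu 0 h0I).2.2 x hx⟩)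
      (fun x _ => ⟨by rw [hflow.norm_apply]; linarith, by
        simpa using ((hflow.hasDerivAt x).clm_apply (hasDerivAt_const x z)).hasDerivWithinAt⟩)
      (fun x _ => by
        rw [hZdef, modHam_zero, map_zero, zero_apply, add_zero, sub_self, norm_zero])
      (by rw [(hu 0 h0I).1, hflow.zero_apply])
    rw [← linFlow_one, ← sub_eq_zero, ← norm_le_zero_iff]
    simpa using h1
  -- Because the generator equals `P` at $x=1$, the curve $t\mapsto u(t,1)$ solves the equation of
  -- $X_P$ up to a defect of order $h^N$.
  have hdefect : ∀ t ∈ Icc 0 h, ∀ η > 0, ∃ δ > 0, ∀ t' ∈ Icc 0 h, |t' - t| < δ →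
      ‖u t' 1 - u t 1 - (t' - t) • L P (tensors r (u t 1))‖ ≤
        (η + ρ₀ * h ^ N * Real.exp (C + 1)) * |t' - t| := by
    intro t ht η hη
    have hW := fun x (_ : x ∈ Icc (0 : ℝ) 1) => hasDerivAt_genHam (br := br) (q := q) (P := P)
      (N := N) (hasDerivAt_phase hl)
      (fun x => by rw [← phase_add, add_neg_cancel, phase_zero]) t x
    have hρ := fun x (hx : x ∈ Icc (0 : ℝ) 1) (y : EllOne 𝒩 s) (hy : ‖y‖ ≤ M + 2) =>
      norm_defect_le (Z := modCoeff br e q P) (W := fun n => genCoeff br e q P n x) hC hlam.abs_le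
        hN hl (fun n hn => ⟨(hadm n hn).1, (hadm n hn).2 x⟩) hT1 ht hh1
        (fun n hn => (hbound n).1.trans (hDS n hn))
        (fun n hn => ((hbound n).2 x hx).trans (hDS n hn)) L hL A hA hy
    have hWb := fun x (hx : x ∈ Icc (0 : ℝ) 1) =>
      norm_genHam_le (h01 t ht) fun n (_ : n < N) => (hbound n).2 x hx
    have hρ1 : 0 ≤ ρ₀ * h ^ N := by positivity
    have hC1 : 0 ≤ C + 1 := by positivity
    have hu1 := fun t ht => (hu t ht).1
    have hu2 : ∀ t ∈ Icc 0 h, ∀ x ∈ Icc (0 : ℝ) 1, ‖u t x‖ ≤ M + 1 ∧ HasDerivWithinAt (u t)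
        (A (u t x) + L (Z t) (tensors r (u t x))) (Icc 0 1) x :=
      fun t ht x hx => ⟨(hu t ht).2.1 x hx, (hu t ht).2.2 x hx⟩
    have hZd : HasDerivAt Z _ t := hasDerivAt_modHam t
    have hR : M + 1 < M + 2 := by linarith
    exact hT1.interpolation ht hZd hW (genHam_zero t) (genHam_one t hN1 hgen1) hWb hρ1 hρ hC1 hR
      hf hu1 hu2 hη
  have hmain := norm_sub_le_of_defect (X := fun y => L P (tensors r y)) (K := ‖L‖ * ‖P‖ * τ)
    (R := M + 1) (ρ := ρ₀ * h ^ N * Real.exp (C + 1)) (a := fun t => u t 1)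
    (v := fun t => v (t / h)) (T := h) (by positivity) (by positivity)
    (fun y y' hy hy' => hT1.norm_field_sub_le P y y' (by linarith) (by linarith)) hh0.le
    (fun t ht => (hu t ht).2.1 1 ⟨zero_le_one, le_rfl⟩)
    (fun t ht => ⟨hvR _ ⟨div_nonneg ht.1 hh0.le, (div_le_one hh0).mpr ht.2⟩, by
      simpa using hv' t ht⟩)
    hdefect (by simpa [hv0] using hu01)
  refine hmain.trans ?_
  -- The smallness of $h$ bounds the exponent in the second Gronwall estimate by 1; its time span
  -- $h$ provides the last power of $h$.
  have hKh : ‖L‖ * ‖P‖ * τ * h ≤ 1 := by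
    have := hsmall h hhI τ hτ (by linarith) (h • P) (by
      rw [norm_smul, Real.norm_of_nonneg hh0.le]
      exact mul_le_mul_of_nonneg_left (le_add_of_nonneg_left hS) hh0.le)
    rw [norm_smul, Real.norm_of_nonneg hh0.le] at this
    linarith
  calc _ ≤ ρ₀ * h ^ N * Real.exp (C + 1) * h * Real.exp 1 := by gcongr
    _ = _ := by ring

end SplittingBEA

end

/-! ### The CFL condition and the passage to polynomial Hamiltonians -/

noncomputable section

namespace SplittingBEA

open Set Filter Topology

variable {d : ℕ} {𝒩 : Set (Fin d → ℤ)} {s : ℝ}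

/-! ### The CFL condition -/

/-- A point $x_0>c$ with $\beta(x_0)<y$ exists by definition of the supremum, and monotonicity
bounds $\beta$ on $[0,c)$ by $b=\beta(x_0)$. The strict inequality $b<y$ is what yields a uniform
distance from the resonances. -/
lemma exists_lt_of_lt_filterInv {β : ℝ → ℝ} (hβ : IsFilterFunction β) {c y : ℝ}
    (hc : (c : EReal) < filterInv β y) :
    ∃ b, 0 ≤ b ∧ b < y ∧ ∀ x, 0 ≤ x → 0 ≤ cflFilter β c x ∧ cflFilter β c x ≤ b := by
  obtain ⟨_, ⟨x₀, ⟨hx₀, hlt⟩, rfl⟩, hcx⟩ := lt_sSup_iff.mp hc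
  have hmono := hβ.strictMonoOn.monotoneOn
  have h0 : ∀ x, 0 ≤ x → 0 ≤ β x := fun x hx => by
    have := hmono self_mem_Ici hx hx
    rwa [hβ.map_zero] at this
  refine ⟨β x₀, h0 x₀ hx₀, hlt, fun x hx => ?_⟩
  rw [cflFilter]
  split_ifs with hxc
  · exact ⟨h0 x hx, hmono hx hx₀ (hxc.trans (EReal.coe_lt_coe_iff.mp hcx)).le⟩
  · exact ⟨le_rfl, h0 x₀ hx₀⟩

/-- A word has at most `r` letters, so it suffices that all $|\lambda_a|$ stay below a fixed number
less than $2\pi/r$. The CFL condition ensures this where $\omega_a\ge0$. Negative frequencies are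
bounded below, so for small $h$ continuity of $\beta$ at 0 gives $|\lambda_a|\le\pi/r$. -/
lemma exists_isNonresonant {ω : 𝒩 → ℝ} (hω : BddBelow (range ω)) {r : ℕ} (hr : 0 < r) {β : ℝ → ℝ}
    (hβ : IsFilterFunction β) {c : ℝ} (hc : (c : EReal) < filterInv β (2 * Real.pi / r))
    (σ : Prop) :
    ∃ h₁ > 0, ∃ C κ : ℝ, 0 ≤ C ∧ κ < 2 * Real.pi ∧ ∀ h, 0 < h → h ≤ h₁ →
      IsNonresonant σ r C κ fun a => cflFilter β c (h * ω a) := by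
  obtain ⟨b, hb0, hb, hβb⟩ := exists_lt_of_lt_filterInv hβ hc
  have hr' : (0 : ℝ) < r := by exact_mod_cast hr
  have hπ := Real.pi_pos
  obtain ⟨ε, hε, hcont⟩ := Metric.continuousAt_iff.mp hβ.hasDerivAt_zero.continuousAt
    (Real.pi / r) (by positivity)
  obtain ⟨B, hB⟩ := hω
  have hB' : ∀ a, -|B| ≤ ω a := fun a => (neg_abs_le B).trans (hB (mem_range_self a))
  have hC : max b (Real.pi / r) < 2 * Real.pi / r :=
    max_lt hb (div_lt_div_of_pos_right (by linarith) hr')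
  refine ⟨ε / (|B| + 1), by positivity, max b (Real.pi / r), r * max b (Real.pi / r),
    le_max_of_le_left hb0, by rwa [lt_div_iff₀' hr'] at hC, fun h h0 hle => ?_⟩
  have hbound : ∀ a, |cflFilter β c (h * ω a)| ≤ max b (Real.pi / r) := fun a => by
    rcases le_or_gt 0 (h * ω a) with hx | hx
    · obtain ⟨h1, h2⟩ := hβb _ hx
      rw [abs_of_nonneg h1]
      exact le_max_of_le_left h2
    · refine le_max_of_le_right ?_
      rw [cflFilter]
      split_ifs
      · rw [le_div_iff₀ (by positivity)] at hle
        have h1 : |h * ω a| < ε := by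
          rw [abs_of_neg hx]
          nlinarith [hB' a, abs_nonneg B]
        have h2 := hcont (x := h * ω a) (by rwa [Real.dist_eq, sub_zero])
        rw [hβ.map_zero, Real.dist_eq, sub_zero] at h2
        exact h2.le
      · rw [abs_zero]; positivity
  refine ⟨hbound, fun w hw => (abs_freq_le hbound w).trans ?_⟩
  exact mul_le_mul_of_nonneg_right (by exact_mod_cast hw.length_le) (le_max_of_le_left hb0)

lemma freq_sub_const (lam : 𝒩 → ℝ) (b : ℝ) (w : List (Idx 𝒩)) :
    freq (fun a => lam a - b) w = freq lam w - b * charge w := by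
  induction w with
  | nil => simp [freq, charge]
  | cons a w ih =>
    simp only [freq, charge, List.map_cons, List.sum_cons] at ih ⊢
    rw [ih]
    push_cast
    ring

/-- On words of zero charge a constant may be subtracted from all $\lambda_a$ without changing the
frequency. As $0\le\lambda_a\le b$, subtracting $b/2$ halves the bound per letter, so $b<4\pi/r$
suffices. -/
lemma exists_isNonresonant_of_symmetric {ω : 𝒩 → ℝ} (hω : ∀ a, 0 ≤ ω a) {r : ℕ} (hr : 0 < r)
    {β : ℝ → ℝ} (hβ : IsFilterFunction β) {c : ℝ}
    (hc : (c : EReal) < filterInv β (4 * Real.pi / r)) :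
    ∃ C κ : ℝ, 0 ≤ C ∧ κ < 2 * Real.pi ∧ ∀ h, 0 < h →
      IsNonresonant True r C κ fun a => cflFilter β c (h * ω a) := by
  obtain ⟨b, hb0, hb, hβb⟩ := exists_lt_of_lt_filterInv hβ hc
  have hr' : (0 : ℝ) < r := by exact_mod_cast hr
  rw [lt_div_iff₀' hr'] at hb
  refine ⟨b, r * (b / 2), hb0, by linarith, fun h h0 => ?_⟩
  have h1 := fun a => hβb (h * ω a) (mul_nonneg h0.le (hω a))
  refine ⟨fun a => abs_le.mpr ⟨by linarith [(h1 a).1], (h1 a).2⟩, fun w hw => ?_⟩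
  have h2 := freq_sub_const (fun a => cflFilter β c (h * ω a)) (b / 2) w
  rw [hw.charge_eq trivial, Int.cast_zero, mul_zero, sub_zero] at h2
  rw [← h2]
  refine (abs_freq_le (C := b / 2) (fun a => abs_le.mpr
    ⟨by linarith [(h1 a).1], by linarith [(h1 a).2]⟩) w).trans ?_
  exact mul_le_mul_of_nonneg_right (by exact_mod_cast hw.length_le) (by positivity)

/-! ### Polynomial Hamiltonians and coefficient families -/

section PolyHam

variable {k : ℕ} {σ : Prop}

/-- The coefficient family of a polynomial Hamiltonian. -/
def PolyHam.coeffs (P : PolyHam 𝒩 k) : Coeffs 𝒩 :=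
  bddFamily (fun w => P.coeff (List.equivSigmaTuple w).1 (List.equivSigmaTuple w).2)
    P.bounded.choose fun _ => P.bounded.choose_spec _ _

lemma PolyHam.coeffs_ofFn (P : PolyHam 𝒩 k) (l : ℕ) (j : Fin l → Idx 𝒩) :
    P.coeffs (List.ofFn j) = P.coeff l j := by
  have h : List.equivSigmaTuple (List.ofFn j) = ⟨l, j⟩ :=
    List.equivSigmaTuple.apply_symm_apply ⟨l, j⟩
  change P.coeff (List.equivSigmaTuple (List.ofFn j)).1 (List.equivSigmaTuple (List.ofFn j)).2 = _
  rw [h]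

lemma exists_eq_ofFn {α : Type*} (w : List α) : ∃ (l : ℕ) (j : Fin l → α), w = List.ofFn j :=
  ⟨w.length, w.get, (List.ofFn_get w).symm⟩

lemma mom_ofFn {l : ℕ} (j : Fin l → Idx 𝒩) : mom (List.ofFn j) = momentum j := by
  rw [mom, List.map_ofFn, List.sum_ofFn]
  rfl

lemma charge_ofFn {l : ℕ} (j : Fin l → Idx 𝒩) : charge (List.ofFn j) =
    ((Finset.univ.filter fun i => (j i).2 = 1).card : ℤ) -
      (Finset.univ.filter fun i => (j i).2 = -1).card := by
  rw [charge, List.map_ofFn, List.sum_ofFn, Finset.card_filter, Finset.card_filter]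
  push_cast
  rw [← Finset.sum_sub_distrib]
  refine Finset.sum_congr rfl fun i _ => ?_
  rcases Int.units_eq_one_or (j i).2 with h | h <;> simp [h]

lemma PolyHam.isAdmissible_coeffs (P : PolyHam 𝒩 k) (hσ : σ → P.IsSymmetric) :
    IsAdmissible σ k P.coeffs := by
  constructor
  · intro w hw
    obtain ⟨l, j, rfl⟩ := exists_eq_ofFn w
    rw [P.coeffs_ofFn] at hw
    refine ⟨by rw [mom_ofFn, P.zero_momentum l j hw], fun h => ?_, ?_, ?_⟩
    · rw [charge_ofFn, hσ h l j hw, sub_self]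
    · simpa using (P.degree l j hw).1
    · simpa using (P.degree l j hw).2
  · intro w
    obtain ⟨l, j, rfl⟩ := exists_eq_ofFn w
    rw [List.map_ofFn, P.coeffs_ofFn, P.coeffs_ofFn]
    exact P.real l j

/-- The polynomial Hamiltonian with an admissible coefficient family. -/
def PolyHam.ofCoeffs (F : Coeffs 𝒩) (hF : IsAdmissible σ k F) : PolyHam 𝒩 k where
  coeff _ j := F (List.ofFn j)
  degree _ j h := by
    have := hF.allowed _ h
    exact ⟨by simpa using this.two_le, by simpa using this.length_le⟩
  zero_momentum _ j h := by rw [← mom_ofFn]; exact hF.zeroMom _ h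
  real _ j := by
    rw [← hF.real, List.map_ofFn]
    rfl
  bounded := ⟨‖F‖, fun _ _ => F.norm_apply_le _⟩

end PolyHam

/-! ### Trajectories -/

lemma isTrajectory_iff [Fact (0 ≤ s)] {r : ℕ} {H : (Idx 𝒩 → ℂ) → ℂ} {F : Coeffs 𝒩}
    (hH : ∀ (z : EllOne 𝒩 s) b, hamField H z.coord b = (hamL 𝒩 s r F (tensors r z)).coord b)
    {T : ℝ} {u : ℝ → EllOne 𝒩 s} : IsTrajectory H T u ↔ IsSolution r 0 F T u := by
  refine forall₂_congr fun t _ => ?_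
  rw [zero_apply, zero_add]
  constructor
  · rintro ⟨v, hv, hd⟩
    rwa [EllOne.ext fun b => (hv b).trans (hH (u t) b)] at hd
  · exact fun hd => ⟨_, fun b => (hH (u t) b).symm, hd⟩

/-- Uniqueness of flows: the error estimate concerns arbitrary end points $w_1,w_2$, which must
coincide with those of the constructed trajectories. The common ball comes from compactness of
$[0,T]$. -/
lemma IsSolution.eq [Fact (0 ≤ s)] {r : ℕ} {A : EllOne 𝒩 s →L[ℝ] EllOne 𝒩 s} {F : Coeffs 𝒩}
    {T : ℝ} (hT : 0 ≤ T) {u v : ℝ → EllOne 𝒩 s} (hu : IsSolution r A F T u)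
    (hv : IsSolution r A F T v) (h0 : u 0 = v 0) : u T = v T := by
  have hb : ∀ w : ℝ → EllOne 𝒩 s, IsSolution r A F T w → ∃ R, ∀ t ∈ Icc 0 T, ‖w t‖ ≤ R :=
    fun w hw => by
      obtain ⟨R, hR⟩ := isCompact_Icc.bddAbove_image (f := fun t => ‖w t‖) (K := Icc 0 T)
        (ContinuousOn.norm fun t ht => (hw t ht).continuousWithinAt)
      exact ⟨R, fun t ht => hR ⟨t, ht, rfl⟩⟩
  obtain ⟨R₁, h₁⟩ := hb u hu
  obtain ⟨R₂, h₂⟩ := hb v hv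
  obtain ⟨τ, hτ⟩ := exists_isTameOn_tensors 𝒩 s r (max R₁ R₂)
  have hτ0 := hτ.nonneg
  have := norm_sub_le_of_approx (f := fun y => A y + realHamL 𝒩 s r F (tensors r y))
    (K := ‖A‖ + ‖realHamL 𝒩 s r‖ * ‖F‖ * τ) (R := max R₁ R₂) (ε := 0) (u := u) (w := v)
    (by positivity) le_rfl (hτ.norm_vectorField_sub_le F le_rfl le_rfl) hT
    (fun t ht => ⟨(h₁ t ht).trans (le_max_left _ _), hu t ht⟩)
    (fun t ht => ⟨(h₂ t ht).trans (le_max_right _ _), hv t ht⟩) (fun t _ => by simp) h0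
  rw [← sub_eq_zero, ← norm_le_zero_iff]
  simpa using this

/-- The backward error analysis, for a class of frequencies without resonances. -/
theorem exists_backward_error [Fact (0 ≤ s)] {σ : Prop} {r₀ r : ℕ} (hr₀ : 3 ≤ r₀) (hr : r₀ ≤ r)
    (P : PolyHam 𝒩 r₀) (hσ : σ → P.IsSymmetric) {C κ : ℝ} (hC : 0 ≤ C) (hκ : κ < 2 * Real.pi)
    (M : ℝ) :
    ∃ h₀ > 0, ∃ C' : ℝ, ∀ lam : 𝒩 → ℝ, IsNonresonant σ r C κ lam → ∀ h, 0 < h → h ≤ h₀ →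
      ∃ H : PolyHam 𝒩 r, ∀ z : EllOne 𝒩 s, ‖z‖ ≤ M →
        (∃ w₁ : EllOne 𝒩 s, FlowsTo P.eval h (phaseFlow lam z) w₁) ∧
        (∃ w₂ : EllOne 𝒩 s, FlowsTo H.eval h z w₂) ∧
        ∀ w₁ w₂ : EllOne 𝒩 s, FlowsTo P.eval h (phaseFlow lam z) w₁ → FlowsTo H.eval h z w₂ →
          ‖w₁ - w₂‖ ≤ C' * h ^ ((r - 2) / (r₀ - 2) + 1) := by
  obtain ⟨m, rfl⟩ := Nat.exists_eq_add_of_le' (show 2 ≤ r₀ by omega)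
  rw [Nat.add_sub_cancel]
  -- The largest number of orders for which $Nm+2\le r$, with $m=r_0-2$.
  set N := (r - 2) / m
  have hN1 : 1 ≤ N := (Nat.one_le_div_iff (by omega)).mpr (by omega)
  have hN : N * m + 2 ≤ r := by
    have : N * m ≤ r - 2 := Nat.div_mul_le_self (r - 2) m
    omega
  have hP := P.isAdmissible_coeffs hσ
  obtain ⟨h₀, hh₀, C', hmod⟩ := exists_modified (s := s) hN1 hN hC hκ hP M
  refine ⟨h₀, hh₀, C', fun lam hlam h h0 hle => ?_⟩
  obtain ⟨Z, hZ, hsol⟩ := hmod lam hlam h h0 hle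
  obtain ⟨n, hn⟩ := Nat.exists_eq_add_of_le' (show 1 ≤ r by omega)
  have hQb : ∀ w, ‖quadFun lam w‖ ≤ C := fun w => by
    unfold quadFun
    split
    · rename_i b c
      split_ifs
      · rw [norm_div, Complex.norm_real, Real.norm_eq_abs, Complex.norm_ofNat]
        linarith [hlam.abs_le b.1]
      · rwa [norm_zero]
    · rwa [norm_zero]
  set Q : Coeffs 𝒩 := bddFamily (quadFun lam) C hQb
  have hQ : IsAdmissible σ r Q := (isAdmissible_quadFun σ lam).mono (by omega)
  -- The time-one flow of $A_0+Z$ is the time-$h$ flow of $h^{-1}(A_0+Z)$.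
  have hF : IsAdmissible σ r (h⁻¹ • (Q + Z) : Coeffs 𝒩) := (hQ.add hZ).smul h⁻¹
  set F : Coeffs 𝒩 := h⁻¹ • (Q + Z) with hFdef
  have hHfield : ∀ (z : EllOne 𝒩 s) b, hamField (PolyHam.ofCoeffs F hF).eval z.coord b =
      (hamL 𝒩 s r F (tensors r z)).coord b := fun z b =>
    (PolyHam.ofCoeffs F hF).hamField_eval (hn ▸ hF) (fun _ _ => rfl) le_rfl hn.ge z b
  have hPfield : ∀ (z : EllOne 𝒩 s) b, hamField P.eval z.coord b =
      (hamL 𝒩 s r P.coeffs (tensors r z)).coord b := fun z b =>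
    P.hamField_eval (n := m + 1) hP (fun l j => (P.coeffs_ofFn l j).symm) hr (by omega) z b
  refine ⟨PolyHam.ofCoeffs F hF, fun z hz => ?_⟩
  obtain ⟨u, v, hu0, hv0, hu, hv, hest⟩ := hsol z hz
  have hu' : IsSolution r 0 (h • F) 1 u := fun t ht => by
    refine (hu t ht).congr_deriv ?_
    rw [hFdef, smul_smul, mul_inv_cancel₀ h0.ne', one_smul, map_add, add_apply, zero_apply,
      zero_add]
    congr 1
    exact (hamL_quadFun (Q := Q) (fun _ => rfl) (by omega) (norm_symplSign_mul_le hlam.abs_le)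
      (u t)).symm
  have hu'' := hu'.rescale h0
  have huh : u (h / h) = u 1 := by rw [div_self h0.ne']
  refine ⟨⟨v h, v, hv0, rfl, (isTrajectory_iff hPfield).mpr hv⟩,
    ⟨u 1, fun t => u (t / h), by simpa using hu0, huh, (isTrajectory_iff hHfield).mpr hu''⟩, ?_⟩
  rintro w₁ w₂ ⟨v', hv'0, rfl, hv'⟩ ⟨u', hu'0, rfl, hu1⟩
  rw [IsSolution.eq h0.le ((isTrajectory_iff hPfield).mp hv') hv (hv'0.trans hv0.symm),
    IsSolution.eq h0.le ((isTrajectory_iff hHfield).mp hu1) hu'' (by simpa [hu0] using hu'0),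
    norm_sub_rev, huh]
  exact hest

end SplittingBEA

end

/-! ### The theorem, under either CFL condition -/

theorem mainTheorem5 {d : ℕ} (𝒩 : Set (Fin d → ℤ)) (ω : 𝒩 → ℝ)
    (hω : BddBelow (Set.range ω))
    (r₀ r : ℕ) (hr₀ : 3 ≤ r₀) (hr : r₀ ≤ r) (s M : ℝ) (hs : 0 ≤ s) (hM : 0 < M)
    (P : SplittingBEA.PolyHam 𝒩 r₀)
    (β : ℝ → ℝ) (hβ : SplittingBEA.IsFilterFunction β) (c : ℝ)
    (hc : (c : EReal) < SplittingBEA.filterInv β (2 * Real.pi / r) ∨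
      (P.IsSymmetric ∧ (∀ a, 0 ≤ ω a) ∧
        (c : EReal) < SplittingBEA.filterInv β (4 * Real.pi / r))) :
    ∃ h₀ : ℝ, 0 < h₀ ∧ ∃ C : ℝ, ∀ h : ℝ, 0 < h → h ≤ h₀ →
      ∃ H : SplittingBEA.PolyHam 𝒩 r, ∀ z : SplittingBEA.EllOne 𝒩 s, ‖z‖ ≤ M →
        (∃ w₁ : SplittingBEA.EllOne 𝒩 s,
          SplittingBEA.FlowsTo P.eval h (SplittingBEA.linearStep ω β c h z) w₁) ∧
        (∃ w₂ : SplittingBEA.EllOne 𝒩 s, SplittingBEA.FlowsTo H.eval h z w₂) ∧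
        ∀ w₁ w₂ : SplittingBEA.EllOne 𝒩 s,
          SplittingBEA.FlowsTo P.eval h (SplittingBEA.linearStep ω β c h z) w₁ →
          SplittingBEA.FlowsTo H.eval h z w₂ →
          -- natural-number division: the exponent is `⌊(r - 2) / (r₀ - 2)⌋ + 1`
          ‖w₁ - w₂‖ ≤ C * h ^ ((r - 2) / (r₀ - 2) + 1) := by
  have : Fact (0 ≤ s) := ⟨hs⟩
  rcases hc with hc | ⟨hP, hω0, hc⟩
  -- In the general case no charge condition is imposed on the words, hence the flag `False`; the
  -- symmetric case takes `True`.
  · obtain ⟨h₁, hh₁, B, κ, hB, hκ, hnon⟩ :=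
      SplittingBEA.exists_isNonresonant hω (by omega) hβ hc False
    obtain ⟨h₂, hh₂, C, H⟩ :=
      SplittingBEA.exists_backward_error (s := s) hr₀ hr P False.elim hB hκ M
    exact ⟨min h₁ h₂, lt_min hh₁ hh₂, C, fun h h0 hle =>
      H _ (hnon h h0 (hle.trans (min_le_left _ _))) h h0 (hle.trans (min_le_right _ _))⟩
  · obtain ⟨B, κ, hB, hκ, hnon⟩ :=
      SplittingBEA.exists_isNonresonant_of_symmetric hω0 (by omega) hβ hc
    obtain ⟨h₂, hh₂, C, H⟩ :=
      SplittingBEA.exists_backward_error (s := s) hr₀ hr P (fun _ => hP) hB hκ M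
    exact ⟨h₂, hh₂, C, fun h h0 hle => H _ (hnon h h0) h h0 hle⟩
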